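/- Let $\zeta,\zeta_1,\zeta_2,\ldots$ be i.i.d. random variables on $\mathbb{Z}^2$ and let $\|\cdot\|$ be the Euclidean norm. Suppose that $\mathbb{E}[\|\zeta\|^\nu]<\infty$ for some $\nu>2$, that $\mathbb{E}\zeta=0$, that there is $R\in\{0,1,2,\ldots\}$ such that both components of $\zeta$ are almost surely at least $-R$, and that the matrix $\Sigma=\mathbb{E}[\zeta\zeta^{\top}]$ is positive definite; let $\rho=\Sigma_{12}/\sqrt{\Sigma_{11}\Sigma_{22}}\in(-1,1)$. Let $Z=(Z_n)_{n\ge 0}$ be either the Lindley random walk $Z_{n+1}=(Z_n+\zeta_{n+1})^+$ or the mirror-reflected random walk $Z_{n+1}=|Z_n+\zeta_{n+1}|$ on $\mathbb{X}=\{0,1,2,\ldots\}^2$, where the positive part and the absolute value act componentwise, and write $\mathbb{P}_z$ for the law of the walk started from $Z_0=z$. Suppose that the Markov chain $Z$ is irreducible on $\mathbb{X}$. Then $Z$ is recurrent if $\rho>0$, and $Z$ is transient if $\rho<0$. Moreover, if $\rho>0$, then for every $r>0$ there exists $r_0>r$ such that, with $\tau_Z(r)=\inf\{n\ge 0:\|Z_n\|\le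 r\}$, \[ \lim_{n\to\infty}\frac{\log \mathbb{P}_z(\tau_Z(r)>n)}{\log n}=-\left(1-\frac{\pi}{2\arccos(-\rho)}\right)\quad\text{for all } z\in\mathbb{X}\text{ with }\|z\|>r_0 . \] -/

import Mathlib

namespace ReflectedWalk

open MeasureTheory ProbabilityTheory

noncomputable section

/-- The point of the Euclidean plane with the given integer coordinates. -/
def toPlane (z : ℤ × ℤ) : EuclideanSpace ℝ (Fin 2) := !₂[(z.1 : ℝ), (z.2 : ℝ)]

/-- Euclidean norm of a state of the quadrant `ℤ₊² = ℕ × ℕ`. -/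
def stateNorm (z : ℕ × ℕ) : ℝ := ‖toPlane ((z.1 : ℤ), (z.2 : ℤ))‖

/-- Componentwise positive part, `(x, y) ↦ (max x 0, max y 0)`. -/
def clipPart (v : ℤ × ℤ) : ℕ × ℕ := (v.1.toNat, v.2.toNat)

/-- Componentwise absolute value, `(x, y) ↦ (|x|, |y|)`. -/
def absPart (v : ℤ × ℤ) : ℕ × ℕ := (v.1.natAbs, v.2.natAbs)

/-- The sum of a state of the quadrant and an increment. -/
def addStep (z : ℕ × ℕ) (v : ℤ × ℤ) : ℤ × ℤ := ((z.1 : ℤ) + v.1, (z.2 : ℤ) + v.2)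

/-- The Lindley random walk started from `z`: `L₀ = z` and `L_{n+1} = (L_n + ζ_{n+1})⁺`. -/
def lindley {Ω : Type*} (ζ : ℕ → Ω → ℤ × ℤ) (z : ℕ × ℕ) : ℕ → Ω → ℕ × ℕ
  | 0, _ => z
  | n + 1, ω => clipPart (addStep (lindley ζ z n ω) (ζ (n + 1) ω))

/-- The mirror-reflected random walk started from `z`: `M₀ = z` and
`M_{n+1} = |M_n + ζ_{n+1}|`. -/
def mirror {Ω : Type*} (ζ : ℕ → Ω → ℤ × ℤ) (z : ℕ × ℕ) : ℕ → Ω → ℕ × ℕ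
  | 0, _ => z
  | n + 1, ω => absPart (addStep (mirror ζ z n ω) (ζ (n + 1) ω))

/-- The variables `ζ 0, ζ 1, ζ 2, …` are independent and identically distributed. -/
structure IsIID {Ω : Type*} [MeasurableSpace Ω] (μ : Measure Ω) (ζ : ℕ → Ω → ℤ × ℤ) : Prop where
  measurable : ∀ n, Measurable (ζ n)
  indep : iIndepFun ζ μ
  identDistrib : ∀ n, IdentDistrib (ζ n) (ζ 0) μ μ

/-- The matrix `Σ = E[ξ ξᵀ]`. -/
def secondMoment {Ω : Type*} [MeasurableSpace Ω] (μ : Measure Ω) (ξ : Ω → ℤ × ℤ) :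
    Matrix (Fin 2) (Fin 2) ℝ :=
  Matrix.of fun i j => ∫ ω, toPlane (ξ ω) i * toPlane (ξ ω) j ∂μ

/-- The correlation coefficient `ρ = Σ₁₂ / √(Σ₁₁ Σ₂₂)`. -/
def correlation {Ω : Type*} [MeasurableSpace Ω] (μ : Measure Ω) (ξ : Ω → ℤ × ℤ) : ℝ :=
  secondMoment μ ξ 0 1 / √(secondMoment μ ξ 0 0 * secondMoment μ ξ 1 1)

/-- The assumption on the increment law: a moment of order `ν > 2`, zero mean, components bounded
below by a constant, and `Σ` positive definite. -/
structure IncrementHypothesis {Ω : Type*} [MeasurableSpace Ω] (μ : Measure Ω)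
    (ξ : Ω → ℤ × ℤ) : Prop where
  moment : ∃ ν : ℝ, 2 < ν ∧ Integrable (fun ω => ‖toPlane (ξ ω)‖ ^ ν) μ
  mean_zero : ∫ ω, toPlane (ξ ω) ∂μ = 0
  bounded_below : ∃ R : ℕ, ∀ k : Fin 2, ∀ᵐ ω ∂μ, -(R : ℝ) ≤ toPlane (ξ ω) k
  posDef : (secondMoment μ ξ).PosDef

/- In the following, `Z z n` is the state at time `n` of the chain started from `z`, so that
the probability of an event for `Z z` is its probability under the law `P_z`. -/

/-- Every state is reached from every state with positive probability. -/
def IsIrreducible {Ω : Type*} [MeasurableSpace Ω] (μ : Measure Ω)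
    (Z : ℕ × ℕ → ℕ → Ω → ℕ × ℕ) : Prop :=
  ∀ z w : ℕ × ℕ, ∃ n : ℕ, 0 < μ {ω | Z z n ω = w}

/-- Every state is recurrent: the chain returns to its starting point almost surely. -/
def IsRecurrent {Ω : Type*} [MeasurableSpace Ω] (μ : Measure Ω)
    (Z : ℕ × ℕ → ℕ → Ω → ℕ × ℕ) : Prop :=
  ∀ z : ℕ × ℕ, μ {ω | ∃ n : ℕ, 1 ≤ n ∧ Z z n ω = z} = 1

/-- Every state is transient: the chain returns to its starting point with probability
less than one. -/
def IsTransient {Ω : Type*} [MeasurableSpace Ω] (μ : Measure Ω)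
    (Z : ℕ × ℕ → ℕ → Ω → ℕ × ℕ) : Prop :=
  ∀ z : ℕ × ℕ, μ {ω | ∃ n : ℕ, 1 ≤ n ∧ Z z n ω = z} < 1

/-- The first passage time `τ(r) = inf {n ≥ 0 : ‖Z_n‖ ≤ r}` of a trajectory, equal to `⊤` if the
ball is never visited. -/
def passageTime (path : ℕ → ℕ × ℕ) (r : ℝ) : ℕ∞ :=
  ⨅ (n : ℕ) (_ : stateNorm (path n) ≤ r), (n : ℕ∞)

end

end ReflectedWalk

namespace ReflectedWalk

open MeasureTheory ProbabilityTheory Set Filter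

noncomputable section

/-! Divide the coordinates by the standard deviations, so that the increments have unit variances
and correlation ρ. Put ξ = arccos(-ρ) and e = exp(iξ). Because 1 + 2ρe + e² = 0, the linear map (X,
Y) ↦ X + Ye carries the quadrant to a wedge of opening ξ, and real parts of holomorphic functions on
the wedge pull back to functions annihilated by ∂_XX + 2ρ ∂_XY + ∂_YY. In polar coordinates (r, φ)
of the wedge, the function r^a cos(a(φ - ξ/2)) is of this kind. It is positive for |a| < 1, and on
either side its derivative in the direction of reflection is a r^(a-1) cos(ξ - aξ/2). The cosine
changes sign at the critical exponent α = 2 - π/ξ, which has the sign of ρ. A small multiple of (X +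
Y)^a makes the inequalities strict, and the discrete walk then has a drift of order size^(a-2) far
from the origin (`NormalizedIncrement.drift`, `IsReflectedWalk.exists_lyapunov`). The two
reflections are treated together: each pushes the walk by θ times the overshoot, with θ = 1 or θ =
2.

Let ρ > 0. For 0 < a < α there is a supermartingale comparable to size^a. The walk then either
reaches size √n, with probability O(n^(-a/2)), or is absorbed in mean time O(n^(1-a/2)); hence P(τ >
n) = O(n^(-a/2)), which also gives recurrence (`IsReflectedWalk.exists_survival_le`). For α < a < 1
there is a submartingale instead. It bounds below, by a multiple of n^(-a/2), the probability of
reaching size of order √n, and from there the return takes of order n steps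
(`IsReflectedWalk.exists_le_survival`). Letting a tend to α gives the exponent α/2 = 1 - π/(2ξ).

Let ρ < 0. For α < a < 0 there is a positive supermartingale vanishing at infinity, so that from far
away a given state is avoided with positive probability (`IsReflectedWalk.exists_survival_ge_half`),
and irreducibility turns this into transience. -/

/-! ### Taylor expansion of complex powers -/

lemma norm_sub_le_of_deriv_le {g g' : ℝ → ℂ} {C : ℝ}
    (hg : ∀ t ∈ Icc (0 : ℝ) 1, HasDerivAt g (g' t) t)
    (hC : ∀ t ∈ Icc (0 : ℝ) 1, ‖g' t‖ ≤ C) {t : ℝ} (ht : t ∈ Icc (0 : ℝ) 1) :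
    ‖g t - g 0‖ ≤ C := by
  have h0 : (0 : ℝ) ∈ Icc (0 : ℝ) 1 := ⟨le_refl _, zero_le_one⟩
  have h := Convex.norm_image_sub_le_of_norm_hasDerivWithin_le
    (fun t ht => (hg t ht).hasDerivWithinAt) hC (convex_Icc (0 : ℝ) 1) h0 ht
  have hC0 : 0 ≤ C := (norm_nonneg _).trans (hC 0 h0)
  have h1 : ‖t - 0‖ ≤ 1 := by
    rw [sub_zero, Real.norm_eq_abs, abs_of_nonneg ht.1]; exact ht.2
  exact h.trans (mul_le_of_le_one_right hC0 h1)

/-- Second order Taylor expansion on the unit interval with a crude remainder. -/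
lemma norm_taylor_two_le {g₀ g₁ g₂ g₃ : ℝ → ℂ} {C : ℝ}
    (h₀ : ∀ t ∈ Icc (0 : ℝ) 1, HasDerivAt g₀ (g₁ t) t)
    (h₁ : ∀ t ∈ Icc (0 : ℝ) 1, HasDerivAt g₁ (g₂ t) t)
    (h₂ : ∀ t ∈ Icc (0 : ℝ) 1, HasDerivAt g₂ (g₃ t) t)
    (hC : ∀ t ∈ Icc (0 : ℝ) 1, ‖g₃ t‖ ≤ C) :
    ‖g₀ 1 - g₀ 0 - g₁ 0 - g₂ 0 / 2‖ ≤ C := by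
  have hof : ∀ t : ℝ, HasDerivAt (fun t : ℝ => (t : ℂ)) 1 t := fun t =>
    (hasDerivAt_id (t : ℂ)).comp_ofReal
  have e₂ : ∀ t ∈ Icc (0 : ℝ) 1, ‖g₂ t - g₂ 0‖ ≤ C := fun t ht =>
    norm_sub_le_of_deriv_le h₂ hC ht
  have e₁ : ∀ t ∈ Icc (0 : ℝ) 1, ‖g₁ t - t * g₂ 0 - g₁ 0‖ ≤ C := by
    intro t ht
    have := norm_sub_le_of_deriv_le (g := fun t => g₁ t - t * g₂ 0) (g' := fun t => g₂ t - g₂ 0)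
      (fun t ht => by simpa using (h₁ t ht).fun_sub ((hof t).mul_const (g₂ 0))) e₂ ht
    simpa using this
  have e₀ := norm_sub_le_of_deriv_le
      (g := fun t => g₀ t - (t : ℂ) ^ 2 / 2 * g₂ 0 - t * g₁ 0)
      (g' := fun t => g₁ t - t * g₂ 0 - g₁ 0)
      (fun t ht => by
        have hq : HasDerivAt (fun t : ℝ => (t : ℂ) ^ 2 / 2) (t : ℂ) t := by
          have := ((hof t).pow 2).div_const 2
          simpa using this
        simpa using ((h₀ t ht).fun_sub (hq.mul_const (g₂ 0))).fun_sub ((hof t).mul_const (g₁ 0)))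
      e₁ (t := 1) ⟨zero_le_one, le_refl _⟩
  refine le_of_eq_of_le ?_ e₀
  congr 1
  simp
  ring

lemma hasDerivAt_cpow_line {p q : ℂ} {a : ℝ} {t : ℝ} (h : p + t * q ∈ Complex.slitPlane) :
    HasDerivAt (fun t : ℝ => (p + t * q) ^ (a : ℂ))
      (a * (p + t * q) ^ ((a - 1 : ℝ) : ℂ) * q) t := by
  have h1 : HasDerivAt (fun s : ℂ => p + s * q) q (t : ℂ) := by
    simpa using ((hasDerivAt_id (t : ℂ)).mul_const q).const_add p
  have := (h1.cpow_const (c := (a : ℂ)) h).comp_ofReal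
  simpa using this

lemma rpow_le_two_pow_mul {x y s : ℝ} (hx : 0 < x) (h1 : x / 2 ≤ y) (h2 : y ≤ 2 * x) :
    y ^ s ≤ 2 ^ |s| * x ^ s := by
  have hy : 0 < y := by linarith
  rcases le_total 0 s with hs | hs
  · rw [abs_of_nonneg hs, ← Real.mul_rpow (by norm_num) hx.le]
    exact Real.rpow_le_rpow hy.le h2 hs
  · calc y ^ s ≤ (x / 2) ^ s := Real.rpow_le_rpow_of_nonpos (by linarith) h1 hs
      _ = 2 ^ |s| * x ^ s := by
        rw [Real.div_rpow hx.le (by norm_num), abs_of_nonpos hs, Real.rpow_neg (by norm_num)]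
        field_simp

/-- The whole segment stays within a factor 2 of ‖p‖ in norm, so the third derivative along it is at
most a multiple of ‖p‖^(a-3) ‖q‖³. -/
lemma cpow_taylor_of_small (a : ℝ) : ∃ C : ℝ, 0 ≤ C ∧ ∀ p q : ℂ,
    (∀ t ∈ Icc (0 : ℝ) 1, p + t * q ∈ Complex.slitPlane) → ‖q‖ ≤ ‖p‖ / 2 →
    ‖(p + q) ^ (a : ℂ) - p ^ (a : ℂ) - a * p ^ ((a - 1 : ℝ) : ℂ) * q
      - a * (a - 1) / 2 * p ^ ((a - 2 : ℝ) : ℂ) * q ^ 2‖ ≤ C * ‖p‖ ^ (a - 3) * ‖q‖ ^ (3 : ℝ) := by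
  refine ⟨|a| * |a - 1| * |a - 2| * 2 ^ |a - 3|, by positivity, fun p q hs hq => ?_⟩
  have hp : 0 < ‖p‖ := by
    have := hs 0 ⟨le_refl _, zero_le_one⟩
    simp only [Complex.ofReal_zero, zero_mul, add_zero] at this
    exact norm_pos_iff.2 (Complex.slitPlane_ne_zero this)
  have key := norm_taylor_two_le (g₀ := fun t : ℝ => (p + t * q) ^ (a : ℂ))
    (g₁ := fun t => a * (p + t * q) ^ ((a - 1 : ℝ) : ℂ) * q)
    (g₂ := fun t => a * (a - 1) * (p + t * q) ^ ((a - 2 : ℝ) : ℂ) * q ^ 2)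
    (g₃ := fun t => a * (a - 1) * (a - 2) * (p + t * q) ^ ((a - 3 : ℝ) : ℂ) * q ^ 3)
    (C := |a| * |a - 1| * |a - 2| * 2 ^ |a - 3| * ‖p‖ ^ (a - 3) * ‖q‖ ^ (3 : ℝ))
    (fun t ht => hasDerivAt_cpow_line (hs t ht))
    (fun t ht => by
      have := ((hasDerivAt_cpow_line (a := a - 1) (hs t ht)).const_mul (a : ℂ)).mul_const q
      refine this.congr_deriv ?_
      rw [show a - 1 - 1 = a - 2 by ring]; push_cast; ring)
    (fun t ht => by
      have := ((hasDerivAt_cpow_line (a := a - 2) (hs t ht)).const_mul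
        ((a : ℂ) * (a - 1))).mul_const (q ^ 2)
      refine this.congr_deriv ?_
      rw [show a - 2 - 1 = a - 3 by ring]; push_cast; ring)
    (fun t ht => by
      have hb : ‖(t : ℂ) * q‖ ≤ ‖p‖ / 2 := by
        rw [norm_mul, Complex.norm_real, Real.norm_eq_abs, abs_of_nonneg ht.1]
        nlinarith [ht.2, norm_nonneg q]
      have l1 : ‖p‖ / 2 ≤ ‖p + t * q‖ := by
        have := norm_sub_norm_le p (-(t * q))
        rw [norm_neg, sub_neg_eq_add] at this
        linarith
      have l2 : ‖p + t * q‖ ≤ 2 * ‖p‖ := (norm_add_le _ _).trans (by linarith)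
      have := rpow_le_two_pow_mul (s := a - 3) hp l1 l2
      have e1 : ‖(a : ℂ) - 1‖ = |a - 1| := by
        rw [← Complex.ofReal_one, ← Complex.ofReal_sub, Complex.norm_real, Real.norm_eq_abs]
      have e2 : ‖(a : ℂ) - 2‖ = |a - 2| := by
        rw [← Complex.ofReal_ofNat, ← Complex.ofReal_sub, Complex.norm_real, Real.norm_eq_abs]
      rw [norm_mul, norm_mul, norm_mul, norm_mul, e1, e2, Complex.norm_cpow_real, norm_pow,
        Complex.norm_real, Real.norm_eq_abs]
      have h3 : ‖q‖ ^ (3 : ℝ) = ‖q‖ ^ 3 := by exact_mod_cast Real.rpow_natCast ‖q‖ 3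
      rw [h3, mul_assoc _ (2 ^ |a - 3|)]
      gcongr)
  refine le_of_eq_of_le ?_ key
  congr 1
  simp
  ring

/-- Second order expansion of a complex power along a segment of the slit plane, with a remainder
of order `ν ∈ (2, 3]`. -/
lemma cpow_taylor (a ν b : ℝ) (hν : 2 < ν) (hν3 : ν ≤ 3) (ha : a ≤ 2) (hb : 0 < b) :
    ∃ C : ℝ, 0 ≤ C ∧ ∀ p q : ℂ,
    (∀ t ∈ Icc (0 : ℝ) 1, p + t * q ∈ Complex.slitPlane) → b * ‖p‖ ≤ ‖p + q‖ →
    ‖(p + q) ^ (a : ℂ) - p ^ (a : ℂ) - a * p ^ ((a - 1 : ℝ) : ℂ) * q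
      - a * (a - 1) / 2 * p ^ ((a - 2 : ℝ) : ℂ) * q ^ 2‖ ≤ C * ‖p‖ ^ (a - ν) * ‖q‖ ^ ν := by
  obtain ⟨C, hC, hsmall⟩ := cpow_taylor_of_small a
  refine ⟨C + (b ^ a * 2 ^ ν + 3 ^ a * 2 ^ (ν - a) + 2 ^ ν + |a| * 2 ^ (ν - 1)
    + |a| * |a - 1| * 2 ^ (ν - 2)), by positivity, fun p q hs hbp => ?_⟩
  have hp : 0 < ‖p‖ := by
    have := hs 0 ⟨le_refl _, zero_le_one⟩
    simp only [Complex.ofReal_zero, zero_mul, add_zero] at this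
    exact norm_pos_iff.2 (Complex.slitPlane_ne_zero this)
  have hmono : ∀ {u v : ℝ}, 0 ≤ v → u ≤ v → u * ‖p‖ ^ (a - ν) * ‖q‖ ^ ν ≤
      v * ‖p‖ ^ (a - ν) * ‖q‖ ^ ν := fun _ huv => by gcongr
  -- A short step has a cubic remainder, which is interpolated down to order ν by ‖q‖ ≤ ‖p‖. For a
  -- long step no cancellation is needed: each term of the expansion is separately of the required
  -- size.
  rcases le_or_gt ‖q‖ (‖p‖ / 2) with hq | hq
  · refine (hsmall p q hs hq).trans (le_trans ?_ (hmono (by positivity)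
      (le_add_of_nonneg_right (by positivity))))
    rcases (norm_nonneg q).eq_or_lt with h0 | h0
    · rw [← h0, Real.zero_rpow (by norm_num), Real.zero_rpow (by linarith)]
      simp
    · have e1 : ‖p‖ ^ (a - 3) = ‖p‖ ^ (a - ν) * ‖p‖ ^ (ν - 3) := by
        rw [← Real.rpow_add hp]; congr 1; ring
      have e2 : ‖q‖ ^ (3 : ℝ) = ‖q‖ ^ ν * ‖q‖ ^ (3 - ν) := by
        rw [← Real.rpow_add h0]; congr 1; ring
      have e3 : ‖p‖ ^ (ν - 3) * ‖q‖ ^ (3 - ν) ≤ 1 := by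
        rw [show ν - 3 = -(3 - ν) by ring, Real.rpow_neg hp.le, inv_mul_le_one₀ (by positivity)]
        exact Real.rpow_le_rpow h0.le (by linarith) (by linarith)
      calc C * ‖p‖ ^ (a - 3) * ‖q‖ ^ (3 : ℝ)
          = C * ‖p‖ ^ (a - ν) * ‖q‖ ^ ν * (‖p‖ ^ (ν - 3) * ‖q‖ ^ (3 - ν)) := by rw [e1, e2]; ring
        _ ≤ C * ‖p‖ ^ (a - ν) * ‖q‖ ^ ν * 1 := by gcongr
        _ = _ := mul_one _
  · have hq0 : 0 < ‖q‖ := by linarith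
    -- Used with s = 0, 1, 2 and s = a; the last is where a ≤ 2 < ν enters.
    have hpow : ∀ s : ℝ, s ≤ ν →
        ‖p‖ ^ (a - s) * ‖q‖ ^ s ≤ 2 ^ (ν - s) * (‖p‖ ^ (a - ν) * ‖q‖ ^ ν) := by
      intro s hsν
      have e1 : ‖q‖ ^ s = ‖q‖ ^ ν * ‖q‖ ^ (s - ν) := by
        rw [← Real.rpow_add hq0]; congr 1; ring
      have e2 : ‖q‖ ^ (s - ν) ≤ 2 ^ (ν - s) * ‖p‖ ^ (s - ν) := by
        refine (Real.rpow_le_rpow_of_nonpos (by linarith) hq.le (by linarith)).trans (le_of_eq ?_)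
        rw [Real.div_rpow hp.le (by norm_num), show ν - s = -(s - ν) by ring,
          Real.rpow_neg (by norm_num)]
        field_simp
      have e3 : ‖p‖ ^ (a - ν) = ‖p‖ ^ (a - s) * ‖p‖ ^ (s - ν) := by
        rw [← Real.rpow_add hp]; congr 1; ring
      calc ‖p‖ ^ (a - s) * ‖q‖ ^ s = ‖p‖ ^ (a - s) * ‖q‖ ^ ν * ‖q‖ ^ (s - ν) := by rw [e1]; ring
        _ ≤ ‖p‖ ^ (a - s) * ‖q‖ ^ ν * (2 ^ (ν - s) * ‖p‖ ^ (s - ν)) := by gcongr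
        _ = _ := by rw [e3]; ring
    have p0 := hpow 0 (by linarith)
    have pa := hpow a (by linarith)
    have p1 := hpow 1 (by linarith)
    have p2 := hpow 2 (by linarith)
    simp only [sub_zero, Real.rpow_zero, mul_one, sub_self, one_mul, Real.rpow_one] at p0 pa p1
    set W := ‖p‖ ^ (a - ν) * ‖q‖ ^ ν with hW
    have hW0 : 0 ≤ W := by positivity
    -- For negative a the power is large near the origin, and only the lower bound b‖p‖ ≤ ‖p + q‖
    -- controls it.
    have t0 : ‖p + q‖ ^ a ≤ b ^ a * ‖p‖ ^ a + 3 ^ a * ‖q‖ ^ a := by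
      rcases le_total 0 a with h | h
      · have : ‖p + q‖ ≤ 3 * ‖q‖ := (norm_add_le _ _).trans (by linarith)
        have := Real.rpow_le_rpow (norm_nonneg _) this h
        rw [Real.mul_rpow (by norm_num) hq0.le] at this
        have h' : 0 ≤ b ^ a * ‖p‖ ^ a := by positivity
        linarith
      · have := Real.rpow_le_rpow_of_nonpos (by positivity) hbp h
        rw [Real.mul_rpow hb.le hp.le] at this
        have h' : 0 ≤ (3 : ℝ) ^ a * ‖q‖ ^ a := by positivity
        linarith
    have e1 : ‖(a : ℂ) - 1‖ = |a - 1| := by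
      rw [← Complex.ofReal_one, ← Complex.ofReal_sub, Complex.norm_real, Real.norm_eq_abs]
    have n1 : ‖(a : ℂ) * p ^ ((a - 1 : ℝ) : ℂ) * q‖ = |a| * (‖p‖ ^ (a - 1) * ‖q‖) := by
      rw [norm_mul, norm_mul, Complex.norm_cpow_real, Complex.norm_real, Real.norm_eq_abs]; ring
    have n2 : ‖(a : ℂ) * (a - 1) / 2 * p ^ ((a - 2 : ℝ) : ℂ) * q ^ 2‖ =
        |a| * |a - 1| / 2 * (‖p‖ ^ (a - 2) * ‖q‖ ^ (2 : ℝ)) := by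
      rw [norm_mul, norm_mul, norm_div, norm_mul, e1, Complex.norm_cpow_real, Complex.norm_real,
        Real.norm_eq_abs, norm_pow, Complex.norm_ofNat, Real.rpow_two]; ring
    have tri : ‖(p + q) ^ (a : ℂ) - p ^ (a : ℂ) - a * p ^ ((a - 1 : ℝ) : ℂ) * q
        - a * (a - 1) / 2 * p ^ ((a - 2 : ℝ) : ℂ) * q ^ 2‖ ≤
        ‖p + q‖ ^ a + ‖p‖ ^ a + |a| * (‖p‖ ^ (a - 1) * ‖q‖)
          + |a| * |a - 1| / 2 * (‖p‖ ^ (a - 2) * ‖q‖ ^ (2 : ℝ)) := by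
      rw [← n1, ← n2, ← Complex.norm_cpow_real, ← Complex.norm_cpow_real]
      exact (norm_sub_le _ _).trans (add_le_add_left ((norm_sub_le _ _).trans
        (add_le_add_left (norm_sub_le _ _) _)) _)
    have q0 : b ^ a * ‖p‖ ^ a ≤ b ^ a * (2 ^ ν * W) := by gcongr
    have qa : 3 ^ a * ‖q‖ ^ a ≤ 3 ^ a * (2 ^ (ν - a) * W) := by gcongr
    have q1 : |a| * (‖p‖ ^ (a - 1) * ‖q‖) ≤ |a| * (2 ^ (ν - 1) * W) := by gcongr
    have q2 : |a| * |a - 1| / 2 * (‖p‖ ^ (a - 2) * ‖q‖ ^ (2 : ℝ)) ≤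
        |a| * |a - 1| / 2 * (2 ^ (ν - 2) * W) := by gcongr
    have q3 : 0 ≤ |a| * |a - 1| / 2 * (2 ^ (ν - 2) * W) := by positivity
    have q4 : 0 ≤ C * W := by positivity
    rw [mul_assoc _ (‖p‖ ^ (a - ν)), ← hW]
    linarith

/-! ### Homogeneous functions on the wedge -/

/-- The function `Re (κ (X + Y e)^b) + η (X + Y)^b` on the quadrant. -/
def wedgeFun (e κ : ℂ) (η b X Y : ℝ) : ℝ :=
  (κ * ((X : ℂ) + Y * e) ^ (b : ℂ)).re + η * (X + Y) ^ b

lemma wedge_mem_slitPlane {e : ℂ} (he : 0 < e.im) {X Y : ℝ} (hY : 0 ≤ Y)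
    (h : 0 < X + Y) : (X : ℂ) + Y * e ∈ Complex.slitPlane := by
  rw [Complex.mem_slitPlane_iff]
  rcases hY.eq_or_lt with h0 | h0
  · left
    simp [← h0]
    linarith
  · right
    simp
    exact ⟨h0.ne', he.ne'⟩

lemma wedge_norm_le {e : ℂ} (he1 : ‖e‖ = 1) {X Y : ℝ} : ‖(X : ℂ) + Y * e‖ ≤ |X| + |Y| := by
  refine (norm_add_le _ _).trans ?_
  rw [norm_mul, he1, mul_one, Complex.norm_real, Complex.norm_real]
  rfl

/-- The imaginary part bounds Y and the reverse triangle inequality bounds X - Y, so the norm in the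
wedge is comparable to X + Y. -/
lemma exists_le_wedge_norm {e : ℂ} (he : 0 < e.im) (he1 : ‖e‖ = 1) :
    ∃ b : ℝ, 0 < b ∧ ∀ X Y : ℝ, 0 ≤ X → 0 ≤ Y → b * (X + Y) ≤ ‖(X : ℂ) + Y * e‖ := by
  refine ⟨(1 + 2 / e.im)⁻¹, by positivity, fun X Y hX hY => ?_⟩
  have h1 : Y * e.im ≤ ‖(X : ℂ) + Y * e‖ := by
    have := Complex.abs_im_le_norm ((X : ℂ) + Y * e)
    simp at this
    exact (le_abs_self _).trans (by rwa [abs_mul])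
  have h2 : X - Y ≤ ‖(X : ℂ) + Y * e‖ := by
    have := norm_sub_norm_le (X : ℂ) (-(Y * e))
    rw [norm_neg, sub_neg_eq_add, norm_mul, he1, mul_one, Complex.norm_real, Complex.norm_real,
      Real.norm_of_nonneg hX, Real.norm_of_nonneg hY] at this
    exact this
  rw [inv_mul_le_iff₀ (by positivity)]
  have h3 : Y ≤ ‖(X : ℂ) + Y * e‖ / e.im := by rwa [le_div_iff₀ he]
  have : (1 + 2 / e.im) * ‖(X : ℂ) + Y * e‖ =
    ‖(X : ℂ) + Y * e‖ + 2 * (‖(X : ℂ) + Y * e‖ / e.im) := by ring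
  linarith

/-- `cpow_taylor` is applied at X + Ye and again at the real point X + Y. The quadrant is convex, so
the segments stay in the slit plane, and the assumption that X + Y at most halves gives the lower
bounds at the end point. -/
lemma wedgeFun_taylor {e : ℂ} (he : 0 < e.im) (he1 : ‖e‖ = 1) (c : ℂ) (ε a ν : ℝ)
    (hν : 2 < ν) (hν3 : ν ≤ 3) (ha : a ≤ 2) :
    ∃ C : ℝ, 0 ≤ C ∧ ∀ X Y D₁ D₂ : ℝ, 0 ≤ X → 0 ≤ Y → 0 < X + Y → 0 ≤ X + D₁ → 0 ≤ Y + D₂ →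
      (X + Y) / 2 ≤ (X + D₁) + (Y + D₂) →
      |wedgeFun e c ε a (X + D₁) (Y + D₂) - wedgeFun e c ε a X Y
        - (wedgeFun e (c * a) (ε * a) (a - 1) X Y * D₁
          + wedgeFun e (c * a * e) (ε * a) (a - 1) X Y * D₂)
        - (wedgeFun e (c * a * (a - 1)) (ε * a * (a - 1)) (a - 2) X Y * D₁ ^ 2
          + 2 * wedgeFun e (c * a * (a - 1) * e) (ε * a * (a - 1)) (a - 2) X Y * (D₁ * D₂)
          + wedgeFun e (c * a * (a - 1) * e ^ 2) (ε * a * (a - 1)) (a - 2) X Y * D₂ ^ 2) / 2|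
      ≤ C * (X + Y) ^ (a - ν) * (|D₁| + |D₂|) ^ ν := by
  obtain ⟨b, hb, hbn⟩ := exists_le_wedge_norm he he1
  obtain ⟨C₁, hC₁, h₁⟩ := cpow_taylor a ν (b / 2) hν hν3 ha (by positivity)
  obtain ⟨C₂, hC₂, h₂⟩ := cpow_taylor a ν (1 / 2) hν hν3 ha (by norm_num)
  refine ⟨‖c‖ * (C₁ * b ^ (a - ν)) + |ε| * C₂, by positivity,
    fun X Y D₁ D₂ hX hY hXY hX1 hY1 hhalf => ?_⟩
  set p : ℂ := (X : ℂ) + Y * e with hp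
  set q : ℂ := (D₁ : ℂ) + D₂ * e with hq
  set l : ℂ := ((X + Y : ℝ) : ℂ) with hl
  set d : ℂ := ((D₁ + D₂ : ℝ) : ℂ) with hd
  have hbp : b * (X + Y) ≤ ‖p‖ := hbn X Y hX hY
  have hpl : ‖p‖ ≤ X + Y := by
    simpa [abs_of_nonneg hX, abs_of_nonneg hY] using wedge_norm_le he1 (X := X) (Y := Y)
  have conv : ∀ t ∈ Icc (0 : ℝ) 1, 0 ≤ X + t * D₁ ∧ 0 ≤ Y + t * D₂ ∧
      0 < (X + t * D₁) + (Y + t * D₂) := by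
    intro t ht
    obtain ⟨h0, h1⟩ := ht
    refine ⟨by nlinarith, by nlinarith, by nlinarith⟩
  have r₁ := h₁ p q (fun t ht => by
      obtain ⟨u, v, w⟩ := conv t ht
      have := wedge_mem_slitPlane he v w
      have e0 : p + t * q = ((X + t * D₁ : ℝ) : ℂ) + ((Y + t * D₂ : ℝ) : ℂ) * e := by
        rw [hp, hq]; push_cast; ring
      rwa [e0]) (by
      have := hbn (X + D₁) (Y + D₂) hX1 hY1
      have e0 : p + q = ((X + D₁ : ℝ) : ℂ) + ((Y + D₂ : ℝ) : ℂ) * e := by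
        rw [hp, hq]; push_cast; ring
      rw [e0]
      refine le_trans ?_ this
      nlinarith)
  have r₂ := h₂ l d (fun t ht => by
      obtain ⟨u, v, w⟩ := conv t ht
      rw [Complex.mem_slitPlane_iff]
      left
      simp [hl, hd]
      linarith) (by
      rw [hl, hd, ← Complex.ofReal_add, Complex.norm_real, Complex.norm_real,
        Real.norm_of_nonneg hXY.le, Real.norm_of_nonneg (by linarith)]
      linarith)
  set r := (p + q) ^ (a : ℂ) - p ^ (a : ℂ) - a * p ^ ((a - 1 : ℝ) : ℂ) * q
      - a * (a - 1) / 2 * p ^ ((a - 2 : ℝ) : ℂ) * q ^ 2 with hr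
  set s := (l + d) ^ (a : ℂ) - l ^ (a : ℂ) - a * l ^ ((a - 1 : ℝ) : ℂ) * d
      - a * (a - 1) / 2 * l ^ ((a - 2 : ℝ) : ℂ) * d ^ 2 with hs
  have hlp : ∀ x : ℝ, l ^ (x : ℂ) = (((X + Y) ^ x : ℝ) : ℂ) := fun x =>
    (Complex.ofReal_cpow hXY.le x).symm
  have hldp : (l + d) ^ (a : ℂ) = ((((X + D₁) + (Y + D₂)) ^ a : ℝ) : ℂ) := by
    rw [Complex.ofReal_cpow (by linarith)]
    congr 1
    rw [hl, hd]; push_cast; ring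
  have hmain : wedgeFun e c ε a (X + D₁) (Y + D₂) - wedgeFun e c ε a X Y
        - (wedgeFun e (c * a) (ε * a) (a - 1) X Y * D₁
          + wedgeFun e (c * a * e) (ε * a) (a - 1) X Y * D₂)
        - (wedgeFun e (c * a * (a - 1)) (ε * a * (a - 1)) (a - 2) X Y * D₁ ^ 2
          + 2 * wedgeFun e (c * a * (a - 1) * e) (ε * a * (a - 1)) (a - 2) X Y * (D₁ * D₂)
          + wedgeFun e (c * a * (a - 1) * e ^ 2) (ε * a * (a - 1)) (a - 2) X Y * D₂ ^ 2) / 2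
      = (c * r + ε * s).re := by
    have hpq : (((X + D₁ : ℝ) : ℂ) + ((Y + D₂ : ℝ) : ℂ) * e) = p + q := by
      rw [hp, hq]; push_cast; ring
    have hr' : r = (p + q) ^ (a : ℂ) - p ^ (a : ℂ) - a * p ^ ((a - 1 : ℝ) : ℂ) * q
        - ((a * (a - 1) / 2 : ℝ) : ℂ) * p ^ ((a - 2 : ℝ) : ℂ) * q ^ 2 := by
      rw [hr]; push_cast; ring
    have hs' : s = ((((X + D₁) + (Y + D₂)) ^ a - (X + Y) ^ a - a * (X + Y) ^ (a - 1) * (D₁ + D₂)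
        - a * (a - 1) / 2 * (X + Y) ^ (a - 2) * (D₁ + D₂) ^ 2 : ℝ) : ℂ) := by
      rw [hs, hldp, hlp, hlp, hlp, hd]; push_cast; ring
    have ha1 : (a : ℂ) - 1 = ((a - 1 : ℝ) : ℂ) := by push_cast; ring
    unfold wedgeFun
    rw [hpq, ← hp, hr', hs', ha1, hq]
    generalize (p + ((D₁ : ℂ) + D₂ * e)) ^ (a : ℂ) = U
    generalize p ^ (a : ℂ) = V
    generalize p ^ ((a - 1 : ℝ) : ℂ) = P₁
    generalize p ^ ((a - 2 : ℝ) : ℂ) = P₂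
    simp only [Complex.add_re, Complex.sub_re, Complex.mul_re, Complex.mul_im, Complex.sub_im,
      Complex.add_im, Complex.ofReal_re, Complex.ofReal_im, pow_two]
    ring
  rw [hmain]
  have n₁ : ‖p‖ ^ (a - ν) ≤ b ^ (a - ν) * (X + Y) ^ (a - ν) := by
    rw [← Real.mul_rpow hb.le hXY.le]
    exact Real.rpow_le_rpow_of_nonpos (by positivity) hbp (by linarith)
  have n₂ : ‖q‖ ^ ν ≤ (|D₁| + |D₂|) ^ ν :=
    Real.rpow_le_rpow (norm_nonneg _) (wedge_norm_le he1) (by linarith)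
  have n₃ : ‖l‖ ^ (a - ν) = (X + Y) ^ (a - ν) := by
    rw [hl, Complex.norm_real, Real.norm_of_nonneg hXY.le]
  have n₄ : ‖d‖ ^ ν ≤ (|D₁| + |D₂|) ^ ν := by
    refine Real.rpow_le_rpow (norm_nonneg _) ?_ (by linarith)
    rw [hd, Complex.norm_real]
    exact abs_add_le _ _
  calc |(c * r + ε * s).re| ≤ ‖c * r + ε * s‖ := Complex.abs_re_le_norm _
    _ ≤ ‖c‖ * ‖r‖ + |ε| * ‖s‖ := by
      refine (norm_add_le _ _).trans ?_
      rw [norm_mul, norm_mul, Complex.norm_real, Real.norm_eq_abs]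
    _ ≤ ‖c‖ * (C₁ * (b ^ (a - ν) * (X + Y) ^ (a - ν)) * (|D₁| + |D₂|) ^ ν)
        + |ε| * (C₂ * (X + Y) ^ (a - ν) * (|D₁| + |D₂|) ^ ν) := by
      gcongr
      · exact r₁.trans (by gcongr)
      · exact r₂.trans (by rw [n₃]; gcongr)
    _ = _ := by ring

/-- Reduces estimates on the quadrant to the compact segment X + Y = 1, where continuity supplies
the constants. -/
lemma wedgeFun_homogeneous (e κ : ℂ) (η b : ℝ) {X Y : ℝ} (h : 0 < X + Y) :
    wedgeFun e κ η b X Y =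
      (X + Y) ^ b * wedgeFun e κ η b (1 - Y / (X + Y)) (Y / (X + Y)) := by
  unfold wedgeFun
  set l := X + Y with hl
  have hw : (X : ℂ) + Y * e = (l : ℂ) * (((1 - Y / l : ℝ) : ℂ) + ((Y / l : ℝ) : ℂ) * e) := by
    have hl0 : (l : ℂ) ≠ 0 := by exact_mod_cast h.ne'
    have : (X : ℂ) = l - Y := by rw [hl]; push_cast; ring
    rw [this]; push_cast; field_simp
  have hc : ∀ w : ℂ, ((l : ℂ) * w) ^ (b : ℂ) = ((l ^ b : ℝ) : ℂ) * w ^ (b : ℂ) := by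
    intro w
    have hl0 : (l : ℂ) ≠ 0 := by exact_mod_cast h.ne'
    rcases eq_or_ne w 0 with rfl | hw0
    · rcases eq_or_ne b 0 with rfl | hb0
      · simp
      · have : (b : ℂ) ≠ 0 := by exact_mod_cast hb0
        simp [Complex.zero_cpow this]
    · rw [Complex.ofReal_cpow h.le, Complex.cpow_def_of_ne_zero (mul_ne_zero hl0 hw0),
        Complex.cpow_def_of_ne_zero hl0, Complex.cpow_def_of_ne_zero hw0,
        Complex.log_ofReal_mul h hw0, ← Complex.exp_add, Complex.ofReal_log h.le]
      congr 1; ring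
  rw [hw, hc, sub_add_cancel, Real.one_rpow, mul_left_comm, Complex.re_ofReal_mul]
  ring

lemma continuousOn_wedgeFun {e : ℂ} (he : 0 < e.im) (κ : ℂ) (η b : ℝ) :
    ContinuousOn (fun y => wedgeFun e κ η b (1 - y) y) (Icc 0 1) := by
  unfold wedgeFun
  have h1 : ContinuousOn (fun y : ℝ => ((1 - y : ℝ) : ℂ) + y * e) (Icc 0 1) := by
    apply Continuous.continuousOn; fun_prop
  have h2 : ContinuousOn (fun y : ℝ => (((1 - y : ℝ) : ℂ) + y * e) ^ (b : ℂ)) (Icc 0 1) :=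
    h1.cpow continuousOn_const fun y hy => wedge_mem_slitPlane he hy.1 (by simp)
  refine (Complex.continuous_re.comp_continuousOn (continuousOn_const.mul h2)).add ?_
  simp only [sub_add_cancel, Real.one_rpow]
  exact continuousOn_const

lemma ratio_mem_Icc {X Y : ℝ} (hX : 0 ≤ X) (hY : 0 ≤ Y) : Y / (X + Y) ∈ Icc (0 : ℝ) 1 :=
  ⟨by positivity, div_le_one_of_le₀ (by linarith) (by linarith)⟩

lemma exists_abs_wedgeFun_le {e : ℂ} (he : 0 < e.im) (κ : ℂ) (η b : ℝ) :
    ∃ C : ℝ, 0 ≤ C ∧ ∀ X Y : ℝ, 0 ≤ X → 0 ≤ Y → 0 < X + Y →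
      |wedgeFun e κ η b X Y| ≤ C * (X + Y) ^ b := by
  obtain ⟨C, hC⟩ := isCompact_Icc.exists_bound_of_continuousOn (continuousOn_wedgeFun he κ η b)
  refine ⟨C, (norm_nonneg _).trans (hC 0 ⟨le_refl _, zero_le_one⟩), fun X Y hX hY h => ?_⟩
  rw [wedgeFun_homogeneous e κ η b h, abs_mul, abs_of_nonneg (by positivity), mul_comm]
  gcongr
  exact hC _ (ratio_mem_Icc hX hY)

lemma exists_le_wedgeFun {e : ℂ} (he : 0 < e.im) (κ : ℂ) (η b : ℝ)
    (hpos : ∀ y ∈ Icc (0 : ℝ) 1, 0 < wedgeFun e κ η b (1 - y) y) :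
    ∃ k : ℝ, 0 < k ∧ ∀ X Y : ℝ, 0 ≤ X → 0 ≤ Y → 0 < X + Y →
      k * (X + Y) ^ b ≤ wedgeFun e κ η b X Y := by
  obtain ⟨y₀, hy₀, hmin⟩ := isCompact_Icc.exists_isMinOn (nonempty_Icc.2 (zero_le_one' ℝ))
    (continuousOn_wedgeFun he κ η b)
  refine ⟨_, hpos y₀ hy₀, fun X Y hX hY h => ?_⟩
  rw [wedgeFun_homogeneous e κ η b h, mul_comm]
  gcongr
  exact hmin (ratio_mem_Icc hX hY)

lemma exists_le_wedgeFun_near {e : ℂ} (he : 0 < e.im) (κ : ℂ) (η b : ℝ) {y₀ : ℝ}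
    (hy₀ : y₀ ∈ Icc (0 : ℝ) 1) (hpos : 0 < wedgeFun e κ η b (1 - y₀) y₀) :
    ∃ k δ : ℝ, 0 < k ∧ 0 < δ ∧ ∀ X Y : ℝ, 0 ≤ X → 0 ≤ Y → 0 < X + Y →
      |Y / (X + Y) - y₀| < δ → k * (X + Y) ^ b ≤ wedgeFun e κ η b X Y := by
  have hc := Metric.continuousWithinAt_iff.1 (continuousOn_wedgeFun he κ η b y₀ hy₀)
    (wedgeFun e κ η b (1 - y₀) y₀ / 2) (by positivity)
  obtain ⟨δ, hδ, h⟩ := hc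
  refine ⟨wedgeFun e κ η b (1 - y₀) y₀ / 2, δ, by positivity, hδ, fun X Y hX hY hXY hd => ?_⟩
  have := h (ratio_mem_Icc hX hY) hd
  rw [Real.dist_eq, abs_lt] at this
  rw [wedgeFun_homogeneous e κ η b hXY, mul_comm]
  gcongr
  linarith

/-- Far from the origin a strip of fixed width along the axis occupies an arbitrarily small angle,
so positivity on the axis itself is enough. -/
lemma exists_le_wedgeFun_near_x_axis {e : ℂ} (he : 0 < e.im) (κ : ℂ) (η b R : ℝ)
    (hpos : 0 < wedgeFun e κ η b 1 0) :
    ∃ k r : ℝ, 0 < k ∧ 0 < r ∧ ∀ X Y : ℝ, 0 ≤ X → 0 ≤ Y → r ≤ X + Y → Y ≤ R →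
      k * (X + Y) ^ b ≤ wedgeFun e κ η b X Y := by
  obtain ⟨k, δ, hk, hδ, h⟩ := exists_le_wedgeFun_near he κ η b
    (y₀ := 0) ⟨le_refl _, zero_le_one⟩ (by simpa using hpos)
  refine ⟨k, (|R| + 1) / δ, hk, by positivity, fun X Y hX hY hr hR => ?_⟩
  have h0 : 0 < X + Y := lt_of_lt_of_le (by positivity) hr
  refine h X Y hX hY h0 ?_
  rw [sub_zero, abs_of_nonneg (ratio_mem_Icc hX hY).1, div_lt_iff₀ h0]
  rw [div_le_iff₀ hδ] at hr
  have := le_abs_self R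
  linarith

lemma exists_le_wedgeFun_near_y_axis {e : ℂ} (he : 0 < e.im) (κ : ℂ) (η b R : ℝ)
    (hpos : 0 < wedgeFun e κ η b 0 1) :
    ∃ k r : ℝ, 0 < k ∧ 0 < r ∧ ∀ X Y : ℝ, 0 ≤ X → 0 ≤ Y → r ≤ X + Y → X ≤ R →
      k * (X + Y) ^ b ≤ wedgeFun e κ η b X Y := by
  obtain ⟨k, δ, hk, hδ, h⟩ := exists_le_wedgeFun_near he κ η b
    (y₀ := 1) ⟨zero_le_one, le_refl _⟩ (by simpa using hpos)
  refine ⟨k, (|R| + 1) / δ, hk, by positivity, fun X Y hX hY hr hR => ?_⟩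
  have h0 : 0 < X + Y := lt_of_lt_of_le (by positivity) hr
  refine h X Y hX hY h0 ?_
  rw [show Y / (X + Y) - 1 = -(X / (X + Y)) by field_simp; ring, abs_neg,
    abs_of_nonneg (by positivity), div_lt_iff₀ h0]
  rw [div_le_iff₀ hδ] at hr
  have := le_abs_self R
  linarith

/-- Differentiation in Y multiplies the holomorphic part by e, so the three terms are second
derivatives weighted by the covariance. The holomorphic part is harmonic for this operator, and only
the perturbation contributes. -/
lemma wedgeFun_quadratic {e : ℂ} {ρ : ℝ} (hρ : 1 + 2 * ρ * e + e ^ 2 = 0) (κ : ℂ)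
    (η b X Y : ℝ) :
    wedgeFun e κ η b X Y + 2 * ρ * wedgeFun e (κ * e) η b X Y + wedgeFun e (κ * e ^ 2) η b X Y
      = η * (2 + 2 * ρ) * (X + Y) ^ b := by
  unfold wedgeFun
  generalize ((X : ℂ) + Y * e) ^ (b : ℂ) = P
  have h : (κ * P).re + 2 * ρ * (κ * e * P).re + (κ * e ^ 2 * P).re = 0 := by
    have h1 : κ * P * (1 + ((2 * ρ : ℝ) : ℂ) * e + e ^ 2) = 0 := by
      push_cast; rw [hρ, mul_zero]
    have h2 := congrArg Complex.re h1
    simp only [Complex.add_re, Complex.mul_re, Complex.mul_im, Complex.add_im, Complex.ofReal_re,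
      Complex.ofReal_im, pow_two, Complex.one_re, Complex.one_im, Complex.zero_re] at h2 ⊢
    linarith
  linear_combination h

/-! ### Positivity and boundary derivatives in the wedge -/

lemma arg_wedge_mem {ξ : ℝ} (h0 : 0 < ξ) (hπ : ξ < Real.pi) {y : ℝ} (hy : y ∈ Icc (0 : ℝ) 1) :
    (((1 - y : ℝ) : ℂ) + y * Complex.exp (ξ * Complex.I)).arg ∈ Icc 0 ξ := by
  have hs : 0 < Real.sin ξ := Real.sin_pos_of_pos_of_lt_pi h0 hπ
  set u := ((1 - y : ℝ) : ℂ) + y * Complex.exp (ξ * Complex.I) with hu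
  have hre : u.re = (1 - y) + y * Real.cos ξ := by
    simp [hu, Complex.exp_ofReal_mul_I_re]
  have him : u.im = y * Real.sin ξ := by
    simp [hu, Complex.exp_ofReal_mul_I_im]
  have hu0 : u ≠ 0 := by
    intro h
    rw [h, Complex.zero_im, eq_comm, mul_eq_zero] at him
    rw [h, Complex.zero_re] at hre
    rcases him with h' | h'
    · rw [h'] at hre; norm_num at hre
    · exact hs.ne' h'
  have harg0 : 0 ≤ u.arg := Complex.arg_nonneg_iff.2 (by rw [him]; exact mul_nonneg hy.1 hs.le)
  refine ⟨harg0, ?_⟩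
  by_contra! hlt
  have hn : 0 < ‖u‖ := norm_pos_iff.2 hu0
  have hsin : 0 < Real.sin (u.arg - ξ) :=
    Real.sin_pos_of_pos_of_lt_pi (by linarith) (by linarith [Complex.arg_le_pi u])
  rw [Real.sin_sub, Complex.cos_arg hu0, Complex.sin_arg, hre, him, div_mul_eq_mul_div,
    div_mul_eq_mul_div, ← sub_div, div_pos_iff_of_pos_right hn] at hsin
  nlinarith [hy.1, hy.2]

/-- The phase centres the angle at the bisector: the value is ‖u‖^a cos(a(arg u - ξ/2)), and the
argument of the cosine is below π/2 in absolute value because |arg u - ξ/2| ≤ ξ/2. -/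
lemma wedgeFun_pos {ξ : ℝ} (h0 : 0 < ξ) (hπ : ξ < Real.pi) {a : ℝ} (ha : |a| < 1)
    {y : ℝ} (hy : y ∈ Icc (0 : ℝ) 1) :
    0 < wedgeFun (Complex.exp (ξ * Complex.I))
      (Complex.exp (((-(a * ξ / 2) : ℝ) : ℂ) * Complex.I)) 0 a (1 - y) y := by
  have hmem := arg_wedge_mem h0 hπ hy
  unfold wedgeFun
  have him : 0 < (Complex.exp (ξ * Complex.I)).im := by
    rw [Complex.exp_ofReal_mul_I_im]; exact Real.sin_pos_of_pos_of_lt_pi h0 hπ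
  have hu0 := Complex.slitPlane_ne_zero (wedge_mem_slitPlane him (X := 1 - y) hy.1 (by simp))
  generalize (((1 - y : ℝ) : ℂ) + y * Complex.exp (ξ * Complex.I)) = u at *
  have e1 : Complex.exp (((-(a * ξ / 2) : ℝ) : ℂ) * Complex.I) * u ^ (a : ℂ) =
      Complex.exp (((a * Real.log ‖u‖ : ℝ) : ℂ)
        + ((a * (u.arg - ξ / 2) : ℝ) : ℂ) * Complex.I) := by
    rw [Complex.cpow_def_of_ne_zero hu0, ← Complex.exp_add, Complex.log]
    congr 1; push_cast; ring
  rw [e1, Complex.exp_add, ← Complex.ofReal_exp, Complex.re_ofReal_mul,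
    Complex.exp_ofReal_mul_I_re, zero_mul, add_zero]
  refine mul_pos (Real.exp_pos _) (Real.cos_pos_of_mem_Ioo ?_)
  have hb : |a * (u.arg - ξ / 2)| < Real.pi / 2 := by
    rw [abs_mul]
    have : |u.arg - ξ / 2| ≤ ξ / 2 := abs_le.2 ⟨by linarith [hmem.1], by linarith [hmem.2]⟩
    nlinarith [abs_nonneg a, abs_nonneg (u.arg - ξ / 2)]
  rw [abs_lt] at hb
  exact ⟨by linarith, hb.2⟩

/-- The conditions under which `wedgeFun e c ε a` is a strict subsolution with normal
reflection on the axes. -/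
structure IsWedgeSub (e c : ℂ) (ε a : ℝ) : Prop where
  interior : 0 < ε * a * (a - 1)
  x_axis : 0 < wedgeFun e (c * a * e) (ε * a) (a - 1) 1 0
  y_axis : 0 < wedgeFun e (c * a) (ε * a) (a - 1) 0 1

/-- This is the inward derivative on the first axis. Its sign, that of a cos(ξ - aξ/2) up to the
perturbation, is what produces the critical exponent 2 - π/ξ. -/
lemma wedgeFun_x_axis (ξ a s η : ℝ) :
    wedgeFun (Complex.exp (ξ * Complex.I))
      ((s : ℂ) * Complex.exp (((-(a * ξ / 2) : ℝ) : ℂ) * Complex.I) * a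
        * Complex.exp (ξ * Complex.I)) η (a - 1) 1 0 = s * a * Real.cos (ξ - a * ξ / 2) + η := by
  unfold wedgeFun
  have : (s : ℂ) * Complex.exp (((-(a * ξ / 2) : ℝ) : ℂ) * Complex.I) * a
      * Complex.exp (ξ * Complex.I) =
      ((s * a : ℝ) : ℂ) * Complex.exp (((ξ - a * ξ / 2 : ℝ) : ℂ) * Complex.I) := by
    have : Complex.exp (((ξ - a * ξ / 2 : ℝ) : ℂ) * Complex.I) =
      Complex.exp (((-(a * ξ / 2) : ℝ) : ℂ) * Complex.I) * Complex.exp (ξ * Complex.I) := by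
      rw [← Complex.exp_add]; congr 1; push_cast; ring
    rw [this]; push_cast; ring
  rw [this]
  simp only [Complex.ofReal_one, Complex.ofReal_zero, zero_mul, add_zero, Complex.one_cpow,
    mul_one, Real.one_rpow, Complex.re_ofReal_mul, Complex.exp_ofReal_mul_I_re]

/-- Symmetry about the bisector gives the same value on the second axis. -/
lemma wedgeFun_y_axis {ξ : ℝ} (h0 : 0 < ξ) (hπ : ξ < Real.pi) (a s η : ℝ) :
    wedgeFun (Complex.exp (ξ * Complex.I))
      ((s : ℂ) * Complex.exp (((-(a * ξ / 2) : ℝ) : ℂ) * Complex.I) * a) η (a - 1) 0 1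
        = s * a * Real.cos (ξ - a * ξ / 2) + η := by
  unfold wedgeFun
  have : (s : ℂ) * Complex.exp (((-(a * ξ / 2) : ℝ) : ℂ) * Complex.I) * a
      * (((0 : ℝ) : ℂ) + ((1 : ℝ) : ℂ) * Complex.exp (ξ * Complex.I)) ^ ((a - 1 : ℝ) : ℂ) =
      ((s * a : ℝ) : ℂ) * Complex.exp (((-(ξ - a * ξ / 2) : ℝ) : ℂ) * Complex.I) := by
    have h1 : (((0 : ℝ) : ℂ) + ((1 : ℝ) : ℂ) * Complex.exp (ξ * Complex.I)) ^ ((a - 1 : ℝ) : ℂ)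
        = Complex.exp (((ξ * (a - 1) : ℝ) : ℂ) * Complex.I) := by
      rw [Complex.ofReal_zero, Complex.ofReal_one, zero_add, one_mul,
        Complex.cpow_def_of_ne_zero (Complex.exp_ne_zero _), Complex.log_exp]
      · congr 1; push_cast; ring
      · simp; linarith
      · simp; linarith
    have h2 : Complex.exp (((-(ξ - a * ξ / 2) : ℝ) : ℂ) * Complex.I) =
      Complex.exp (((-(a * ξ / 2) : ℝ) : ℂ) * Complex.I)
        * Complex.exp (((ξ * (a - 1) : ℝ) : ℂ) * Complex.I) := by
      rw [← Complex.exp_add]; congr 1; push_cast; ring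
    rw [h1, h2]; push_cast; ring
  rw [this]
  simp only [zero_add, mul_one, Real.one_rpow, Complex.re_ofReal_mul,
    Complex.exp_ofReal_mul_I_re, Real.cos_neg]

/-- For exponents with the right sign of the boundary derivative there is a positive function
which, multiplied by the sign `s`, is a strict subsolution. -/
lemma exists_isWedgeSub {ξ : ℝ} (h0 : 0 < ξ) (hπ : ξ < Real.pi) {a s : ℝ} (ha : |a| < 1)
    (hs : s = 1 ∨ s = -1) (hcos : 0 < s * a * Real.cos (ξ - a * ξ / 2)) :
    ∃ (c : ℂ) (ε : ℝ), IsWedgeSub (Complex.exp (ξ * Complex.I)) (s * c) (s * ε) a ∧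
      ∀ y ∈ Icc (0 : ℝ) 1, 0 < wedgeFun (Complex.exp (ξ * Complex.I)) c ε a (1 - y) y := by
  have him : 0 < (Complex.exp (ξ * Complex.I)).im := by
    rw [Complex.exp_ofReal_mul_I_im]; exact Real.sin_pos_of_pos_of_lt_pi h0 hπ
  set e := Complex.exp (ξ * Complex.I) with he
  set c := Complex.exp (((-(a * ξ / 2) : ℝ) : ℂ) * Complex.I) with hc
  have ha0 : a ≠ 0 := by rintro rfl; simp at hcos
  have ha1 : a < 1 := (abs_lt.1 ha).2
  have hs2 : s * s = 1 := by rcases hs with rfl | rfl <;> norm_num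
  have hs1 : |s| = 1 := by rcases hs with rfl | rfl <;> simp
  obtain ⟨k, hk, hkle⟩ := exists_le_wedgeFun him c 0 a (fun y hy => wedgeFun_pos h0 hπ ha hy)
  set β := s * a * Real.cos (ξ - a * ξ / 2) with hβ
  -- Below k, so that the perturbed function stays positive; below β, so that the boundary
  -- derivatives keep their sign.
  set δ := min (k / 2) (β / 2) with hδ
  have hδ0 : 0 < δ := by positivity
  have hδk : δ < k := (min_le_left _ _).trans_lt (by linarith)
  have hδβ : δ < β := (min_le_right _ _).trans_lt (by linarith)
  -- With this sign the interior term is a²δ(1 - a) for either value of s, at the cost of only a²δ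
  -- in the boundary derivatives.
  refine ⟨c, -(s * a * δ), ⟨?_, ?_, ?_⟩, fun y hy => ?_⟩
  · have : s * -(s * a * δ) * a * (a - 1) = (s * s) * (a * a) * δ * (1 - a) := by ring
    rw [this, hs2]
    have : 0 < a * a := mul_self_pos.2 ha0
    have : 0 < 1 - a := by linarith
    positivity
  · rw [he, hc, wedgeFun_x_axis, ← hβ]
    have : s * -(s * a * δ) * a = -((s * s) * (a * a) * δ) := by ring
    rw [this, hs2]
    have : a * a < 1 := by nlinarith [abs_lt.1 ha]
    nlinarith
  · rw [he, hc, wedgeFun_y_axis h0 hπ, ← hβ]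
    have : s * -(s * a * δ) * a = -((s * s) * (a * a) * δ) := by ring
    rw [this, hs2]
    have : a * a < 1 := by nlinarith [abs_lt.1 ha]
    nlinarith
  · have h1 := hkle (1 - y) y (by linarith [hy.2]) hy.1 (by simp)
    unfold wedgeFun at h1 ⊢
    simp only [sub_add_cancel, Real.one_rpow, add_zero, mul_one] at h1 ⊢
    have : |s * a * δ| < k := by
      rw [abs_mul, abs_mul, hs1, one_mul, abs_of_pos hδ0]
      nlinarith [abs_nonneg a]
    linarith [le_abs_self (s * a * δ)]

/-! ### Normalized increments and the push at the boundary -/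

/-- A pair of centred random variables with unit variances and correlation `ρ`, bounded below by
`-R`, with a moment of order `ν ∈ (2, 3]`. -/
structure NormalizedIncrement {Ω : Type*} [MeasurableSpace Ω] (μ : Measure Ω) (V₁ V₂ : Ω → ℝ)
    (ρ ν R : ℝ) : Prop where
  meas₁ : Measurable V₁
  meas₂ : Measurable V₂
  two_lt : 2 < ν
  le_three : ν ≤ 3
  R_nonneg : 0 ≤ R
  lower₁ : ∀ᵐ ω ∂μ, -R ≤ V₁ ω
  lower₂ : ∀ᵐ ω ∂μ, -R ≤ V₂ ω
  moment : Integrable (fun ω => (|V₁ ω| + |V₂ ω|) ^ ν) μ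
  mean₁ : ∫ ω, V₁ ω ∂μ = 0
  mean₂ : ∫ ω, V₂ ω ∂μ = 0
  var₁ : ∫ ω, V₁ ω ^ 2 ∂μ = 1
  var₂ : ∫ ω, V₂ ω ^ 2 ∂μ = 1
  cov : ∫ ω, V₁ ω * V₂ ω ∂μ = ρ

/-- The push at the boundary: `0` inside, and `θ` times the overshoot outside. -/
def push (θ X v : ℝ) : ℝ := θ * max (-(X + v)) 0

lemma push_nonneg {θ : ℝ} (hθ : 1 ≤ θ) (X v : ℝ) : 0 ≤ push θ X v :=
  mul_nonneg (by linarith) (le_max_right _ _)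

lemma push_eq_zero {θ X v : ℝ} (h : 0 ≤ X + v) : push θ X v = 0 := by
  rw [push, max_eq_right (by linarith), mul_zero]

lemma push_le {θ X v R : ℝ} (hθ : 1 ≤ θ) (hθ2 : θ ≤ 2) (hX : 0 ≤ X) (hR : 0 ≤ R) (hv : -R ≤ v) :
    push θ X v ≤ 2 * R := by
  have h1 : max (-(X + v)) 0 ≤ R := max_le (by linarith) hR
  have h2 : 0 ≤ max (-(X + v)) 0 := le_max_right _ _
  unfold push
  nlinarith

lemma add_push_nonneg {θ : ℝ} (hθ : 1 ≤ θ) (X v : ℝ) : 0 ≤ X + (v + push θ X v) := by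
  have h1 : -(X + v) ≤ max (-(X + v)) 0 := le_max_left _ _
  have h2 : 0 ≤ max (-(X + v)) 0 := le_max_right _ _
  unfold push
  nlinarith

/-- A push occurs only when X + v < 0, and then v lies between -R and 0, however heavy the upper
tail is. -/
lemma abs_mul_push_le {θ X v R : ℝ} (hθ : 1 ≤ θ) (hX : 0 ≤ X) (hv : -R ≤ v) :
    |v| * push θ X v ≤ R * push θ X v := by
  rcases le_or_gt 0 (X + v) with h | h
  · rw [push_eq_zero h]; simp
  · have : |v| ≤ R := abs_le.2 ⟨hv, by linarith⟩
    exact mul_le_mul_of_nonneg_right this (push_nonneg hθ X v)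

lemma measurable_push {Ω : Type*} [MeasurableSpace Ω] {V : Ω → ℝ} (hV : Measurable V) (θ X : ℝ) :
    Measurable fun ω => push θ X (V ω) := by
  unfold push; fun_prop

namespace NormalizedIncrement

variable {Ω : Type*} [MeasurableSpace Ω] {μ : Measure Ω}
  {V₁ V₂ : Ω → ℝ} {ρ ν R : ℝ}

lemma symm (h : NormalizedIncrement μ V₁ V₂ ρ ν R) : NormalizedIncrement μ V₂ V₁ ρ ν R where
  meas₁ := h.meas₂
  meas₂ := h.meas₁
  two_lt := h.two_lt
  le_three := h.le_three
  R_nonneg := h.R_nonneg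
  lower₁ := h.lower₂
  lower₂ := h.lower₁
  moment := by simpa only [add_comm] using h.moment
  mean₁ := h.mean₂
  mean₂ := h.mean₁
  var₁ := h.var₂
  var₂ := h.var₁
  cov := by simpa only [mul_comm] using h.cov

lemma integral_push_eq_zero (h : NormalizedIncrement μ V₁ V₂ ρ ν R) {θ X : ℝ} (hX : R ≤ X) :
    ∫ ω, push θ X (V₁ ω) ∂μ = 0 := by
  refine integral_eq_zero_of_ae ?_
  filter_upwards [h.lower₁] with ω hω
  exact push_eq_zero (by linarith)

variable [IsProbabilityMeasure μ]

lemma integrable_sq (h : NormalizedIncrement μ V₁ V₂ ρ ν R) :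
    Integrable (fun ω => (|V₁ ω| + |V₂ ω|) ^ 2) μ := by
  have m₁ := h.meas₁
  have m₂ := h.meas₂
  refine Integrable.mono' ((integrable_const (1 : ℝ)).add h.moment)
    (by fun_prop) (Filter.Eventually.of_forall fun ω => ?_)
  rw [Real.norm_of_nonneg (by positivity)]
  have hx : 0 ≤ |V₁ ω| + |V₂ ω| := by positivity
  simp only [Pi.add_apply]
  rcases le_total (|V₁ ω| + |V₂ ω|) 1 with h1 | h1
  · have : 0 ≤ (|V₁ ω| + |V₂ ω|) ^ ν := by positivity
    nlinarith
  · have := Real.rpow_le_rpow_of_exponent_le h1 h.two_lt.le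
    rw [Real.rpow_two] at this
    linarith

lemma integrable_sq₁ (h : NormalizedIncrement μ V₁ V₂ ρ ν R) :
    Integrable (fun ω => V₁ ω ^ 2) μ := by
  have m₁ := h.meas₁
  refine h.integrable_sq.mono' (by fun_prop) (Filter.Eventually.of_forall fun ω => ?_)
  rw [Real.norm_of_nonneg (by positivity), ← sq_abs]
  gcongr
  linarith [abs_nonneg (V₂ ω)]

lemma integrable_mul (h : NormalizedIncrement μ V₁ V₂ ρ ν R) :
    Integrable (fun ω => V₁ ω * V₂ ω) μ := by
  have m₁ := h.meas₁
  have m₂ := h.meas₂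
  refine h.integrable_sq.mono' (by fun_prop) (Filter.Eventually.of_forall fun ω => ?_)
  rw [Real.norm_eq_abs, abs_mul]
  nlinarith [abs_nonneg (V₁ ω), abs_nonneg (V₂ ω)]

lemma integrable₁ (h : NormalizedIncrement μ V₁ V₂ ρ ν R) : Integrable V₁ μ := by
  have m₁ := h.meas₁
  refine ((integrable_const (1 : ℝ)).add h.integrable_sq₁).mono' (by fun_prop)
    (Filter.Eventually.of_forall fun ω => ?_)
  rw [Real.norm_eq_abs, Pi.add_apply, ← sq_abs]
  nlinarith [sq_nonneg (|V₁ ω| - 1)]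

lemma integrable_moment (h : NormalizedIncrement μ V₁ V₂ ρ ν R) {K : ℝ} (hK : 0 ≤ K) :
    Integrable (fun ω => (|V₁ ω| + |V₂ ω| + K) ^ ν) μ := by
  have m₁ := h.meas₁
  have m₂ := h.meas₂
  have hν : 0 ≤ ν := by linarith [h.two_lt]
  refine ((h.moment.const_mul (2 ^ ν)).add (integrable_const ((2 * K) ^ ν))).mono' (by fun_prop)
    (Filter.Eventually.of_forall fun ω => ?_)
  have hx : 0 ≤ |V₁ ω| + |V₂ ω| := by positivity
  simp only [Pi.add_apply]
  generalize |V₁ ω| + |V₂ ω| = x at *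
  rw [Real.norm_of_nonneg (by positivity), ← Real.mul_rpow (by norm_num) hx]
  have h1 : 0 ≤ (2 * x) ^ ν := by positivity
  have h2 : 0 ≤ (2 * K) ^ ν := by positivity
  rcases le_total x K with h3 | h3
  · have := Real.rpow_le_rpow (by positivity) (show x + K ≤ 2 * K by linarith) hν
    linarith
  · have := Real.rpow_le_rpow (by positivity) (show x + K ≤ 2 * x by linarith) hν
    linarith

lemma integrable_push (h : NormalizedIncrement μ V₁ V₂ ρ ν R) {θ X : ℝ} (hθ : 1 ≤ θ) (hθ2 : θ ≤ 2)
    (hX : 0 ≤ X) : Integrable (fun ω => push θ X (V₁ ω)) μ := by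
  refine (integrable_const (2 * R)).mono' (measurable_push h.meas₁ θ X).aestronglyMeasurable ?_
  filter_upwards [h.lower₁] with ω hω
  rw [Real.norm_of_nonneg (push_nonneg hθ _ _)]
  exact push_le hθ hθ2 hX h.R_nonneg hω

/-- The push changes the variance by at most a multiple of its own mean, which the boundary
derivative can absorb in the drift estimate. -/
lemma second_moment_diag (h : NormalizedIncrement μ V₁ V₂ ρ ν R) {θ X : ℝ} (hθ : 1 ≤ θ)
    (hθ2 : θ ≤ 2) (hX : 0 ≤ X) :
    Integrable (fun ω => (V₁ ω + push θ X (V₁ ω)) ^ 2) μ ∧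
    |∫ ω, (V₁ ω + push θ X (V₁ ω)) ^ 2 ∂μ - 1| ≤ 4 * R * ∫ ω, push θ X (V₁ ω) ∂μ := by
  have hp := h.integrable_push hθ hθ2 hX
  have mp := measurable_push h.meas₁ θ X
  have m₁ := h.meas₁
  have hb : ∀ᵐ ω ∂μ, ‖(V₁ ω + push θ X (V₁ ω)) ^ 2 - V₁ ω ^ 2‖ ≤ 4 * R * push θ X (V₁ ω) := by
    filter_upwards [h.lower₁] with ω hω
    have h1 := abs_mul_push_le hθ hX hω
    have h2 := push_le hθ hθ2 hX h.R_nonneg hω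
    have h0 := push_nonneg hθ X (V₁ ω)
    rw [show (V₁ ω + push θ X (V₁ ω)) ^ 2 - V₁ ω ^ 2 =
      2 * (V₁ ω * push θ X (V₁ ω)) + push θ X (V₁ ω) * push θ X (V₁ ω) by ring]
    refine (norm_add_le _ _).trans ?_
    rw [norm_mul, norm_mul, norm_mul, Real.norm_eq_abs (V₁ ω), Real.norm_of_nonneg h0,
      Real.norm_of_nonneg (zero_le_two)]
    nlinarith
  have hd : Integrable (fun ω => (V₁ ω + push θ X (V₁ ω)) ^ 2 - V₁ ω ^ 2) μ :=
    (hp.const_mul (4 * R)).mono' (by fun_prop) hb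
  have hi : Integrable (fun ω => (V₁ ω + push θ X (V₁ ω)) ^ 2) μ := by
    simpa using hd.fun_add h.integrable_sq₁
  refine ⟨hi, ?_⟩
  rw [← h.var₁, ← integral_sub hi h.integrable_sq₁, ← integral_const_mul]
  exact norm_integral_le_of_norm_le (hp.const_mul _) hb

/-- When one coordinate is pushed the other increment may be large, so it is cut at L: below L the
error is charged to the mean push, above L to the second moment, leaving 4R/L, which is small for
large L. -/
lemma second_moment_cross (h : NormalizedIncrement μ V₁ V₂ ρ ν R) {θ X Y L : ℝ} (hθ : 1 ≤ θ)
    (hθ2 : θ ≤ 2) (hX : 0 ≤ X) (hY : 0 ≤ Y) (hL : 0 < L) :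
    Integrable (fun ω => (V₁ ω + push θ X (V₁ ω)) * (V₂ ω + push θ Y (V₂ ω))) μ ∧
    |∫ ω, (V₁ ω + push θ X (V₁ ω)) * (V₂ ω + push θ Y (V₂ ω)) ∂μ - ρ| ≤
      (L + 2 * R) * (∫ ω, push θ X (V₁ ω) ∂μ + ∫ ω, push θ Y (V₂ ω) ∂μ) + 4 * R / L := by
  have hp₁ := h.integrable_push hθ hθ2 hX
  have hp₂ := h.symm.integrable_push hθ hθ2 hY
  have mp₁ := measurable_push h.meas₁ θ X
  have mp₂ := measurable_push h.meas₂ θ Y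
  have m₁ := h.meas₁
  have m₂ := h.meas₂
  have hR := h.R_nonneg
  have cut : ∀ v r : ℝ, 0 ≤ r → r ≤ 2 * R → |v| * r ≤ L * r + 2 * R / L * v ^ 2 := by
    intro v r h0 h1
    rw [← sq_abs v]
    generalize hx : |v| = x
    have hx0 : 0 ≤ x := hx ▸ abs_nonneg v
    rcases le_total x L with h2 | h2
    · have : 0 ≤ 2 * R / L * x ^ 2 := by positivity
      nlinarith
    · have : x * (2 * R) ≤ 2 * R / L * x ^ 2 := by
        rw [div_mul_eq_mul_div, le_div_iff₀ hL]
        nlinarith [mul_nonneg hR hx0]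
      nlinarith [mul_nonneg hL.le h0]
  have hb : ∀ᵐ ω ∂μ, ‖(V₁ ω + push θ X (V₁ ω)) * (V₂ ω + push θ Y (V₂ ω)) - V₁ ω * V₂ ω‖ ≤
      (L + 2 * R) * (push θ X (V₁ ω) + push θ Y (V₂ ω))
        + 2 * R / L * (V₁ ω ^ 2 + V₂ ω ^ 2) := by
    filter_upwards [h.lower₁, h.lower₂] with ω h₁ h₂
    have a1 := push_le hθ hθ2 hX h.R_nonneg h₁
    have a2 := push_le hθ hθ2 hY h.R_nonneg h₂
    have b1 := push_nonneg hθ X (V₁ ω)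
    have b2 := push_nonneg hθ Y (V₂ ω)
    have c1 := cut (V₂ ω) _ b1 a1
    have c2 := cut (V₁ ω) _ b2 a2
    generalize push θ X (V₁ ω) = r₁ at *
    generalize push θ Y (V₂ ω) = r₂ at *
    rw [show (V₁ ω + r₁) * (V₂ ω + r₂) - V₁ ω * V₂ ω = V₁ ω * r₂ + V₂ ω * r₁ + r₁ * r₂ by ring]
    refine (norm_add_le _ _).trans ((add_le_add_left (norm_add_le _ _) _).trans ?_)
    rw [norm_mul, norm_mul, norm_mul, Real.norm_eq_abs (V₁ ω), Real.norm_eq_abs (V₂ ω),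
      Real.norm_of_nonneg b1, Real.norm_of_nonneg b2]
    nlinarith
  have hsq := h.integrable_sq₁.fun_add h.symm.integrable_sq₁
  have hdom : Integrable (fun ω => (L + 2 * R) * (push θ X (V₁ ω) + push θ Y (V₂ ω))
        + 2 * R / L * (V₁ ω ^ 2 + V₂ ω ^ 2)) μ :=
    ((hp₁.fun_add hp₂).const_mul _).add (hsq.const_mul _)
  have hd := hdom.mono' (by fun_prop) hb
  have hi : Integrable (fun ω => (V₁ ω + push θ X (V₁ ω)) * (V₂ ω + push θ Y (V₂ ω))) μ := by
    simpa using hd.fun_add h.integrable_mul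
  refine ⟨hi, ?_⟩
  have e1 : ∫ ω, ((L + 2 * R) * (push θ X (V₁ ω) + push θ Y (V₂ ω))
        + 2 * R / L * (V₁ ω ^ 2 + V₂ ω ^ 2)) ∂μ =
      (L + 2 * R) * (∫ ω, push θ X (V₁ ω) ∂μ + ∫ ω, push θ Y (V₂ ω) ∂μ) + 4 * R / L := by
    rw [integral_add ((hp₁.fun_add hp₂).const_mul _) (hsq.const_mul _), integral_const_mul,
      integral_const_mul]
    rw [integral_add hp₁ hp₂, integral_add h.integrable_sq₁ h.symm.integrable_sq₁, h.var₁, h.var₂]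
    ring
  rw [← e1, ← h.cov, ← integral_sub hi h.integrable_mul]
  exact norm_integral_le_of_norm_le hdom hb

end NormalizedIncrement

/-! ### The one-step drift -/

lemma measurable_wedgeFun {Ω : Type*} [MeasurableSpace Ω] {A B : Ω → ℝ} (hA : Measurable A)
    (hB : Measurable B) (e κ : ℂ) (η b : ℝ) :
    Measurable fun ω => wedgeFun e κ η b (A ω) (B ω) := by
  unfold wedgeFun
  fun_prop

set_option maxHeartbeats 1000000 in
/-- A strict subsolution gains at least a multiple of `(X + Y) ^ (a - 2)` per step of the
reflected walk, far away from the origin. -/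
theorem NormalizedIncrement.drift {Ω : Type*} [MeasurableSpace Ω] {μ : Measure Ω}
    [IsProbabilityMeasure μ] {V₁ V₂ : Ω → ℝ} {ρ ν R : ℝ}
    (h : NormalizedIncrement μ V₁ V₂ ρ ν R) {θ : ℝ} (hθ : 1 ≤ θ) (hθ2 : θ ≤ 2)
    {e c : ℂ} {ε a : ℝ} (he : 0 < e.im) (he1 : ‖e‖ = 1) (heρ : 1 + 2 * ρ * e + e ^ 2 = 0)
    (hρ : -1 < ρ) (ha : a ≤ 2) (hsub : IsWedgeSub e c ε a) :
    ∃ r κ : ℝ, 0 < r ∧ 0 < κ ∧ ∀ X Y : ℝ, 0 ≤ X → 0 ≤ Y → r ≤ X + Y →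
      Integrable (fun ω => wedgeFun e c ε a (X + (V₁ ω + push θ X (V₁ ω)))
        (Y + (V₂ ω + push θ Y (V₂ ω)))) μ ∧
      wedgeFun e c ε a X Y + κ * (X + Y) ^ (a - 2) ≤
        ∫ ω, wedgeFun e c ε a (X + (V₁ ω + push θ X (V₁ ω)))
          (Y + (V₂ ω + push θ Y (V₂ ω))) ∂μ := by
  have hR := h.R_nonneg
  obtain ⟨C, hC, htaylor⟩ := wedgeFun_taylor he he1 c ε a ν h.two_lt h.le_three ha
  obtain ⟨B₁, hB₁, hb₁⟩ := exists_abs_wedgeFun_le he (c * a * (a - 1)) (ε * a * (a - 1)) (a - 2)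
  obtain ⟨B₂, hB₂, hb₂⟩ := exists_abs_wedgeFun_le he (c * a * (a - 1) * e) (ε * a * (a - 1)) (a - 2)
  obtain ⟨B₃, hB₃, hb₃⟩ :=
    exists_abs_wedgeFun_le he (c * a * (a - 1) * e ^ 2) (ε * a * (a - 1)) (a - 2)
  obtain ⟨k₁, r₁, hk₁, hr₁, hx⟩ := exists_le_wedgeFun_near_y_axis he (c * a) (ε * a) (a - 1) R
    hsub.y_axis
  obtain ⟨k₂, r₂, hk₂, hr₂, hy⟩ := exists_le_wedgeFun_near_x_axis he (c * a * e) (ε * a) (a - 1) R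
    hsub.x_axis
  -- The quadratic term contributes 3κ(X + Y)^(a-2): one third pays for the Taylor remainder, one
  -- for the cut-off error in the cross moment, and one is the drift claimed.
  set κ := ε * a * (a - 1) * (1 + ρ) / 3 with hκ
  have hκ0 : 0 < κ := by
    have := hsub.interior
    have : 0 < 1 + ρ := by linarith
    positivity
  set M := ∫ ω, (|V₁ ω| + |V₂ ω| + 4 * R) ^ ν ∂μ with hM
  have hM0 : 0 ≤ M := integral_nonneg fun ω => by positivity
  set L := B₂ * 4 * R / κ + 1 with hL
  have hL0 : 0 < L := by positivity
  -- All errors proportional to a mean push, in units of (X + Y)^(a-2). The boundary derivative is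
  -- of the larger order (X + Y)^(a-1) and beats G once X + Y is at least G/k₁ and G/k₂.
  set G := B₁ * (2 * R) + B₂ * (L + 2 * R) + B₃ * (2 * R) with hG
  have hG0 : 0 ≤ G := by positivity
  obtain ⟨r₃, hr₃⟩ : ∃ r₃ : ℝ, ∀ l : ℝ, 0 < l → r₃ ≤ l → C * M * l ^ (a - ν) ≤ κ * l ^ (a - 2) := by
    refine ⟨(C * M / κ) ^ (1 / (ν - 2)), fun l hl hrl => ?_⟩
    have hν : 0 < ν - 2 := by linarith [h.two_lt]
    have h1 : C * M / κ ≤ l ^ (ν - 2) := by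
      have := Real.rpow_le_rpow (by positivity) hrl hν.le
      rwa [← Real.rpow_mul (by positivity), one_div_mul_cancel hν.ne', Real.rpow_one] at this
    rw [div_le_iff₀ hκ0] at h1
    have e1 : l ^ (a - 2) = l ^ (ν - 2) * l ^ (a - ν) := by
      rw [← Real.rpow_add hl]; congr 1; ring
    rw [e1, ← mul_assoc]
    exact mul_le_mul_of_nonneg_right (by linarith) (by positivity)
  -- The term 4R + 1 ensures that a step, which lowers X + Y by at most 2R, cannot halve it.
  refine ⟨max (max (max r₁ r₂) r₃) (max (4 * R + 1) (max (G / k₁) (G / k₂))), κ, ?_, hκ0,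
    fun X Y hX hY hr => ?_⟩
  · exact lt_max_of_lt_left (lt_max_of_lt_left (lt_max_of_lt_left hr₁))
  simp only [max_le_iff] at hr
  obtain ⟨⟨⟨hl₁, hl₂⟩, hl₃⟩, hl₄, hl₅, hl₆⟩ := hr
  have hl : 0 < X + Y := by linarith
  have ia := h.integrable_push hθ hθ2 hX
  have ib := h.symm.integrable_push hθ hθ2 hY
  obtain ⟨iAA, hAA⟩ := h.second_moment_diag hθ hθ2 hX
  obtain ⟨iBB, hBB⟩ := h.symm.second_moment_diag hθ hθ2 hY
  obtain ⟨iAB, hAB⟩ := h.second_moment_cross hθ hθ2 hX hY hL0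
  have iA : Integrable (fun ω => V₁ ω + push θ X (V₁ ω)) μ := h.integrable₁.add ia
  have iB : Integrable (fun ω => V₂ ω + push θ Y (V₂ ω)) μ := h.symm.integrable₁.add ib
  have mA : Measurable (fun ω => V₁ ω + push θ X (V₁ ω)) :=
    h.meas₁.add (measurable_push h.meas₁ θ X)
  have mB : Measurable (fun ω => V₂ ω + push θ Y (V₂ ω)) :=
    h.meas₂.add (measurable_push h.meas₂ θ Y)
  have hEA : ∫ ω, (V₁ ω + push θ X (V₁ ω)) ∂μ = ∫ ω, push θ X (V₁ ω) ∂μ := by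
    rw [integral_add h.integrable₁ ia, h.mean₁, zero_add]
  have hEB : ∫ ω, (V₂ ω + push θ Y (V₂ ω)) ∂μ = ∫ ω, push θ Y (V₂ ω) ∂μ := by
    rw [integral_add h.symm.integrable₁ ib, h.mean₂, zero_add]
  have hpt : ∀ᵐ ω ∂μ, 0 ≤ X + (V₁ ω + push θ X (V₁ ω)) ∧ 0 ≤ Y + (V₂ ω + push θ Y (V₂ ω)) ∧
      (X + Y) / 2 ≤ (X + (V₁ ω + push θ X (V₁ ω))) + (Y + (V₂ ω + push θ Y (V₂ ω))) ∧
      |V₁ ω + push θ X (V₁ ω)| + |V₂ ω + push θ Y (V₂ ω)| ≤ |V₁ ω| + |V₂ ω| + 4 * R := by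
    filter_upwards [h.lower₁, h.lower₂] with ω h₁ h₂
    have a1 := push_le hθ hθ2 hX hR h₁
    have a2 := push_le hθ hθ2 hY hR h₂
    have b1 := push_nonneg hθ X (V₁ ω)
    have b2 := push_nonneg hθ Y (V₂ ω)
    refine ⟨add_push_nonneg hθ _ _, add_push_nonneg hθ _ _, by linarith, ?_⟩
    have c1 := abs_add_le (V₁ ω) (push θ X (V₁ ω))
    have c2 := abs_add_le (V₂ ω) (push θ Y (V₂ ω))
    rw [abs_of_nonneg b1] at c1
    rw [abs_of_nonneg b2] at c2
    linarith
  set A := fun ω => V₁ ω + push θ X (V₁ ω) with hAdef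
  set B := fun ω => V₂ ω + push θ Y (V₂ ω) with hBdef
  set m₁ := ∫ ω, push θ X (V₁ ω) ∂μ with hm₁
  set m₂ := ∫ ω, push θ Y (V₂ ω) ∂μ with hm₂
  have hm₁0 : 0 ≤ m₁ := integral_nonneg fun ω => push_nonneg hθ _ _
  have hm₂0 : 0 ≤ m₂ := integral_nonneg fun ω => push_nonneg hθ _ _
  -- Either X ≥ R and the mean push vanishes, or the point is in the strip where the boundary
  -- derivative is bounded below.
  have gx : m₁ * (G * (X + Y) ^ (a - 2)) ≤
      m₁ * wedgeFun e (c * a) (ε * a) (a - 1) X Y := by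
    rcases le_or_gt R X with hXR | hXR
    · rw [hm₁, h.integral_push_eq_zero hXR, zero_mul, zero_mul]
    · refine mul_le_mul_of_nonneg_left (le_trans ?_ (hx X Y hX hY hl₁ hXR.le)) hm₁0
      have e1 : (X + Y) ^ (a - 1) = (X + Y) * (X + Y) ^ (a - 2) := by
        rw [show a - 1 = 1 + (a - 2) by ring, Real.rpow_add hl, Real.rpow_one]
      rw [e1, ← mul_assoc]
      rw [div_le_iff₀ hk₁] at hl₅
      gcongr
      linarith
  have gy : m₂ * (G * (X + Y) ^ (a - 2)) ≤
      m₂ * wedgeFun e (c * a * e) (ε * a) (a - 1) X Y := by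
    rcases le_or_gt R Y with hYR | hYR
    · rw [hm₂, h.symm.integral_push_eq_zero hYR, zero_mul, zero_mul]
    · refine mul_le_mul_of_nonneg_left (le_trans ?_ (hy X Y hX hY hl₂ hYR.le)) hm₂0
      have e1 : (X + Y) ^ (a - 1) = (X + Y) * (X + Y) ^ (a - 2) := by
        rw [show a - 1 = 1 + (a - 2) by ring, Real.rpow_add hl, Real.rpow_one]
      rw [e1, ← mul_assoc]
      rw [div_le_iff₀ hk₂] at hl₆
      gcongr
      linarith
  have hquad := wedgeFun_quadratic heρ (c * a * (a - 1)) (ε * a * (a - 1)) (a - 2) X Y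
  have b₁ := hb₁ X Y hX hY hl
  have b₂ := hb₂ X Y hX hY hl
  have b₃ := hb₃ X Y hX hY hl
  have htay := fun ω => htaylor X Y (A ω) (B ω) hX hY hl
  set F₀ := wedgeFun e c ε a X Y with hF₀
  set g₁ := wedgeFun e (c * a) (ε * a) (a - 1) X Y with hg₁
  set g₂ := wedgeFun e (c * a * e) (ε * a) (a - 1) X Y with hg₂
  set H₁ := wedgeFun e (c * a * (a - 1)) (ε * a * (a - 1)) (a - 2) X Y with hH₁
  set H₂ := wedgeFun e (c * a * (a - 1) * e) (ε * a * (a - 1)) (a - 2) X Y with hH₂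
  set H₃ := wedgeFun e (c * a * (a - 1) * e ^ 2) (ε * a * (a - 1)) (a - 2) X Y with hH₃
  set P : Ω → ℝ := fun ω => F₀ + (g₁ * A ω + g₂ * B ω)
    + (H₁ * A ω ^ 2 + 2 * H₂ * (A ω * B ω) + H₃ * B ω ^ 2) / 2 with hP
  have iLin : Integrable (fun ω => g₁ * A ω + g₂ * B ω) μ := (iA.const_mul _).add (iB.const_mul _)
  have iQ₁ : Integrable (fun ω => H₁ * A ω ^ 2 + 2 * H₂ * (A ω * B ω)) μ :=
    (iAA.const_mul _).add (iAB.const_mul _)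
  have iQ : Integrable (fun ω => H₁ * A ω ^ 2 + 2 * H₂ * (A ω * B ω) + H₃ * B ω ^ 2) μ :=
    iQ₁.add (iBB.const_mul _)
  have iFL : Integrable (fun ω => F₀ + (g₁ * A ω + g₂ * B ω)) μ := (integrable_const _).add iLin
  have iP : Integrable P μ := iFL.add (iQ.div_const 2)
  have hEP : ∫ ω, P ω ∂μ = F₀ + (g₁ * m₁ + g₂ * m₂)
      + (H₁ * ∫ ω, A ω ^ 2 ∂μ + 2 * H₂ * ∫ ω, A ω * B ω ∂μ + H₃ * ∫ ω, B ω ^ 2 ∂μ) / 2 := by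
    rw [hP, integral_add iFL (iQ.div_const 2), integral_add (integrable_const _) iLin,
      integral_add (iA.const_mul _) (iB.const_mul _), integral_div, integral_add iQ₁
      (iBB.const_mul _), integral_add (iAA.const_mul _) (iAB.const_mul _), integral_const_mul,
      integral_const_mul, integral_const_mul, integral_const_mul, integral_const_mul, hEA, hEB]
    simp
    rfl
  set F : Ω → ℝ := fun ω => wedgeFun e c ε a (X + A ω) (Y + B ω) with hF
  have mF : Measurable F := measurable_wedgeFun (mA.const_add X) (mB.const_add Y) e c ε a
  have hrem : ∀ᵐ ω ∂μ, ‖F ω - P ω‖ ≤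
      C * (X + Y) ^ (a - ν) * (|V₁ ω| + |V₂ ω| + 4 * R) ^ ν := by
    filter_upwards [hpt] with ω hω
    obtain ⟨w1, w2, w3, w4⟩ := hω
    have := htay ω w1 w2 w3
    have e1 : F ω - P ω = F ω - F₀ - (g₁ * A ω + g₂ * B ω)
        - (H₁ * A ω ^ 2 + 2 * H₂ * (A ω * B ω) + H₃ * B ω ^ 2) / 2 := by
      simp only [hP]; ring
    rw [e1]
    refine this.trans ?_
    have : 0 ≤ ν := by linarith [h.two_lt]
    gcongr
  have iDom := (h.integrable_moment (show 0 ≤ 4 * R by positivity)).const_mul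
    (C * (X + Y) ^ (a - ν))
  have iFP : Integrable (fun ω => F ω - P ω) μ :=
    iDom.mono' (mF.aestronglyMeasurable.sub iP.aestronglyMeasurable) hrem
  have iF : Integrable F μ := by simpa using iFP.fun_add iP
  refine ⟨iF, ?_⟩
  have hEF : |∫ ω, F ω ∂μ - ∫ ω, P ω ∂μ| ≤ C * (X + Y) ^ (a - ν) * M := by
    rw [← integral_sub iF iP, hM, ← integral_const_mul]
    exact norm_integral_le_of_norm_le iDom hrem
  have hlast := hr₃ (X + Y) hl hl₃
  rw [hEP] at hEF
  set S₁ := ∫ ω, A ω ^ 2 ∂μ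
  set S₂ := ∫ ω, A ω * B ω ∂μ
  set S₃ := ∫ ω, B ω ^ 2 ∂μ
  set l := (X + Y) ^ (a - 2) with hldef
  have hl0 : 0 < l := by positivity
  have u₁ : -(B₁ * l * (4 * R * m₁)) ≤ H₁ * (S₁ - 1) := by
    have : |H₁ * (S₁ - 1)| ≤ B₁ * l * (4 * R * m₁) := by rw [abs_mul]; gcongr
    exact (abs_le.1 this).1
  have u₃ : -(B₃ * l * (4 * R * m₂)) ≤ H₃ * (S₃ - 1) := by
    have : |H₃ * (S₃ - 1)| ≤ B₃ * l * (4 * R * m₂) := by rw [abs_mul]; gcongr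
    exact (abs_le.1 this).1
  have u₂ : -(B₂ * l * ((L + 2 * R) * (m₁ + m₂) + 4 * R / L)) ≤ H₂ * (S₂ - ρ) := by
    have : |H₂ * (S₂ - ρ)| ≤ B₂ * l * ((L + 2 * R) * (m₁ + m₂) + 4 * R / L) := by
      rw [abs_mul]; gcongr
    exact (abs_le.1 this).1
  have u₄ : B₂ * (4 * R / L) ≤ κ := by
    rw [← mul_div_assoc, div_le_iff₀ hL0, hL, mul_add, mul_div_cancel₀ _ hκ0.ne']
    linarith
  have u₅ : B₂ * l * (4 * R / L) ≤ κ * l := by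
    calc B₂ * l * (4 * R / L) = B₂ * (4 * R / L) * l := by ring
      _ ≤ κ * l := by gcongr
  have u₆ := (abs_le.1 hEF).1
  have u₇ : H₁ + 2 * ρ * H₂ + H₃ = 6 * κ * l := by rw [hquad, hκ]; ring
  have u₈ : B₁ * (2 * R) * (l * m₂) ≥ 0 := by positivity
  have u₉ : B₃ * (2 * R) * (l * m₁) ≥ 0 := by positivity
  have gx' : G * (l * m₁) ≤ g₁ * m₁ := by linarith
  have gy' : G * (l * m₂) ≤ g₂ * m₂ := by linarith
  rw [hG] at gx' gy'
  have : C * (X + Y) ^ (a - ν) * M ≤ κ * l := by linarith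
  linarith

/-! ### Survival probabilities and Lyapunov functions -/

section Survival

variable {S : Type*} [MeasurableSpace S]

open Classical in
/-- The probability that the chain with transition probabilities `p` avoids `B` at the times
`0, …, n`, as a function of the starting point. -/
def survival (p : S → Measure S) (B : Set S) : ℕ → S → ℝ
  | 0, z => if z ∈ B then 0 else 1
  | n + 1, z => if z ∈ B then 0 else ∫ w, survival p B n w ∂p z

variable {p : S → Measure S} {B : Set S}

lemma survival_of_mem {z : S} (h : z ∈ B) (n : ℕ) : survival p B n z = 0 := by
  cases n <;> simp [survival, h]

lemma survival_zero {z : S} (h : z ∉ B) : survival p B 0 z = 1 := by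
  simp [survival, h]

lemma survival_succ {z : S} (h : z ∉ B) (n : ℕ) :
    survival p B (n + 1) z = ∫ w, survival p B n w ∂p z := by
  simp [survival, h]

variable [DiscreteMeasurableSpace S] [∀ z, IsProbabilityMeasure (p z)]

lemma integrable_of_forall_abs_le {g : S → ℝ} {C : ℝ} (h : ∀ w, |g w| ≤ C) (z : S) :
    Integrable g (p z) :=
  (integrable_const C).mono' (Measurable.of_discrete).aestronglyMeasurable
    (Filter.Eventually.of_forall h)

lemma survival_mem_Icc (n : ℕ) (z : S) : survival p B n z ∈ Icc (0 : ℝ) 1 := by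
  induction n generalizing z with
  | zero =>
    by_cases h : z ∈ B
    · simp [survival_of_mem h]
    · simp [survival_zero h]
  | succ n ih =>
    by_cases h : z ∈ B
    · simp [survival_of_mem h]
    · rw [survival_succ h]
      refine ⟨integral_nonneg fun w => (ih w).1, ?_⟩
      have := integral_mono (μ := p z) (integrable_of_forall_abs_le (C := 1) (fun w => by
        rw [abs_of_nonneg (ih w).1]; exact (ih w).2) z) (integrable_const (1 : ℝ))
        (fun w => (ih w).2)
      simpa using this

lemma survival_nonneg (n : ℕ) (z : S) : 0 ≤ survival p B n z := (survival_mem_Icc n z).1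

lemma survival_le_one (n : ℕ) (z : S) : survival p B n z ≤ 1 := (survival_mem_Icc n z).2

lemma integrable_survival (n : ℕ) (z : S) : Integrable (survival p B n) (p z) :=
  integrable_of_forall_abs_le (C := 1) (fun w => by
    rw [abs_of_nonneg (survival_nonneg n w)]; exact survival_le_one n w) z

lemma survival_succ_le (n : ℕ) (z : S) : survival p B (n + 1) z ≤ survival p B n z := by
  induction n generalizing z with
  | zero =>
    by_cases h : z ∈ B
    · simp [survival_of_mem h]
    · rw [survival_zero h]; exact survival_le_one _ _
  | succ n ih =>
    by_cases h : z ∈ B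
    · simp [survival_of_mem h]
    · rw [survival_succ h, survival_succ h]
      exact integral_mono (integrable_survival _ z) (integrable_survival _ z) ih

lemma survival_antitone (z : S) : Antitone fun n => survival p B n z :=
  antitone_nat_of_succ_le fun n => survival_succ_le n z

/-- A Lyapunov function with a drift `-κ ℓ ^ (a - 2)` gives a polynomial bound on survival. -/
lemma survival_le_of_drift {F ℓ : S → ℝ} {a κ k : ℝ} (ha : 0 < a) (ha2 : a < 2) (hκ : 0 < κ)
    (hk : 0 < k) (hℓ : ∀ z, 1 ≤ ℓ z) (hF : ∀ z, k * ℓ z ^ a ≤ F z)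
    (hinteg : ∀ z, Integrable F (p z))
    (hdrift : ∀ z, z ∉ B → ∫ w, F w ∂p z ≤ F z - κ * ℓ z ^ (a - 2)) {n : ℕ} (hn : 0 < n) (z : S) :
    survival p B n z ≤ (1 / k + 1 / κ) * F z * (n : ℝ) ^ (-(a / 2)) := by
  have hF0 : ∀ z, 0 ≤ F z := fun z => le_trans (by have := hℓ z; positivity) (hF z)
  have hn0 : (0 : ℝ) < n := by exact_mod_cast hn
  set K : ℝ := (n : ℝ) ^ (1 / 2 : ℝ) with hK
  have hK0 : 0 < K := by positivity
  set B' : Set S := B ∪ {z | K ≤ ℓ z} with hB'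
  have hdrift0 : ∀ z, z ∉ B → ∫ w, F w ∂p z ≤ F z := fun z hz => by
    have : 0 ≤ κ * ℓ z ^ (a - 2) := by have := hℓ z; positivity
    linarith [hdrift z hz]
  -- Maximal inequality: the supermartingale F is at least kK^a when level K is reached.
  have first : ∀ m z, survival p B m z ≤ survival p B' m z + 1 / (k * K ^ a) * F z := by
    have hc : 0 ≤ 1 / (k * K ^ a) := by positivity
    have hfar : ∀ m z, K ≤ ℓ z → survival p B m z ≤ survival p B' m z + 1 / (k * K ^ a) * F z := by
      intro m z hz
      have h1 : k * K ^ a ≤ F z := le_trans (by gcongr) (hF z)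
      have h2 : 1 ≤ 1 / (k * K ^ a) * F z := by
        rw [one_div, ← div_eq_inv_mul, le_div_iff₀ (by positivity)]; linarith
      linarith [survival_le_one (p := p) (B := B) m z, survival_nonneg (p := p) (B := B') m z]
    intro m
    induction m with
    | zero =>
      intro z
      by_cases hz : z ∈ B
      · rw [survival_of_mem hz]
        have := survival_nonneg (p := p) (B := B') 0 z
        have := mul_nonneg hc (hF0 z)
        linarith
      · by_cases hz' : K ≤ ℓ z
        · exact hfar 0 z hz'
        · have hzB' : z ∉ B' := by simp [hB', hz, hz']
          rw [survival_zero hz, survival_zero hzB']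
          have := mul_nonneg hc (hF0 z)
          linarith
    | succ m ih =>
      intro z
      by_cases hz : z ∈ B
      · rw [survival_of_mem hz]
        have := survival_nonneg (p := p) (B := B') (m + 1) z
        have := mul_nonneg hc (hF0 z)
        linarith
      · by_cases hz' : K ≤ ℓ z
        · exact hfar (m + 1) z hz'
        · have hzB' : z ∉ B' := by simp [hB', hz, hz']
          rw [survival_succ hz, survival_succ hzB']
          have h1 := integral_mono (integrable_survival m z)
            ((integrable_survival (B := B') m z).add ((hinteg z).const_mul (1 / (k * K ^ a)))) ih
          simp only [Pi.add_apply] at h1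
          rw [integral_add (integrable_survival m z) ((hinteg z).const_mul _),
            integral_const_mul] at h1
          have h2 := mul_le_mul_of_nonneg_left (hdrift0 z hz) hc
          linarith
  -- The sum is a truncated mean exit time. Below level K the drift is at least κK^(a-2) in absolute
  -- value because a < 2.
  have second : ∀ m z, ∑ i ∈ Finset.range m, survival p B' i z ≤ K ^ (2 - a) / κ * F z := by
    have hc : 0 ≤ K ^ (2 - a) / κ := by positivity
    intro m
    induction m with
    | zero => intro z; simpa using mul_nonneg hc (hF0 z)
    | succ m ih =>
      intro z
      by_cases hz : z ∈ B'
      · simp only [survival_of_mem hz, Finset.sum_const_zero]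
        exact mul_nonneg hc (hF0 z)
      · have hzB : z ∉ B := fun h => hz (Or.inl h)
        have hzK : ℓ z ≤ K := le_of_not_ge fun h => hz (Or.inr h)
        rw [Finset.sum_range_succ', survival_zero hz]
        simp only [survival_succ hz]
        rw [← integral_finsetSum _ fun i _ => integrable_survival (p := p) (B := B') i z]
        have h1 := integral_mono (integrable_finsetSum (Finset.range m)
          fun i _ => integrable_survival (p := p) (B := B') i z)
          ((hinteg z).const_mul (K ^ (2 - a) / κ)) ih
        rw [integral_const_mul] at h1
        have h2 := mul_le_mul_of_nonneg_left (hdrift z hzB) hc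
        have h3 : 1 ≤ K ^ (2 - a) / κ * (κ * ℓ z ^ (a - 2)) := by
          have e1 : K ^ (2 - a) / κ * (κ * ℓ z ^ (a - 2)) = K ^ (2 - a) * ℓ z ^ (a - 2) := by
            field_simp
          rw [e1, show a - 2 = -(2 - a) by ring, Real.rpow_neg (by linarith [hℓ z]),
            ← div_eq_mul_inv, one_le_div (by have := hℓ z; positivity)]
          exact Real.rpow_le_rpow (by linarith [hℓ z]) hzK (by linarith)
        linarith
  have third : n * survival p B' n z ≤ K ^ (2 - a) / κ * F z := by
    refine le_trans ?_ (second n z)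
    have := Finset.card_nsmul_le_sum (Finset.range n) (fun i => survival p B' i z)
      (survival p B' n z) (fun i hi => survival_antitone z (Finset.mem_range.1 hi).le)
    simpa using this
  have e1 : 1 / (k * K ^ a) = 1 / k * (n : ℝ) ^ (-(a / 2)) := by
    rw [hK, ← Real.rpow_mul hn0.le, Real.rpow_neg hn0.le, show 1 / 2 * a = a / 2 by ring]
    field_simp
  have e2 : K ^ (2 - a) = n * (n : ℝ) ^ (-(a / 2)) := by
    rw [hK, ← Real.rpow_mul hn0.le, ← Real.rpow_one_add' hn0.le (by linarith)]
    congr 1; ring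
  have h4 : survival p B' n z ≤ 1 / κ * (n : ℝ) ^ (-(a / 2)) * F z := by
    rw [e2] at third
    refine le_of_mul_le_mul_left (third.trans (le_of_eq ?_)) hn0
    ring
  have := first n z
  rw [e1] at this
  linarith

/-- Removing a finite exceptional set from the drift condition, when the target `B` can be reached
from each exceptional point. -/
lemma exists_survival_le_of_drift {f ℓ : S → ℝ} {a κ k : ℝ} (ha : 0 < a) (ha2 : a < 2)
    (hκ : 0 < κ) (hk : 0 < k) (hℓ : ∀ z, 1 ≤ ℓ z) (hf : ∀ z, k * ℓ z ^ a ≤ f z)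
    (hinteg : ∀ z, Integrable f (p z)) {E : Set S} (hE : E.Finite)
    (hdrift : ∀ z, z ∉ E → ∫ w, f w ∂p z ≤ f z - κ * ℓ z ^ (a - 2))
    (hreach : ∀ z, ∃ N, survival p B N z < 1) :
    ∃ F : S → ℝ, (∀ z, 0 ≤ F z) ∧ (∀ z, Integrable F (p z)) ∧ ∀ n : ℕ, 0 < n → ∀ z,
      survival p B n z ≤ F z * (n : ℝ) ^ (-(a / 2)) := by
  choose N hN using hreach
  obtain ⟨M, hM⟩ : ∃ M, ∀ z ∈ E, N z ≤ M := by
    obtain ⟨M, hM⟩ := (hE.image N).bddAbove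
    exact ⟨M, fun z hz => hM (mem_image_of_mem N hz)⟩
  have hlt : ∀ z ∈ E, survival p B (M + 1) z < 1 := fun z hz =>
    (survival_antitone z ((hM z hz).trans M.le_succ)).trans_lt (hN z)
  obtain ⟨A, hA⟩ : ∃ A : ℝ, ∀ z ∈ E,
      (∫ w, f w ∂p z - f z + κ * ℓ z ^ (a - 2)) / (1 - survival p B (M + 1) z) ≤ A := by
    obtain ⟨A, hA⟩ := (hE.image fun z =>
      (∫ w, f w ∂p z - f z + κ * ℓ z ^ (a - 2)) / (1 - survival p B (M + 1) z)).bddAbove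
    exact ⟨A, fun z hz => hA (mem_image_of_mem _ hz)⟩
  set A' := max A 0 with hA'
  have hA0 : 0 ≤ A' := le_max_right _ _
  -- A truncated mean hitting time of B. Its one-step change telescopes to the negative of the
  -- probability of hitting B within M + 1 steps, so a large multiple of it repairs the drift on the
  -- finite set and spoils nothing elsewhere.
  set b : S → ℝ := fun z => ∑ m ∈ Finset.range (M + 1), survival p B m z with hb
  have hb0 : ∀ z, 0 ≤ b z := fun z => Finset.sum_nonneg fun m _ => survival_nonneg m z
  have ib : ∀ z, Integrable b (p z) := fun z =>
    integrable_finsetSum _ fun i _ => integrable_survival i z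
  have hbdrift : ∀ z, z ∉ B → ∫ w, b w ∂p z - b z = survival p B (M + 1) z - 1 := by
    intro z hz
    simp only [hb]
    rw [integral_finsetSum _ fun i _ => integrable_survival (p := p) (B := B) i z,
      ← Finset.sum_sub_distrib]
    simp only [← survival_succ hz]
    rw [Finset.sum_range_sub fun m => survival p B m z, survival_zero hz]
  set F : S → ℝ := fun z => f z + A' * b z with hF
  have iF : ∀ z, Integrable F (p z) := fun z => (hinteg z).add ((ib z).const_mul A')
  have hFlow : ∀ z, k * ℓ z ^ a ≤ F z := fun z =>
    (hf z).trans (le_add_of_nonneg_right (mul_nonneg hA0 (hb0 z)))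
  have hFdrift : ∀ z, z ∉ B → ∫ w, F w ∂p z ≤ F z - κ * ℓ z ^ (a - 2) := by
    intro z hz
    have e1 : ∫ w, F w ∂p z = ∫ w, f w ∂p z + A' * ∫ w, b w ∂p z := by
      rw [hF, integral_add (hinteg z) ((ib z).const_mul A'), integral_const_mul]
    have e2 := hbdrift z hz
    have e3 : A' * ∫ w, b w ∂p z = A' * b z + A' * (survival p B (M + 1) z - 1) := by
      rw [← e2]; ring
    rw [e1, e3]
    simp only [hF]
    by_cases hzE : z ∈ E
    · have h1 := hA z hzE
      have h2 : 0 < 1 - survival p B (M + 1) z := by linarith [hlt z hzE]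
      rw [div_le_iff₀ h2] at h1
      have h3 : A * (1 - survival p B (M + 1) z) ≤ A' * (1 - survival p B (M + 1) z) :=
        mul_le_mul_of_nonneg_right (le_max_left _ _) h2.le
      linarith
    · have h1 := hdrift z hzE
      have h2 : A' * (survival p B (M + 1) z - 1) ≤ 0 :=
        mul_nonpos_of_nonneg_of_nonpos hA0 (by
          linarith [survival_le_one (p := p) (B := B) (M + 1) z])
      linarith
  refine ⟨fun z => (1 / k + 1 / κ) * F z, fun z => ?_, fun z => (iF z).const_mul _,
    fun n hn z => survival_le_of_drift ha ha2 hκ hk hℓ hFlow iF hFdrift hn z⟩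
  have h1 : 0 ≤ k * ℓ z ^ a := by have := hℓ z; positivity
  have := h1.trans (hFlow z)
  positivity

/-- A bounded function which is subharmonic between `near` and `far` transfers a lower bound on
survival from `far` to everywhere. -/
lemma mul_le_survival {g : S → ℝ} {near far : Set S} {q C : ℝ} {N : ℕ} (hq0 : 0 ≤ q) (hq1 : q ≤ 1)
    (hgC : ∀ z, |g z| ≤ C) (hg1 : ∀ z, g z ≤ 1) (hnear : ∀ z ∈ near, g z ≤ 0) (hB : B ⊆ near)
    (hfar : ∀ z ∈ far, ∀ m ≤ N, q ≤ survival p B m z)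
    (hsub : ∀ z, z ∉ near → z ∉ far → g z ≤ ∫ w, g w ∂p z) {m : ℕ} (hm : m ≤ N) (z : S) :
    q * g z ≤ survival p B m z := by
  induction m generalizing z with
  | zero =>
    by_cases hz : z ∈ near
    · exact (mul_nonpos_of_nonneg_of_nonpos hq0 (hnear z hz)).trans (survival_nonneg _ _)
    · rw [survival_zero fun h => hz (hB h)]
      nlinarith [hg1 z]
  | succ m ih =>
    by_cases hz : z ∈ near
    · exact (mul_nonpos_of_nonneg_of_nonpos hq0 (hnear z hz)).trans (survival_nonneg _ _)
    by_cases hz' : z ∈ far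
    · exact (mul_le_of_le_one_right hq0 (hg1 z)).trans (hfar z hz' _ hm)
    rw [survival_succ fun h => hz (hB h)]
    have h1 := integral_mono ((integrable_of_forall_abs_le hgC z).const_mul q)
      (integrable_survival m z) (fun w => ih (by omega) w)
    rw [integral_const_mul] at h1
    exact (mul_le_mul_of_nonneg_left (hsub z hz hz') hq0).trans h1

/-- If `∫ φ dp_z ≤ φ z + s` and `φ ≥ d` on `B`, then hitting `B` within `n` steps has probability
at most `(φ z + n s) / d`. -/
lemma one_sub_survival_le {φ : S → ℝ} {s d : ℝ} (hd : 0 < d) (hs : 0 ≤ s) (hφ0 : ∀ z, 0 ≤ φ z)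
    (hinteg : ∀ z, Integrable φ (p z)) {near : Set S} (hB : B ⊆ near) (hφ : ∀ z ∈ near, d ≤ φ z)
    (hdrift : ∀ z, z ∉ near → ∫ w, φ w ∂p z ≤ φ z + s) (n : ℕ) (z : S) :
    1 - survival p B n z ≤ (φ z + n * s) / d := by
  have hmem : ∀ n : ℕ, ∀ z ∈ near, 1 - survival p B n z ≤ (φ z + n * s) / d := by
    intro n z hz
    have h1 : 1 ≤ (φ z + n * s) / d := by
      rw [le_div_iff₀ hd]
      have := hφ z hz
      have : 0 ≤ n * s := by positivity
      linarith
    linarith [survival_nonneg (p := p) (B := B) n z]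
  induction n generalizing z with
  | zero =>
    by_cases hz : z ∈ near
    · exact hmem 0 z hz
    · rw [survival_zero fun h => hz (hB h)]
      have := hφ0 z
      simp
      positivity
  | succ n ih =>
    by_cases hz : z ∈ near
    · exact hmem _ z hz
    · rw [survival_succ fun h => hz (hB h)]
      have h1 := integral_mono ((integrable_const (1 : ℝ)).sub (integrable_survival n z))
        (((hinteg z).add (integrable_const (n * s))).div_const d) ih
      simp only [Pi.sub_apply, Pi.add_apply] at h1
      rw [integral_sub (integrable_const _) (integrable_survival n z), integral_div,
        integral_add (hinteg z) (integrable_const _)] at h1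
      simp only [integral_const, probReal_univ, smul_eq_mul, one_mul] at h1
      refine h1.trans (div_le_div_of_nonneg_right ?_ hd.le)
      have := hdrift z hz
      push_cast
      linarith

end Survival

/-! ### The Markov property of the driven walk -/

/-- The trajectory from `z` driven by the sequence of increments `s 1, s 2, …`. -/
def traj (T : ℕ × ℕ → ℤ × ℤ → ℕ × ℕ) (z : ℕ × ℕ) (s : ℕ → ℤ × ℤ) : ℕ → ℕ × ℕ
  | 0 => z
  | n + 1 => T (traj T z s n) (s (n + 1))

lemma traj_congr (T : ℕ × ℕ → ℤ × ℤ → ℕ × ℕ) (z : ℕ × ℕ) {s s' : ℕ → ℤ × ℤ} {n : ℕ}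
    (h : ∀ m ≤ n, s m = s' m) : traj T z s n = traj T z s' n := by
  induction n with
  | zero => rfl
  | succ n ih => rw [traj, traj, ih fun m hm => h m (by omega), h (n + 1) le_rfl]

section Chain

variable {Ω : Type*} [MeasurableSpace Ω] {μ : Measure Ω}
  {ζ : ℕ → Ω → ℤ × ℤ} {T : ℕ × ℕ → ℤ × ℤ → ℕ × ℕ}

/-- The transition probabilities of the chain. -/
def transition (μ : Measure Ω) (ξ : Ω → ℤ × ℤ) (T : ℕ × ℕ → ℤ × ℤ → ℕ × ℕ) (z : ℕ × ℕ) :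
    Measure (ℕ × ℕ) :=
  μ.map fun ω => T z (ξ ω)

lemma measurable_step {ξ : Ω → ℤ × ℤ} (hξ : Measurable ξ) (T : ℕ × ℕ → ℤ × ℤ → ℕ × ℕ)
    (z : ℕ × ℕ) : Measurable fun ω => T z (ξ ω) :=
  (Measurable.of_discrete (f := T z)).comp hξ

lemma integral_transition {ξ : Ω → ℤ × ℤ} (hξ : Measurable ξ) (g : ℕ × ℕ → ℝ) (z : ℕ × ℕ) :
    ∫ w, g w ∂transition μ ξ T z = ∫ ω, g (T z (ξ ω)) ∂μ :=
  integral_map (measurable_step hξ T z).aemeasurable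
    (Measurable.of_discrete (f := g)).aestronglyMeasurable

lemma integrable_transition_iff {ξ : Ω → ℤ × ℤ} (hξ : Measurable ξ) (g : ℕ × ℕ → ℝ) (z : ℕ × ℕ) :
    Integrable g (transition μ ξ T z) ↔ Integrable (fun ω => g (T z (ξ ω))) μ :=
  integrable_map_measure (Measurable.of_discrete (f := g)).aestronglyMeasurable
    (measurable_step hξ T z).aemeasurable

variable [IsProbabilityMeasure μ]

lemma isProbabilityMeasure_transition {ξ : Ω → ℤ × ℤ} (hξ : Measurable ξ) (z : ℕ × ℕ) :
    IsProbabilityMeasure (transition μ ξ T z) :=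
  Measure.isProbabilityMeasure_map (measurable_step hξ T z).aemeasurable

/-- Independence and Fubini. The increment at time 0 never drives a trajectory after time 0; it
serves as a representative of the common law. Finite histories take countably many values, so
measurability is automatic. -/
lemma integral_past_next (hiid : IsIID μ ζ) {n : ℕ}
    {G : (Finset.range (n + 1) → ℤ × ℤ) → ℤ × ℤ → ℝ} {C : ℝ} (hG : ∀ t v, |G t v| ≤ C) :
    ∫ ω, G (fun i => ζ i ω) (ζ (n + 1) ω) ∂μ =
      ∫ ω, (∫ ω', G (fun i => ζ i ω) (ζ 0 ω') ∂μ) ∂μ := by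
  have mt : Measurable fun ω => (fun i : Finset.range (n + 1) => ζ i ω) :=
    measurable_pi_iff.2 fun i => hiid.measurable i
  have mn := hiid.measurable (n + 1)
  have hind : IndepFun (fun ω => (fun i : Finset.range (n + 1) => ζ i ω)) (ζ (n + 1)) μ := by
    have h1 := hiid.indep.indepFun_finset (Finset.range (n + 1)) {n + 1} (by simp) hiid.measurable
    exact h1.comp (φ := id) (ψ := fun f => f ⟨n + 1, by simp⟩) measurable_id
      Measurable.of_discrete
  have hmap := (indepFun_iff_map_prod_eq_prod_map_map mt.aemeasurable mn.aemeasurable).1 hind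
  rw [(hiid.identDistrib (n + 1)).map_eq] at hmap
  have mG : Measurable fun x : (Finset.range (n + 1) → ℤ × ℤ) × (ℤ × ℤ) => G x.1 x.2 :=
    Measurable.of_discrete
  have : IsProbabilityMeasure (μ.map (ζ 0)) :=
    Measure.isProbabilityMeasure_map (hiid.measurable 0).aemeasurable
  have : IsProbabilityMeasure (μ.map fun ω => (fun i : Finset.range (n + 1) => ζ i ω)) :=
    Measure.isProbabilityMeasure_map mt.aemeasurable
  calc ∫ ω, G (fun i => ζ i ω) (ζ (n + 1) ω) ∂μ
      = ∫ x, G x.1 x.2 ∂(μ.map fun ω => ((fun i : Finset.range (n + 1) => ζ i ω), ζ (n + 1) ω)) :=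
        (integral_map (mt.prodMk mn).aemeasurable mG.aestronglyMeasurable).symm
    _ = ∫ t, ∫ v, G t v ∂(μ.map (ζ 0))
          ∂(μ.map fun ω => (fun i : Finset.range (n + 1) => ζ i ω)) := by
        rw [hmap]
        exact integral_prod _ ((integrable_const C).mono' mG.aestronglyMeasurable
          (Filter.Eventually.of_forall fun x => hG _ _))
    _ = ∫ ω, ∫ v, G (fun i => ζ i ω) v ∂(μ.map (ζ 0)) ∂μ :=
        integral_map mt.aemeasurable (Measurable.of_discrete).aestronglyMeasurable
    _ = _ := by
        refine integral_congr_ae (Filter.Eventually.of_forall fun ω => ?_)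
        exact integral_map (hiid.measurable 0).aemeasurable
          (Measurable.of_discrete).aestronglyMeasurable

open Classical in
lemma integral_killed_succ (hiid : IsIID μ ζ) (B : Set (ℕ × ℕ)) (z : ℕ × ℕ) (n : ℕ)
    {g : ℕ × ℕ → ℝ} {C : ℝ} (hg : ∀ w, |g w| ≤ C) :
    ∫ ω, (if ∀ m, 1 ≤ m → m ≤ n + 1 → traj T z (fun i => ζ i ω) m ∉ B then
        g (traj T z (fun i => ζ i ω) (n + 1)) else 0) ∂μ =
      ∫ ω, (if ∀ m, 1 ≤ m → m ≤ n → traj T z (fun i => ζ i ω) m ∉ B then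
        ∫ w, (if w ∈ B then 0 else g w) ∂transition μ (ζ 0) T (traj T z (fun i => ζ i ω) n)
        else 0) ∂μ := by
  -- Trajectories take infinite sequences; a finite history is padded by zeros, which `traj_congr`
  -- shows to be harmless up to time n.
  set ext : (Finset.range (n + 1) → ℤ × ℤ) → ℕ → ℤ × ℤ :=
    fun t i => if h : i ∈ Finset.range (n + 1) then t ⟨i, h⟩ else 0 with hext
  have htraj : ∀ ω, ∀ m ≤ n, traj T z (fun i => ζ i ω) m =
      traj T z (ext fun i => ζ i ω) m := by
    intro ω m hm
    refine traj_congr T z fun i hi => ?_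
    simp only [hext]
    rw [dif_pos (Finset.mem_range.2 (by omega))]
  have hC : 0 ≤ C := (abs_nonneg _).trans (hg 0)
  have key := integral_past_next hiid (n := n)
    (G := fun t v => if ∀ m, 1 ≤ m → m ≤ n → traj T z (ext t) m ∉ B then
      (if T (traj T z (ext t) n) v ∈ B then 0 else g (T (traj T z (ext t) n) v)) else 0)
    (C := C) (fun t v => by
      split_ifs
      · simpa using hC
      · exact hg _
      · simpa using hC)
  refine Eq.trans ?_ (key.trans ?_)
  · refine integral_congr_ae (Filter.Eventually.of_forall fun ω => ?_)
    have e1 : (∀ m, 1 ≤ m → m ≤ n → traj T z (ext fun i => ζ i ω) m ∉ B) ↔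
        ∀ m, 1 ≤ m → m ≤ n → traj T z (fun i => ζ i ω) m ∉ B :=
      forall_congr' fun m => imp_congr_right fun _ => forall_congr' fun hm => by
        rw [htraj ω m hm]
    have e2 : (∀ m, 1 ≤ m → m ≤ n + 1 → traj T z (fun i => ζ i ω) m ∉ B) ↔
        (∀ m, 1 ≤ m → m ≤ n → traj T z (fun i => ζ i ω) m ∉ B) ∧
          traj T z (fun i => ζ i ω) (n + 1) ∉ B := by
      constructor
      · exact fun h => ⟨fun m h1 h2 => h m h1 (by omega), h _ (by omega) le_rfl⟩
      · rintro ⟨h, h'⟩ m h1 h2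
        rcases Nat.le_succ_iff.1 h2 with h3 | rfl
        · exact h m h1 h3
        · exact h'
    have e3 : T (traj T z (ext fun i => ζ i ω) n) (ζ (n + 1) ω) =
        traj T z (fun i => ζ i ω) (n + 1) := by rw [← htraj ω n le_rfl]; rfl
    simp only [e1, e2, e3]
    split_ifs <;> first | rfl | tauto
  · refine integral_congr_ae (Filter.Eventually.of_forall fun ω => ?_)
    have e1 : (∀ m, 1 ≤ m → m ≤ n → traj T z (ext fun i => ζ i ω) m ∉ B) ↔
        ∀ m, 1 ≤ m → m ≤ n → traj T z (fun i => ζ i ω) m ∉ B :=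
      forall_congr' fun m => imp_congr_right fun _ => forall_congr' fun hm => by
        rw [htraj ω m hm]
    simp only [e1, ← htraj ω n le_rfl]
    split_ifs with h
    · exact (integral_transition (μ := μ) (T := T) (hiid.measurable 0)
        (fun w => if w ∈ B then 0 else g w) _).symm
    · simp

lemma measurable_traj (hζ : ∀ n, Measurable (ζ n)) (z : ℕ × ℕ) (n : ℕ) :
    Measurable fun ω => traj T z (fun i => ζ i ω) n := by
  induction n with
  | zero => exact measurable_const
  | succ n ih =>
    exact (Measurable.of_discrete (f := fun x : (ℕ × ℕ) × (ℤ × ℤ) => T x.1 x.2)).comp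
      (ih.prodMk (hζ (n + 1)))

/-- The expectation after one more step. -/
lemma integral_traj_succ (hiid : IsIID μ ζ) (z : ℕ × ℕ) (n : ℕ) {g : ℕ × ℕ → ℝ} {C : ℝ}
    (hg : ∀ w, |g w| ≤ C) :
    ∫ ω, g (traj T z (fun i => ζ i ω) (n + 1)) ∂μ =
      ∫ ω, (∫ w, g w ∂transition μ (ζ 0) T (traj T z (fun i => ζ i ω) n)) ∂μ := by
  simpa using integral_killed_succ hiid ∅ z n hg

open Classical in
-- Steps are moved one at a time from the path to the survival function. Killing starts at time 1,
-- so that the starting point may belong to B, as return times require.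
lemma integral_killed_survival (hiid : IsIID μ ζ) (B : Set (ℕ × ℕ)) (z : ℕ × ℕ) (n k : ℕ) :
    ∫ ω, (if ∀ m, 1 ≤ m → m ≤ n → traj T z (fun i => ζ i ω) m ∉ B then
        ∫ w, survival (transition μ (ζ 0) T) B k w
          ∂transition μ (ζ 0) T (traj T z (fun i => ζ i ω) n) else 0) ∂μ =
      ∫ w, survival (transition μ (ζ 0) T) B (n + k) w ∂transition μ (ζ 0) T z := by
  have := isProbabilityMeasure_transition (μ := μ) (T := T) (hiid.measurable 0)
  induction n generalizing k with
  | zero =>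
    have : ∀ ω, ∀ m, 1 ≤ m → m ≤ 0 → traj T z (fun i => ζ i ω) m ∉ B := fun ω m h1 h2 => by omega
    simp only [if_pos (this _), traj]
    simp
  | succ n ih =>
    rw [integral_killed_succ hiid B z n (C := 1) (g := fun v =>
      ∫ w, survival (transition μ (ζ 0) T) B k w ∂transition μ (ζ 0) T v)]
    · rw [show n + 1 + k = n + (k + 1) by ring, ← ih (k + 1)]
      rfl
    · intro v
      rw [abs_of_nonneg (integral_nonneg fun w => survival_nonneg k w)]
      have := integral_mono (integrable_survival (B := B) k v)
        (integrable_const (μ := transition μ (ζ 0) T v) (1 : ℝ)) (fun w => survival_le_one k w)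
      simpa using this

lemma measurableSet_avoid (hζ : ∀ n, Measurable (ζ n)) (B : Set (ℕ × ℕ)) (z : ℕ × ℕ) (n : ℕ) :
    MeasurableSet {ω | ∀ m, 1 ≤ m → m ≤ n → traj T z (fun i => ζ i ω) m ∉ B} := by
  simp only [ofPred_forall]
  exact MeasurableSet.iInter fun m => MeasurableSet.iInter fun _ => MeasurableSet.iInter fun _ =>
    (measurable_traj hζ z m) (MeasurableSet.of_discrete (s := Bᶜ))

/-- The probability of avoiding `B` at the times `1, …, n + 1`. -/
lemma measureReal_avoid_succ (hiid : IsIID μ ζ) (B : Set (ℕ × ℕ)) (z : ℕ × ℕ) (n : ℕ) :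
    μ.real {ω | ∀ m, 1 ≤ m → m ≤ n + 1 → traj T z (fun i => ζ i ω) m ∉ B} =
      ∫ w, survival (transition μ (ζ 0) T) B n w ∂transition μ (ζ 0) T z := by
  classical
  have h1 := integral_killed_succ (T := T) hiid B z n (g := fun _ => 1) (C := 1) (by simp)
  have h2 := integral_killed_survival (T := T) hiid B z n 0
  rw [add_zero] at h2
  rw [← h2, ← integral_indicator_one (measurableSet_avoid hiid.measurable B z (n + 1))]
  refine Eq.trans ?_ (h1.trans ?_)
  · refine integral_congr_ae (Filter.Eventually.of_forall fun ω => ?_)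
    simp [indicator]
  · rfl

/-- The probability of avoiding `B` at the times `0, …, n`, from a point outside `B`. -/
lemma measureReal_avoid (hiid : IsIID μ ζ) {B : Set (ℕ × ℕ)} {z : ℕ × ℕ} (hz : z ∉ B) (n : ℕ) :
    μ.real {ω | ∀ m ≤ n, traj T z (fun i => ζ i ω) m ∉ B} =
      survival (transition μ (ζ 0) T) B n z := by
  cases n with
  | zero => simp [survival_zero hz, traj, hz]
  | succ n =>
    rw [survival_succ hz, ← measureReal_avoid_succ hiid]
    congr 1
    ext ω
    refine forall_congr' fun m => ⟨fun h _ hm => h hm, fun h hm => ?_⟩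
    cases m with
    | zero => exact hz
    | succ m => exact h (by omega) hm

end Chain

/-! ### From the normalized quadrant to the lattice -/

/-- The size of a state in normalized coordinates. -/
def size (s₁ s₂ : ℝ) (z : ℕ × ℕ) : ℝ := z.1 / s₁ + z.2 / s₂

/-- A function on the normalized quadrant as a function on states. -/
def wedgeState (s₁ s₂ : ℝ) (e c : ℂ) (ε a : ℝ) (z : ℕ × ℕ) : ℝ :=
  wedgeFun e c ε a (z.1 / s₁) (z.2 / s₂)

/-- The walk with step map `T`, whose push at the boundary is `θ` times the overshoot, and with
increments which are normalized after division of the coordinates by `s₁` and `s₂`. -/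
structure IsReflectedWalk {Ω : Type*} [MeasurableSpace Ω] (μ : Measure Ω) (ζ : ℕ → Ω → ℤ × ℤ)
    (T : ℕ × ℕ → ℤ × ℤ → ℕ × ℕ) (s₁ s₂ θ ρ ν R : ℝ) : Prop where
  iid : IsIID μ ζ
  s₁_pos : 0 < s₁
  s₂_pos : 0 < s₂
  one_le : 1 ≤ θ
  le_two : θ ≤ 2
  step₁ : ∀ z v, ((T z v).1 : ℝ) = z.1 + (v.1 + push θ z.1 v.1)
  step₂ : ∀ z v, ((T z v).2 : ℝ) = z.2 + (v.2 + push θ z.2 v.2)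
  normalized : NormalizedIncrement μ (fun ω => ((ζ 0 ω).1 : ℝ) / s₁) (fun ω => ((ζ 0 ω).2 : ℝ) / s₂)
    ρ ν R

lemma push_div {s : ℝ} (hs : 0 < s) (θ X v : ℝ) : push θ X v / s = push θ (X / s) (v / s) := by
  unfold push
  rw [mul_div_assoc, ← add_div, ← neg_div]
  congr 1
  rcases le_total (-(X + v)) 0 with h | h
  · rw [max_eq_right h, max_eq_right (div_nonpos_of_nonpos_of_nonneg h hs.le), zero_div]
  · rw [max_eq_left h, max_eq_left (div_nonneg h hs.le)]

lemma size_nonneg {s₁ s₂ : ℝ} (h₁ : 0 < s₁) (h₂ : 0 < s₂) (z : ℕ × ℕ) : 0 ≤ size s₁ s₂ z := by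
  unfold size; positivity

lemma finite_size_le {s₁ s₂ : ℝ} (h₁ : 0 < s₁) (h₂ : 0 < s₂) (b : ℝ) :
    {z | size s₁ s₂ z ≤ b}.Finite := by
  refine ((finite_Iic (⌊b * s₁⌋₊)).prod (finite_Iic (⌊b * s₂⌋₊))).subset fun z hz => ?_
  have hz' : (z.1 : ℝ) / s₁ + z.2 / s₂ ≤ b := hz
  have a1 : 0 ≤ (z.1 : ℝ) / s₁ := by positivity
  have a2 : 0 ≤ (z.2 : ℝ) / s₂ := by positivity
  refine ⟨Nat.le_floor ?_, Nat.le_floor ?_⟩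
  · rw [← div_le_iff₀ h₁]; linarith
  · rw [← div_le_iff₀ h₂]; linarith

lemma le_size_of_ne_zero {s₁ s₂ : ℝ} (h₁ : 0 < s₁) (h₂ : 0 < s₂) {z : ℕ × ℕ} (hz : z ≠ 0) :
    min (1 / s₁) (1 / s₂) ≤ size s₁ s₂ z := by
  unfold size
  rcases Nat.eq_zero_or_pos z.1 with h | h
  · have h' : 0 < z.2 := Nat.pos_of_ne_zero fun h2 => hz (Prod.ext h h2)
    have : (1 : ℝ) ≤ z.2 := by exact_mod_cast h'
    calc min (1 / s₁) (1 / s₂) ≤ 1 / s₂ := min_le_right _ _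
      _ ≤ z.2 / s₂ := by gcongr
      _ ≤ _ := le_add_of_nonneg_left (by positivity)
  · have : (1 : ℝ) ≤ z.1 := by exact_mod_cast h
    calc min (1 / s₁) (1 / s₂) ≤ 1 / s₁ := min_le_left _ _
      _ ≤ z.1 / s₁ := by gcongr
      _ ≤ _ := le_add_of_nonneg_right (by positivity)

lemma size_pos {s₁ s₂ : ℝ} (h₁ : 0 < s₁) (h₂ : 0 < s₂) {z : ℕ × ℕ} (hz : z ≠ 0) :
    0 < size s₁ s₂ z :=
  lt_of_lt_of_le (by positivity) (le_size_of_ne_zero h₁ h₂ hz)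

lemma wedgeState_real_mul (s₁ s₂ : ℝ) (e c : ℂ) (ε a s : ℝ) (z : ℕ × ℕ) :
    wedgeState s₁ s₂ e (s * c) (s * ε) a z = s * wedgeState s₁ s₂ e c ε a z := by
  unfold wedgeState wedgeFun
  rw [mul_assoc, Complex.re_ofReal_mul]
  ring

lemma wedgeState_zero (s₁ s₂ : ℝ) (e c : ℂ) (ε : ℝ) {a : ℝ} (ha : a ≠ 0) :
    wedgeState s₁ s₂ e c ε a 0 = 0 := by
  have : (a : ℂ) ≠ 0 := by exact_mod_cast ha
  simp [wedgeState, wedgeFun, Complex.zero_cpow this, Real.zero_rpow ha]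

namespace IsReflectedWalk

variable {Ω : Type*} [MeasurableSpace Ω] {μ : Measure Ω} {ζ : ℕ → Ω → ℤ × ℤ}
  {T : ℕ × ℕ → ℤ × ℤ → ℕ × ℕ} {s₁ s₂ θ ρ ν R : ℝ}

lemma step_div₁ (h : IsReflectedWalk μ ζ T s₁ s₂ θ ρ ν R) (z : ℕ × ℕ) (v : ℤ × ℤ) :
    ((T z v).1 : ℝ) / s₁ = z.1 / s₁ + (v.1 / s₁ + push θ (z.1 / s₁) (v.1 / s₁)) := by
  rw [h.step₁, add_div, add_div, push_div h.s₁_pos]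

lemma step_div₂ (h : IsReflectedWalk μ ζ T s₁ s₂ θ ρ ν R) (z : ℕ × ℕ) (v : ℤ × ℤ) :
    ((T z v).2 : ℝ) / s₂ = z.2 / s₂ + (v.2 / s₂ + push θ (z.2 / s₂) (v.2 / s₂)) := by
  rw [h.step₂, add_div, add_div, push_div h.s₂_pos]

/-- Downward jumps are bounded, upward jumps are controlled only through moments. -/
lemma size_step_mem (h : IsReflectedWalk μ ζ T s₁ s₂ θ ρ ν R) (z : ℕ × ℕ) :
    ∀ᵐ ω ∂μ, size s₁ s₂ z - 2 * R ≤ size s₁ s₂ (T z (ζ 0 ω)) ∧ size s₁ s₂ (T z (ζ 0 ω)) ≤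
      size s₁ s₂ z + (|((ζ 0 ω).1 : ℝ) / s₁| + |((ζ 0 ω).2 : ℝ) / s₂| + 4 * R) := by
  have p₁ := h.s₁_pos
  have p₂ := h.s₂_pos
  filter_upwards [h.normalized.lower₁, h.normalized.lower₂] with ω h₁ h₂
  have a1 := push_le (X := z.1 / s₁) h.one_le h.le_two (by positivity) h.normalized.R_nonneg h₁
  have a2 := push_le (X := z.2 / s₂) h.one_le h.le_two (by positivity) h.normalized.R_nonneg h₂
  have b1 := push_nonneg h.one_le (z.1 / s₁) (((ζ 0 ω).1 : ℝ) / s₁)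
  have b2 := push_nonneg h.one_le (z.2 / s₂) (((ζ 0 ω).2 : ℝ) / s₂)
  unfold size
  rw [h.step_div₁, h.step_div₂]
  constructor
  · linarith
  · linarith [le_abs_self (((ζ 0 ω).1 : ℝ) / s₁), le_abs_self (((ζ 0 ω).2 : ℝ) / s₂)]

variable [IsProbabilityMeasure μ]

lemma isProbabilityMeasure (h : IsReflectedWalk μ ζ T s₁ s₂ θ ρ ν R) (z : ℕ × ℕ) :
    IsProbabilityMeasure (transition μ (ζ 0) T z) :=
  isProbabilityMeasure_transition (h.iid.measurable 0) z

lemma integrable_of_le_size (h : IsReflectedWalk μ ζ T s₁ s₂ θ ρ ν R) {g : ℕ × ℕ → ℝ} {C : ℝ}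
    (hC : 0 ≤ C) (hg : ∀ w, |g w| ≤ C * (1 + size s₁ s₂ w)) (z : ℕ × ℕ) :
    Integrable g (transition μ (ζ 0) T z) := by
  rw [integrable_transition_iff (h.iid.measurable 0)]
  have i1 : Integrable (fun ω => C * (1 + (size s₁ s₂ z
      + (|((ζ 0 ω).1 : ℝ) / s₁| + |((ζ 0 ω).2 : ℝ) / s₂| + 4 * R)))) μ := by
    have := h.normalized.integrable₁.abs
    have := h.normalized.symm.integrable₁.abs
    fun_prop
  refine i1.mono' ((Measurable.of_discrete (f := g)).comp
    (measurable_step (h.iid.measurable 0) T z)).aestronglyMeasurable ?_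
  filter_upwards [h.size_step_mem z] with ω hω
  refine (hg _).trans ?_
  gcongr
  exact hω.2

/-- The drift inequality on the lattice. -/
lemma drift (h : IsReflectedWalk μ ζ T s₁ s₂ θ ρ ν R) {e c : ℂ} {ε a : ℝ} (he : 0 < e.im)
    (he1 : ‖e‖ = 1) (heρ : 1 + 2 * ρ * e + e ^ 2 = 0) (hρ : -1 < ρ) (ha : a ≤ 2)
    (hsub : IsWedgeSub e c ε a) :
    ∃ r κ : ℝ, 0 < r ∧ 0 < κ ∧ ∀ z, r ≤ size s₁ s₂ z →
      Integrable (wedgeState s₁ s₂ e c ε a) (transition μ (ζ 0) T z) ∧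
      wedgeState s₁ s₂ e c ε a z + κ * size s₁ s₂ z ^ (a - 2) ≤
        ∫ w, wedgeState s₁ s₂ e c ε a w ∂transition μ (ζ 0) T z := by
  have p₁ := h.s₁_pos
  have p₂ := h.s₂_pos
  obtain ⟨r, κ, hr, hκ, hd⟩ := h.normalized.drift h.one_le h.le_two he he1 heρ hρ ha hsub
  refine ⟨r, κ, hr, hκ, fun z hz => ?_⟩
  rw [integral_transition (h.iid.measurable 0), integrable_transition_iff (h.iid.measurable 0)]
  have := hd (z.1 / s₁) (z.2 / s₂) (by positivity) (by positivity) hz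
  simp only [wedgeState, h.step_div₁, h.step_div₂]
  exact this

end IsReflectedWalk

lemma wedgeState_le {s₁ s₂ : ℝ} (h₁ : 0 < s₁) (h₂ : 0 < s₂) {e : ℂ} (he : 0 < e.im) (c : ℂ)
    (ε : ℝ) {a : ℝ} (ha : a ≠ 0) :
    ∃ C : ℝ, 0 ≤ C ∧ ∀ z, |wedgeState s₁ s₂ e c ε a z| ≤ C * size s₁ s₂ z ^ a := by
  obtain ⟨C, hC, h⟩ := exists_abs_wedgeFun_le he c ε a
  refine ⟨C, hC, fun z => ?_⟩
  rcases eq_or_ne z 0 with rfl | hz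
  · simp [wedgeState_zero s₁ s₂ e c ε ha, size, Real.zero_rpow ha]
  · exact h _ _ (by positivity) (by positivity) (size_pos h₁ h₂ hz)

lemma le_wedgeState {s₁ s₂ : ℝ} (h₁ : 0 < s₁) (h₂ : 0 < s₂) {e : ℂ} (he : 0 < e.im) (c : ℂ)
    (ε : ℝ) {a : ℝ} (ha : a ≠ 0) (hpos : ∀ y ∈ Icc (0 : ℝ) 1, 0 < wedgeFun e c ε a (1 - y) y) :
    ∃ k : ℝ, 0 < k ∧ ∀ z, k * size s₁ s₂ z ^ a ≤ wedgeState s₁ s₂ e c ε a z := by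
  obtain ⟨k, hk, h⟩ := exists_le_wedgeFun he c ε a hpos
  refine ⟨k, hk, fun z => ?_⟩
  rcases eq_or_ne z 0 with rfl | hz
  -- At the origin both sides vanish, also for negative a, by the convention 0^a = 0.
  · simp [wedgeState_zero s₁ s₂ e c ε ha, size, Real.zero_rpow ha]
  · exact h _ _ (by positivity) (by positivity) (size_pos h₁ h₂ hz)

lemma one_add_two_mul_exp {ξ ρ : ℝ} (h : Real.cos ξ = -ρ) :
    1 + 2 * (ρ : ℂ) * Complex.exp (ξ * Complex.I) + Complex.exp (ξ * Complex.I) ^ 2 = 0 := by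
  have hsc := Real.sin_sq_add_cos_sq ξ
  have hre := Complex.exp_ofReal_mul_I_re ξ
  have him := Complex.exp_ofReal_mul_I_im ξ
  rw [h] at hre hsc
  generalize Complex.exp (ξ * Complex.I) = e at *
  generalize Real.sin ξ = t at *
  apply Complex.ext
  · simp [pow_two, hre, him]
    nlinarith
  · simp [pow_two, hre, him]
    ring

lemma exp_im_pos {ξ : ℝ} (h0 : 0 < ξ) (hπ : ξ < Real.pi) :
    0 < (Complex.exp (ξ * Complex.I)).im := by
  rw [Complex.exp_ofReal_mul_I_im]; exact Real.sin_pos_of_pos_of_lt_pi h0 hπ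

/-! ### Lyapunov functions for the walk and escape to large distances -/

namespace IsReflectedWalk

variable {Ω : Type*} [MeasurableSpace Ω] {μ : Measure Ω} [IsProbabilityMeasure μ]
  {ζ : ℕ → Ω → ℤ × ℤ} {T : ℕ × ℕ → ℤ × ℤ → ℕ × ℕ} {s₁ s₂ θ ρ ν R ξ a : ℝ}

/-- Lyapunov functions of order `a` for the walk: a positive function comparable to `size ^ a`
which, multiplied by `s`, is a strict submartingale far from the origin. -/
lemma exists_lyapunov (h : IsReflectedWalk μ ζ T s₁ s₂ θ ρ ν R) (h0 : 0 < ξ) (hπ : ξ < Real.pi)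
    (hξ : Real.cos ξ = -ρ) {s : ℝ} (ha : |a| < 1) (hs : s = 1 ∨ s = -1)
    (hcos : 0 < s * a * Real.cos (ξ - a * ξ / 2)) :
    ∃ (W : ℕ × ℕ → ℝ) (k C r κ : ℝ), 0 < k ∧ 0 < C ∧ 0 < r ∧ 0 < κ ∧
      (∀ z, k * size s₁ s₂ z ^ a ≤ W z) ∧ (∀ z, W z ≤ C * size s₁ s₂ z ^ a) ∧
      ∀ z, r ≤ size s₁ s₂ z → Integrable W (transition μ (ζ 0) T z) ∧
        s * W z + κ * size s₁ s₂ z ^ (a - 2) ≤ s * ∫ w, W w ∂transition μ (ζ 0) T z := by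
  have ha0 : a ≠ 0 := by rintro rfl; simp at hcos
  have hs2 : s * s = 1 := by rcases hs with rfl | rfl <;> norm_num
  have him := exp_im_pos h0 hπ
  have hρ : -1 < ρ := by
    have : Real.cos ξ < 1 := by
      rw [← Real.cos_zero]
      exact Real.cos_lt_cos_of_nonneg_of_le_pi le_rfl hπ.le h0
    linarith
  obtain ⟨c, ε, hsub, hpos⟩ := exists_isWedgeSub h0 hπ ha hs hcos
  obtain ⟨k, hk, hlow⟩ := le_wedgeState h.s₁_pos h.s₂_pos him c ε ha0 hpos
  obtain ⟨C, hC, hup⟩ := wedgeState_le h.s₁_pos h.s₂_pos him c ε ha0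
  obtain ⟨r, κ, hr, hκ, hd⟩ := h.drift him (Complex.norm_exp_ofReal_mul_I ξ)
    (one_add_two_mul_exp hξ) hρ (by linarith [(abs_lt.1 ha).2]) hsub
  refine ⟨wedgeState s₁ s₂ (Complex.exp (ξ * Complex.I)) c ε a, k, C + 1, r, κ, hk, by linarith, hr,
    hκ, hlow, fun z => ?_, fun z hz => ?_⟩
  · refine (le_abs_self _).trans ((hup z).trans ?_)
    have := size_nonneg h.s₁_pos h.s₂_pos z
    gcongr
    linarith
  · obtain ⟨hi, hd⟩ := hd z hz
    simp only [wedgeState_real_mul] at hd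
    rw [integral_const_mul] at hd
    refine ⟨?_, hd⟩
    have := hi.const_mul s
    refine this.congr (Filter.Eventually.of_forall fun w => ?_)
    simp only [wedgeState_real_mul]
    rw [← mul_assoc, hs2, one_mul]

/-- Polynomial upper bound on survival probabilities. -/
lemma exists_survival_le (h : IsReflectedWalk μ ζ T s₁ s₂ θ ρ ν R) (h0 : 0 < ξ) (hπ : ξ < Real.pi)
    (hξ : Real.cos ξ = -ρ) (ha : 0 < a) (haα : a < 2 - Real.pi / ξ) {B : Set (ℕ × ℕ)}
    (hreach : ∀ z, ∃ N, survival (transition μ (ζ 0) T) B N z < 1) :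
    ∃ F : ℕ × ℕ → ℝ, (∀ z, 0 ≤ F z) ∧ (∀ z, Integrable F (transition μ (ζ 0) T z)) ∧
      ∀ n : ℕ, 0 < n → ∀ z,
        survival (transition μ (ζ 0) T) B n z ≤ F z * (n : ℝ) ^ (-(a / 2)) := by
  have := h.isProbabilityMeasure
  have h1 : a * ξ < 2 * ξ - Real.pi := by
    have : Real.pi / ξ < 2 - a := by linarith
    rw [div_lt_iff₀ h0] at this
    linarith
  have ha1 : a < 1 := by nlinarith
  -- Below the critical exponent the angle ξ - aξ/2 exceeds π/2, so the function decreases under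
  -- reflection.
  have hcos : 0 < -1 * a * Real.cos (ξ - a * ξ / 2) := by
    have := Real.cos_neg_of_pi_div_two_lt_of_lt (x := ξ - a * ξ / 2) (by linarith)
      (by nlinarith [Real.pi_pos])
    nlinarith
  obtain ⟨W, k, C, r, κ, hk, hC, hr, hκ, hlow, hup, hd⟩ := h.exists_lyapunov h0 hπ hξ
    (abs_lt.2 ⟨by linarith, ha1⟩) (Or.inr rfl) hcos
  have hℓ := size_nonneg h.s₁_pos h.s₂_pos
  have hW0 : ∀ z, 0 ≤ W z := fun z => le_trans (by have := hℓ z; positivity) (hlow z)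
  have iW : ∀ z, Integrable W (transition μ (ζ 0) T z) := fun z => by
    refine h.integrable_of_le_size hC.le (fun w => ?_) z
    rw [abs_of_nonneg (hW0 w)]
    refine (hup w).trans ?_
    gcongr
    calc size s₁ s₂ w ^ a ≤ (1 + size s₁ s₂ w) ^ a :=
          Real.rpow_le_rpow (hℓ w) (by linarith) ha.le
      _ ≤ (1 + size s₁ s₂ w) ^ (1 : ℝ) :=
          Real.rpow_le_rpow_of_exponent_le (by linarith [hℓ w]) ha1.le
      _ = _ := Real.rpow_one _
  -- The size is shifted by 1 to be bounded away from zero; subadditivity of x ↦ x^a compensates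
  -- with the constant k.
  refine exists_survival_le_of_drift (f := fun z => W z + k) (ℓ := fun z => 1 + size s₁ s₂ z)
    (κ := κ) (k := k) ha (by linarith) hκ hk (fun z => by linarith [hℓ z]) (fun z => ?_)
    (fun z => (iW z).add (integrable_const k)) (finite_size_le h.s₁_pos h.s₂_pos r) (fun z hz => ?_)
    hreach
  · have := Real.rpow_add_le_add_rpow zero_le_one (hℓ z) ha.le ha1.le
    rw [Real.one_rpow] at this
    have := mul_le_mul_of_nonneg_left this hk.le
    linarith [hlow z]
  · have hz' : r ≤ size s₁ s₂ z := le_of_not_ge hz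
    obtain ⟨_, hd⟩ := hd z hz'
    rw [integral_add (iW z) (integrable_const k)]
    simp only [integral_const, probReal_univ, smul_eq_mul, one_mul]
    have : (1 + size s₁ s₂ z) ^ (a - 2) ≤ size s₁ s₂ z ^ (a - 2) :=
      Real.rpow_le_rpow_of_nonpos (by linarith) (by linarith) (by linarith)
    have := mul_le_mul_of_nonneg_left this hκ.le
    linarith

/-- A truncated Lyapunov function is subharmonic in an annulus. -/
lemma exists_truncated_subharmonic (h : IsReflectedWalk μ ζ T s₁ s₂ θ ρ ν R) (h0 : 0 < ξ)
    (hπ : ξ < Real.pi) (hξ : Real.cos ξ = -ρ) (ha : 0 < a) (ha1 : a < 1)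
    (haα : 2 - Real.pi / ξ < a) :
    ∃ (W : ℕ × ℕ → ℝ) (k C r K₀ : ℝ), 0 < k ∧ 0 < C ∧
      (∀ z, k * size s₁ s₂ z ^ a ≤ W z) ∧ (∀ z, W z ≤ C * size s₁ s₂ z ^ a) ∧
      ∀ K, K₀ ≤ K → ∀ z, r ≤ size s₁ s₂ z → size s₁ s₂ z < K →
        min (W z) (C * (2 * K) ^ a) ≤
          ∫ w, min (W w) (C * (2 * K) ^ a) ∂transition μ (ζ 0) T z := by
  have := h.isProbabilityMeasure
  have h1 : 2 * ξ - Real.pi < a * ξ := by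
    have : 2 - a < Real.pi / ξ := by linarith
    rw [lt_div_iff₀ h0] at this
    linarith
  have hcos : 0 < 1 * a * Real.cos (ξ - a * ξ / 2) := by
    have := Real.cos_pos_of_mem_Ioo (x := ξ - a * ξ / 2)
      ⟨by nlinarith [Real.pi_pos], by linarith⟩
    positivity
  obtain ⟨W, k, C, r, κ, hk, hC, hr, hκ, hlow, hup, hd⟩ := h.exists_lyapunov h0 hπ hξ
    (abs_lt.2 ⟨by linarith, ha1⟩) (Or.inl rfl) hcos
  have hℓ := size_nonneg h.s₁_pos h.s₂_pos
  have hW0 : ∀ z, 0 ≤ W z := fun z => le_trans (by have := hℓ z; positivity) (hlow z)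
  have hν := h.normalized.two_lt
  have hR := h.normalized.R_nonneg
  set D : Ω → ℝ := fun ω => |((ζ 0 ω).1 : ℝ) / s₁| + |((ζ 0 ω).2 : ℝ) / s₂| + 4 * R with hD
  have iD : Integrable (fun ω => D ω ^ ν) μ := h.normalized.integrable_moment (by positivity)
  set M := ∫ ω, D ω ^ ν ∂μ with hM
  have hM0 : 0 ≤ M := integral_nonneg fun ω => by positivity
  -- For K^(ν-2) ≥ Q the loss from truncation, of order K^(a-ν), is below the drift, which is at
  -- least κK^(a-2) when the size is below K.
  set Q := C * 2 ^ a * M / κ with hQ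
  refine ⟨W, k, C, r, max 1 (Q ^ (1 / (ν - 2))), hk, hC, hlow, hup, fun K hK z hrz hzK => ?_⟩
  rw [max_le_iff] at hK
  have hK0 : 0 < K := by linarith [hK.1]
  have hz0 : 0 < size s₁ s₂ z := by linarith
  obtain ⟨iW, hdz⟩ := hd z hrz
  rw [one_mul, one_mul] at hdz
  have hQK : C * 2 ^ a * M * K ^ (a - ν) ≤ κ * K ^ (a - 2) := by
    have hν' : 0 < ν - 2 := by linarith
    have h1 : Q ≤ K ^ (ν - 2) := by
      have := Real.rpow_le_rpow (by positivity) hK.2 hν'.le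
      rwa [← Real.rpow_mul (by positivity), one_div_mul_cancel hν'.ne', Real.rpow_one] at this
    rw [hQ, div_le_iff₀ hκ] at h1
    have e1 : K ^ (a - 2) = K ^ (ν - 2) * K ^ (a - ν) := by
      rw [← Real.rpow_add hK0]; congr 1; ring
    rw [e1, ← mul_assoc]
    exact mul_le_mul_of_nonneg_right (by linarith) (by positivity)
  have hpt : ∀ᵐ ω ∂μ, W (T z (ζ 0 ω)) - C * 2 ^ a * K ^ (a - ν) * D ω ^ ν ≤
      min (W (T z (ζ 0 ω))) (C * (2 * K) ^ a) := by
    filter_upwards [h.size_step_mem z] with ω hω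
    have hD0 : 0 ≤ D ω := by positivity
    have ht := hω.2
    have hp : 0 ≤ C * 2 ^ a * K ^ (a - ν) * D ω ^ ν := by positivity
    rcases le_or_gt (size s₁ s₂ (T z (ζ 0 ω))) (2 * K) with hle | hgt
    · have : W (T z (ζ 0 ω)) ≤ C * (2 * K) ^ a := (hup _).trans (by
        have := hℓ (T z (ζ 0 ω)); gcongr)
      rw [min_eq_left this]
      linarith
    -- Truncation acts only above size 2K, which a point of size below K reaches only by a jump
    -- longer than K; the moment of order ν pays for such jumps.
    · have hDK : K ≤ D ω := by simp only [hD]; linarith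
      have hDpos : 0 < D ω := by linarith
      have h2 : W (T z (ζ 0 ω)) ≤ C * 2 ^ a * K ^ (a - ν) * D ω ^ ν := by
        calc W (T z (ζ 0 ω)) ≤ C * size s₁ s₂ (T z (ζ 0 ω)) ^ a := hup _
          _ ≤ C * (2 * D ω) ^ a := by
            have := hℓ (T z (ζ 0 ω))
            gcongr
            simp only [hD] at hDK ⊢
            linarith
          _ = C * 2 ^ a * (D ω ^ (a - ν) * D ω ^ ν) := by
            rw [Real.mul_rpow (by norm_num) hD0, ← Real.rpow_add hDpos, sub_add_cancel]; ring
          _ ≤ C * 2 ^ a * (K ^ (a - ν) * D ω ^ ν) := by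
            have := Real.rpow_le_rpow_of_nonpos hK0 hDK (show a - ν ≤ 0 by linarith)
            gcongr
          _ = _ := by ring
      have h3 : 0 ≤ min (W (T z (ζ 0 ω))) (C * (2 * K) ^ a) := le_min (hW0 _) (by positivity)
      linarith
  have iW' := (integrable_transition_iff (h.iid.measurable 0) W z).1 iW
  have imin : Integrable (fun w => min (W w) (C * (2 * K) ^ a)) (transition μ (ζ 0) T z) :=
    iW.inf (integrable_const _)
  have imin' := (integrable_transition_iff (h.iid.measurable 0) _ z).1 imin
  have hmono := integral_mono_ae (iW'.sub (iD.const_mul (C * 2 ^ a * K ^ (a - ν)))) imin' hpt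
  simp only [Pi.sub_apply] at hmono
  rw [integral_sub iW' (iD.const_mul _), integral_const_mul, ← hM] at hmono
  rw [integral_transition (h.iid.measurable 0)] at hdz ⊢
  refine (min_le_left _ _).trans (le_trans ?_ hmono)
  have h5 : κ * K ^ (a - 2) ≤ κ * size s₁ s₂ z ^ (a - 2) := by
    have := Real.rpow_le_rpow_of_nonpos hz0 hzK.le (show a - 2 ≤ 0 by linarith)
    gcongr
  linarith

/-- Lower bound for survival in terms of survival from afar. -/
lemma exists_mul_le_survival (h : IsReflectedWalk μ ζ T s₁ s₂ θ ρ ν R) (h0 : 0 < ξ)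
    (hπ : ξ < Real.pi) (hξ : Real.cos ξ = -ρ) (ha : 0 < a) (ha1 : a < 1)
    (haα : 2 - Real.pi / ξ < a) {B : Set (ℕ × ℕ)} {b : ℝ} (hB : ∀ z ∈ B, size s₁ s₂ z ≤ b) :
    ∃ r₀ K₀ δ : ℝ, 0 < K₀ ∧ 0 < δ ∧ ∀ z, r₀ ≤ size s₁ s₂ z → ∀ K, K₀ ≤ K → ∀ q : ℝ, 0 ≤ q →
      q ≤ 1 → ∀ N : ℕ, (∀ w, K ≤ size s₁ s₂ w → ∀ m ≤ N,
        q ≤ survival (transition μ (ζ 0) T) B m w) →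
      q * (δ * K ^ (-a)) ≤ survival (transition μ (ζ 0) T) B N z := by
  have := h.isProbabilityMeasure
  obtain ⟨W, k, C, r, K₀, hk, hC, hlow, hup, hsub⟩ :=
    h.exists_truncated_subharmonic h0 hπ hξ ha ha1 haα
  have hℓ := size_nonneg h.s₁_pos h.s₂_pos
  have hW0 : ∀ z, 0 ≤ W z := fun z => le_trans (by have := hℓ z; positivity) (hlow z)
  set r' := max (max r (b + 1)) 1 with hr'
  have hr_one : 1 ≤ r' := le_max_right _ _
  have hr_ge : r ≤ r' := (le_max_left _ _).trans (le_max_left _ _)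
  have hr_gt : b < r' := lt_of_lt_of_le (by linarith)
    ((le_max_right r (b + 1)).trans (le_max_left _ _))
  have hr_pos : 0 < r' := by linarith
  -- An upper bound for W on the inner region. The distance r₀ makes W z at least 2m₀ and K₀ makes
  -- the cap at least 2m₀, so that optional stopping of (min(W, M) - m₀)/M leaves m₀/M, which is
  -- δK^(-a).
  set m₀ := C * r' ^ a with hm₀
  have hm₀0 : 0 < m₀ := by positivity
  refine ⟨max (2 * m₀ / k) 1 ^ (1 / a), max K₀ (r' * 2 ^ (1 / a)), r' ^ a / 2 ^ a,
    lt_max_of_lt_right (by positivity), by positivity, fun z hz K hK q hq0 hq1 N hfar => ?_⟩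
  rw [max_le_iff] at hK
  have hK0 : 0 < K := lt_of_lt_of_le (by positivity) hK.2
  set M := C * (2 * K) ^ a with hM
  have hM2 : M = C * 2 ^ a * K ^ a := by rw [hM, Real.mul_rpow (by norm_num) hK0.le]; ring
  have hM0 : 0 < M := by positivity
  have hone : (1 : ℝ) ≤ 2 ^ a := Real.one_le_rpow (by norm_num) ha.le
  have hmM : 2 * m₀ ≤ M := by
    have h1 := Real.rpow_le_rpow (by positivity) hK.2 ha.le
    rw [Real.mul_rpow hr_pos.le (by positivity), ← Real.rpow_mul (by norm_num),
      one_div_mul_cancel ha.ne', Real.rpow_one] at h1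
    have h2 : C * K ^ a ≤ C * 2 ^ a * K ^ a := by
      have : C ≤ C * 2 ^ a := le_mul_of_one_le_right hC.le hone
      gcongr
    have h3 := mul_le_mul_of_nonneg_left h1 hC.le
    rw [hM2, hm₀]
    linarith
  have hWz : 2 * m₀ ≤ W z := by
    have h1 := Real.rpow_le_rpow (by positivity) hz ha.le
    rw [← Real.rpow_mul (by positivity), one_div_mul_cancel ha.ne', Real.rpow_one] at h1
    have h2 := (le_max_left _ _).trans h1
    rw [div_le_iff₀ hk] at h2
    linarith [hlow z]
  have key := mul_le_survival (p := transition μ (ζ 0) T) (B := B)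
    (g := fun w => (min (W w) M - m₀) / M)
    (near := {w | size s₁ s₂ w < r'}) (far := {w | K ≤ size s₁ s₂ w}) (C := 1 + m₀ / M) (N := N)
    hq0 hq1 (fun w => by
      have h1 : 0 ≤ min (W w) M := le_min (hW0 w) hM0.le
      have h2 : min (W w) M ≤ M := min_le_right _ _
      rw [abs_div, abs_of_pos hM0, div_le_iff₀ hM0, add_mul, div_mul_cancel₀ _ hM0.ne', one_mul]
      exact abs_le.2 ⟨by linarith, by linarith⟩)
    (fun w => by
      rw [div_le_one hM0]
      linarith [min_le_right (W w) M])
    (fun w hw => by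
      refine div_nonpos_of_nonpos_of_nonneg ?_ hM0.le
      have h1 : W w ≤ m₀ := (hup w).trans (by
        have := hℓ w
        have hw' : size s₁ s₂ w ≤ r' := le_of_lt hw
        rw [hm₀]; gcongr)
      linarith [min_le_left (W w) M])
    (fun w hw => lt_of_le_of_lt (hB w hw) hr_gt) hfar
    (fun w hw hw' => by
      have h1 := hsub K hK.1 w (hr_ge.trans (not_lt.1 hw)) (not_le.1 hw')
      have i1 : Integrable (fun w => min (W w) M) (transition μ (ζ 0) T w) :=
        integrable_of_forall_abs_le (C := M) (fun v => by
          rw [abs_of_nonneg (le_min (hW0 v) hM0.le)]; exact min_le_right _ _) w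
      rw [integral_div, integral_sub i1 (integrable_const _)]
      simp only [integral_const, probReal_univ, smul_eq_mul, one_mul]
      exact div_le_div_of_nonneg_right (by linarith) hM0.le)
    le_rfl z
  refine le_trans (mul_le_mul_of_nonneg_left ?_ hq0) key
  have e1 : r' ^ a / 2 ^ a * K ^ (-a) = m₀ / M := by
    rw [hM2, hm₀, Real.rpow_neg hK0.le]
    field_simp
  rw [e1]
  refine div_le_div_of_nonneg_right ?_ hM0.le
  have := le_min hWz hmM
  linarith

end IsReflectedWalk

/-! ### Diffusive return times and lower bounds on survival -/

lemma sq_max_sub_le (t v : ℝ) : max (t - v) 0 ^ 2 ≤ (max t 0 - v) ^ 2 := by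
  rcases le_total t 0 with h | h
  · rw [max_eq_right h]
    rcases le_total (t - v) 0 with hv | hv
    · rw [max_eq_right hv, zero_pow two_ne_zero]; positivity
    · rw [max_eq_left hv]; nlinarith
  · rw [max_eq_left h]
    rcases le_total (t - v) 0 with hv | hv
    · rw [max_eq_right hv, zero_pow two_ne_zero]; positivity
    · rw [max_eq_left hv]

/-- A chain with a coordinate that dominates a centred walk of unit variance does not come down
from level `K` to level `b` in fewer than about `(K - b)²` steps. -/
lemma one_sub_survival_le_of_coord {Ω : Type*} [MeasurableSpace Ω] {μ : Measure Ω}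
    [IsProbabilityMeasure μ] {ξ : Ω → ℤ × ℤ} (hξ : Measurable ξ)
    {T : ℕ × ℕ → ℤ × ℤ → ℕ × ℕ} {V : Ω → ℝ} (iV : Integrable V μ)
    (iV2 : Integrable (fun ω => V ω ^ 2) μ) (hV : ∫ ω, V ω ∂μ = 0) (hV2 : ∫ ω, V ω ^ 2 ∂μ = 1)
    {x : ℕ × ℕ → ℝ} (hx : ∀ z, 0 ≤ x z) (hstep : ∀ z ω, x z + V ω ≤ x (T z (ξ ω)))
    {B : Set (ℕ × ℕ)} {b K : ℝ} (hB : ∀ z ∈ B, x z ≤ b) (hK : b < K) {z : ℕ × ℕ} (hz : K ≤ x z)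
    (n : ℕ) : 1 - survival (transition μ ξ T) B n z ≤ n / (K - b) ^ 2 := by
  have := isProbabilityMeasure_transition (μ := μ) (T := T) hξ
  have hinteg : ∀ w, Integrable (fun w => max (K - x w) 0 ^ 2) (transition μ ξ T w) := fun w =>
    integrable_of_forall_abs_le (C := |K| ^ 2) (fun v => by
      rw [abs_of_nonneg (by positivity)]
      have : max (K - x v) 0 ≤ |K| := max_le (by linarith [hx v, le_abs_self K]) (abs_nonneg K)
      have h0 : 0 ≤ max (K - x v) 0 := le_max_right _ _
      gcongr) w
  -- Chebyshev-type bound: the squared depth below level K starts at 0, grows on average by at most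
  -- the unit variance per step, and is at least (K - b)² when the coordinate is at most b.
  have key := one_sub_survival_le (p := transition μ ξ T) (B := B)
    (φ := fun w => max (K - x w) 0 ^ 2) (s := 1) (d := (K - b) ^ 2) (near := {w | x w ≤ b})
    (pow_pos (by linarith) 2) zero_le_one (fun w => by positivity) hinteg hB
    (fun w hw => by
      have hw' : x w ≤ b := hw
      have h1 : K - b ≤ max (K - x w) 0 := (by linarith : K - b ≤ K - x w).trans (le_max_left _ _)
      have h2 : 0 ≤ K - b := by linarith
      gcongr)
    (fun w _ => by
      have i1 := (integrable_transition_iff hξ _ w).1 (hinteg w)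
      rw [integral_transition hξ]
      set t := max (K - x w) 0 with ht
      have i2 : Integrable (fun ω => t ^ 2 - 2 * t * V ω + V ω ^ 2) μ := by fun_prop
      have h1 : ∫ ω, max (K - x (T w (ξ ω))) 0 ^ 2 ∂μ ≤
          ∫ ω, (t ^ 2 - 2 * t * V ω + V ω ^ 2) ∂μ := by
        refine integral_mono i1 i2 fun ω => ?_
        have h2 : max (K - x (T w (ξ ω))) 0 ≤ max (K - x w - V ω) 0 :=
          max_le_max_right _ (by linarith [hstep w ω])
        have h3 : 0 ≤ max (K - x (T w (ξ ω))) 0 := le_max_right _ _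
        have h4 := sq_max_sub_le (K - x w) (V ω)
        have h5 : max (K - x (T w (ξ ω))) 0 ^ 2 ≤ max (K - x w - V ω) 0 ^ 2 := by gcongr
        have h6 : (t - V ω) ^ 2 = t ^ 2 - 2 * t * V ω + V ω ^ 2 := by ring
        simp only
        linarith
      rw [integral_add (by fun_prop) iV2, integral_sub (integrable_const _) (by fun_prop),
        integral_const_mul, hV, hV2] at h1
      simpa using h1) n z
  have e1 : max (K - x z) 0 = 0 := max_eq_right (by linarith)
  simpa [e1] using key

namespace IsReflectedWalk

variable {Ω : Type*} [MeasurableSpace Ω] {μ : Measure Ω} [IsProbabilityMeasure μ]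
  {ζ : ℕ → Ω → ℤ × ℤ} {T : ℕ × ℕ → ℤ × ℤ → ℕ × ℕ} {s₁ s₂ θ ρ ν R ξ a : ℝ}

/-- One of the two normalized coordinates is at least K. As pushes are nonnegative, that coordinate
dominates a centred walk, and on B it is at most b. -/
lemma one_sub_survival_le (h : IsReflectedWalk μ ζ T s₁ s₂ θ ρ ν R) {B : Set (ℕ × ℕ)} {b K : ℝ}
    (hB : ∀ z ∈ B, size s₁ s₂ z ≤ b) (hK : b < K) {z : ℕ × ℕ} (hz : 2 * K ≤ size s₁ s₂ z) (n : ℕ) :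
    1 - survival (transition μ (ζ 0) T) B n z ≤ n / (K - b) ^ 2 := by
  have p₁ := h.s₁_pos
  have p₂ := h.s₂_pos
  have hn := h.normalized
  have n1 : ∀ w : ℕ × ℕ, 0 ≤ (w.1 : ℝ) / s₁ := fun w => by positivity
  have n2 : ∀ w : ℕ × ℕ, 0 ≤ (w.2 : ℝ) / s₂ := fun w => by positivity
  rcases le_or_gt K (z.1 / s₁) with h1 | h1
  · refine one_sub_survival_le_of_coord (h.iid.measurable 0) hn.integrable₁ hn.integrable_sq₁
      hn.mean₁ hn.var₁ (x := fun w => (w.1 : ℝ) / s₁) n1 (fun w ω => ?_) (fun w hw => ?_) hK h1 n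
    · rw [h.step_div₁]
      linarith [push_nonneg h.one_le (w.1 / s₁) (((ζ 0 ω).1 : ℝ) / s₁)]
    · have : (w.1 : ℝ) / s₁ + w.2 / s₂ ≤ b := hB w hw
      linarith [n2 w]
  · have h2 : K ≤ z.2 / s₂ := by
      have : 2 * K ≤ (z.1 : ℝ) / s₁ + z.2 / s₂ := hz
      linarith
    refine one_sub_survival_le_of_coord (h.iid.measurable 0) hn.symm.integrable₁
      hn.symm.integrable_sq₁
      hn.mean₂ hn.var₂ (x := fun w => (w.2 : ℝ) / s₂) n2 (fun w ω => ?_) (fun w hw => ?_) hK h2 n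
    · rw [h.step_div₂]
      linarith [push_nonneg h.one_le (w.2 / s₂) (((ζ 0 ω).2 : ℝ) / s₂)]
    · have : (w.1 : ℝ) / s₁ + w.2 / s₂ ≤ b := hB w hw
      linarith [n1 w]

lemma exists_uniform_le_survival (h : IsReflectedWalk μ ζ T s₁ s₂ θ ρ ν R) (h0 : 0 < ξ)
    (hπ : ξ < Real.pi) (hξ : Real.cos ξ = -ρ) (ha : 0 < a) (ha1 : a < 1)
    (haα : 2 - Real.pi / ξ < a) {B : Set (ℕ × ℕ)} {b : ℝ} (hB : ∀ z ∈ B, size s₁ s₂ z ≤ b) :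
    ∃ r₀ c : ℝ, 0 < c ∧ ∃ n₀ : ℕ, ∀ n, n₀ ≤ n → ∀ z, r₀ ≤ size s₁ s₂ z →
      c * (n : ℝ) ^ (-(a / 2)) ≤ survival (transition μ (ζ 0) T) B n z := by
  obtain ⟨r₀, K₀, δ, hK₀, hδ, hmain⟩ := h.exists_mul_le_survival h0 hπ hξ ha ha1 haα hB
  set b' := max b 0 with hb'
  have hb_nonneg : 0 ≤ b' := le_max_right _ _
  -- The level (b' + 2)√n lies at least 2√n above b', so within n steps the return has probability
  -- at most 1/4.
  set A := 2 * (b' + 2) with hA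
  have hA0 : 0 < A := by positivity
  refine ⟨r₀, 1 / 2 * (δ * A ^ (-a)), by positivity, ⌈(K₀ / A) ^ 2⌉₊ + 1, fun n hn z hz => ?_⟩
  have hn1 : (1 : ℝ) ≤ n := by exact_mod_cast (by omega : 1 ≤ n)
  have hn0 : (0 : ℝ) < n := by linarith
  have hsq : √(n : ℝ) ^ 2 = n := Real.sq_sqrt hn0.le
  have hs1 : 1 ≤ √(n : ℝ) := Real.one_le_sqrt.2 hn1
  have hKle : K₀ ≤ A * √n := by
    have h1 : (K₀ / A) ^ 2 ≤ n := (Nat.le_ceil _).trans (by exact_mod_cast (by omega))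
    have h2 : K₀ / A ≤ √n := Real.le_sqrt_of_sq_le h1
    rw [div_le_iff₀ hA0] at h2
    linarith
  have hfar : ∀ w, A * √n ≤ size s₁ s₂ w → ∀ m ≤ n,
      (1 / 2 : ℝ) ≤ survival (transition μ (ζ 0) T) B m w := by
    intro w hw m hm
    have hm' : (m : ℝ) ≤ n := by exact_mod_cast hm
    have hgap : 2 * √n ≤ (b' + 2) * √n - b' := by nlinarith
    have h1 := h.one_sub_survival_le (B := B) (b := b') (K := (b' + 2) * √n)
      (fun v hv => (hB v hv).trans (le_max_left _ _)) (by linarith)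
      (z := w) (by rw [hA] at hw; linarith) m
    have h2 : (m : ℝ) / ((b' + 2) * √n - b') ^ 2 ≤ 1 / 2 := by
      rw [div_le_iff₀ (pow_pos (by linarith) 2)]
      have h3 : (2 * √(n : ℝ)) ^ 2 ≤ ((b' + 2) * √n - b') ^ 2 := by gcongr
      rw [mul_pow, hsq] at h3
      linarith
    linarith
  have := hmain z hz (A * √n) hKle (1 / 2) (by norm_num) (by norm_num) n hfar
  refine le_trans (le_of_eq ?_) this
  rw [Real.mul_rpow hA0.le (Real.sqrt_nonneg _), Real.sqrt_eq_rpow, ← Real.rpow_mul hn0.le,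
    show 1 / 2 * -a = -(a / 2) by ring]
  ring

/-- Polynomial lower bounds on survival, of any order above the critical one, from all points at
a distance that does not depend on the order. -/
lemma exists_le_survival (h : IsReflectedWalk μ ζ T s₁ s₂ θ ρ ν R) (h0 : 0 < ξ)
    (hπ : ξ < Real.pi) (hξ : Real.cos ξ = -ρ) {B : Set (ℕ × ℕ)} {b : ℝ}
    (hB : ∀ z ∈ B, size s₁ s₂ z ≤ b) :
    ∃ r₀ : ℝ, ∀ z, r₀ ≤ size s₁ s₂ z → ∀ a : ℝ, 0 < a → a < 1 → 2 - Real.pi / ξ < a →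
      ∃ c : ℝ, 0 < c ∧ ∃ n₀ : ℕ, ∀ n, n₀ ≤ n →
        c * (n : ℝ) ^ (-(a / 2)) ≤ survival (transition μ (ζ 0) T) B n z := by
  have := h.isProbabilityMeasure
  have hα1 : 2 - Real.pi / ξ < 1 := by
    have : 1 < Real.pi / ξ := by rwa [one_lt_div h0]
    linarith
  -- One auxiliary exponent fixes the distance r₀ once and for all. For another exponent a, the walk
  -- first goes, at a price independent of n, to the distance that a requires.
  obtain ⟨a₀, ha₀, ha₀1⟩ := exists_between (max_lt hα1 zero_lt_one)
  rw [max_lt_iff] at ha₀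
  obtain ⟨r₀, K₀, δ, hK₀, hδ, hmain⟩ := h.exists_mul_le_survival h0 hπ hξ ha₀.2 ha₀1 ha₀.1 hB
  refine ⟨r₀, fun z hz a ha ha1 haα => ?_⟩
  obtain ⟨r₁, c, hc, n₀, hlow⟩ := h.exists_uniform_le_survival h0 hπ hξ ha ha1 haα hB
  have hK : 0 < max K₀ r₁ := lt_max_of_lt_left hK₀
  refine ⟨c * (δ * max K₀ r₁ ^ (-a₀)), by positivity, n₀, fun n hn => ?_⟩
  have hfar : ∀ w, max K₀ r₁ ≤ size s₁ s₂ w → ∀ m ≤ n,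
      c * (n : ℝ) ^ (-(a / 2)) ≤ survival (transition μ (ζ 0) T) B m w := fun w hw m hm =>
    (hlow n hn w ((le_max_right _ _).trans hw)).trans (survival_antitone w hm)
  have hq0 : 0 ≤ c * (n : ℝ) ^ (-(a / 2)) := by positivity
  have hq1 : c * (n : ℝ) ^ (-(a / 2)) ≤ 1 := by
    obtain ⟨w, hw⟩ : ∃ w : ℕ × ℕ, max K₀ r₁ ≤ size s₁ s₂ w := by
      obtain ⟨N, hN⟩ := exists_nat_ge (max K₀ r₁ * s₁)
      refine ⟨(N, 0), ?_⟩
      rw [size]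
      simpa using (le_div_iff₀ h.s₁_pos).2 hN
    exact (hfar w hw 0 (Nat.zero_le n)).trans (survival_le_one _ _)
  have := hmain z hz _ (le_max_left K₀ r₁) _ hq0 hq1 n hfar
  linarith

/-- For an acute wedge there are points from which a given state is avoided with positive
probability. -/
lemma exists_survival_ge_half (h : IsReflectedWalk μ ζ T s₁ s₂ θ ρ ν R) (h0 : 0 < ξ)
    (hπ : ξ < Real.pi / 2) (hξ : Real.cos ξ = -ρ) (z₀ : ℕ × ℕ) :
    ∃ w, ∀ n, (1 / 2 : ℝ) ≤ survival (transition μ (ζ 0) T) {z₀} n w := by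
  have := h.isProbabilityMeasure
  have hα : 2 - Real.pi / ξ < 0 := by
    have : 2 < Real.pi / ξ := by rw [lt_div_iff₀ h0]; linarith
    linarith
  -- A negative exponent above the critical one: the supermartingale decays at infinity.
  obtain ⟨a, ha, ha0⟩ := exists_between (max_lt hα (by norm_num : (-1 : ℝ) < 0))
  rw [max_lt_iff] at ha
  have h1 : 2 * ξ - Real.pi < a * ξ := by
    have : 2 - a < Real.pi / ξ := by linarith
    rw [lt_div_iff₀ h0] at this
    linarith
  have hcos : 0 < -1 * a * Real.cos (ξ - a * ξ / 2) := by
    have := Real.cos_pos_of_mem_Ioo (x := ξ - a * ξ / 2)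
      ⟨by nlinarith [Real.pi_pos], by linarith⟩
    have : 0 < -1 * a := by linarith
    positivity
  obtain ⟨W, k, C, r, κ, hk, hC, hr, hκ, hlow, hup, hd⟩ := h.exists_lyapunov h0 (by linarith) hξ
    (abs_lt.2 ⟨ha.2, by linarith⟩) (Or.inr rfl) hcos
  have hℓ := size_nonneg h.s₁_pos h.s₂_pos
  have p₁ := h.s₁_pos
  have p₂ := h.s₂_pos
  have hR := h.normalized.R_nonneg
  -- Beyond 2R + 1 a single step almost surely cannot reach the origin, so the value of the function
  -- there does not affect the drift.
  set r' := max (max r (2 * R + 1)) (size s₁ s₂ z₀ + 1) with hr'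
  have hr_ge : r ≤ r' := (le_max_left _ _).trans (le_max_left _ _)
  have hr_R : 2 * R + 1 ≤ r' := (le_max_right _ _).trans (le_max_left _ _)
  have hr_z : size s₁ s₂ z₀ < r' := lt_of_lt_of_le (by linarith) (le_max_right _ _)
  have hr_pos : 0 < r' := by linarith
  -- The bounds force W to vanish at the origin, as 0^a = 0 by convention, whereas a function large
  -- near the origin is needed.
  set F : ℕ × ℕ → ℝ := fun z => if z = 0 then 1 else W z with hF
  have hW0 : ∀ z, 0 ≤ W z := fun z => le_trans (by have := hℓ z; positivity) (hlow z)
  have hF0 : ∀ z, 0 ≤ F z := fun z => by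
    simp only [hF]; split_ifs
    · exact zero_le_one
    · exact hW0 z
  set u := min (1 / s₁) (1 / s₂) with hu
  have hu0 : 0 < u := by positivity
  have hFb : ∀ z, |F z| ≤ 1 + C * u ^ a := fun z => by
    rw [abs_of_nonneg (hF0 z)]
    simp only [hF]; split_ifs with hz
    · have : 0 ≤ C * u ^ a := by positivity
      linarith
    · have h2 := Real.rpow_le_rpow_of_nonpos hu0 (le_size_of_ne_zero p₁ p₂ hz) ha0.le
      have h3 := mul_le_mul_of_nonneg_left h2 hC.le
      linarith [hup z]
  set m := min 1 (k * r' ^ a) with hm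
  have hm0 : 0 < m := by positivity
  have hsurv : ∀ n z, 1 - survival (transition μ (ζ 0) T) {z₀} n z ≤ F z / m := by
    intro n z
    have key := ReflectedWalk.one_sub_survival_le (p := transition μ (ζ 0) T) (B := {z₀}) (φ := F)
      (s := 0) (d := m) (near := {w | size s₁ s₂ w < r'}) hm0 le_rfl hF0
      (integrable_of_forall_abs_le hFb) (by simpa using hr_z)
      (fun w hw => by
        simp only [hF]; split_ifs with hw0
        · exact min_le_left _ _
        · have h2 := Real.rpow_le_rpow_of_nonpos (size_pos p₁ p₂ hw0) (le_of_lt hw) ha0.le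
          have h3 := mul_le_mul_of_nonneg_left h2 hk.le
          exact (min_le_right _ _).trans (h3.trans (hlow w)))
      (fun w hw => by
        have hw' : r' ≤ size s₁ s₂ w := not_lt.1 hw
        obtain ⟨iW, hdw⟩ := hd w (hr_ge.trans hw')
        have hw0 : w ≠ 0 := by
          rintro rfl
          have : size s₁ s₂ 0 = 0 := by simp [size]
          linarith
        have e1 : ∫ v, F v ∂transition μ (ζ 0) T w = ∫ v, W v ∂transition μ (ζ 0) T w := by
          rw [integral_transition (h.iid.measurable 0), integral_transition (h.iid.measurable 0)]
          refine integral_congr_ae ?_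
          filter_upwards [h.size_step_mem w] with ω hω
          have : T w (ζ 0 ω) ≠ 0 := by
            intro h2
            have h3 : size s₁ s₂ 0 = 0 := by simp [size]
            have h4 := hω.1
            rw [h2, h3] at h4
            linarith
          simp [hF, this]
        have e2 : F w = W w := by simp [hF, hw0]
        rw [e1, e2]
        have : 0 ≤ κ * size s₁ s₂ w ^ (a - 2) := by have := hℓ w; positivity
        linarith) n z
    simpa using key
  have htend : Filter.Tendsto (fun x : ℝ => C * x ^ a) Filter.atTop (nhds (C * 0)) :=
    (by simpa using tendsto_rpow_neg_atTop (y := -a) (by linarith) :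
      Filter.Tendsto (fun x : ℝ => x ^ a) Filter.atTop (nhds 0)).const_mul C
  rw [mul_zero] at htend
  obtain ⟨x, hx1, hx2⟩ := ((htend.eventually_lt_const (half_pos hm0)).and
    (Filter.eventually_gt_atTop 0)).exists
  obtain ⟨N, hN⟩ := exists_nat_ge (x * s₁)
  have hsz : x ≤ size s₁ s₂ (N, 0) := by
    rw [size]
    simpa using (le_div_iff₀ h.s₁_pos).2 hN
  refine ⟨(N, 0), fun n => ?_⟩
  have h2 := hsurv n (N, 0)
  have h3 : F (N, 0) ≤ m / 2 := by
    have hne : ((N, 0) : ℕ × ℕ) ≠ 0 := by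
      intro h4
      rw [h4] at hsz
      have : size s₁ s₂ 0 = 0 := by simp [size]
      linarith
    simp only [hF, hne, if_false]
    have h4 := Real.rpow_le_rpow_of_nonpos hx2 hsz ha0.le
    have h5 := mul_le_mul_of_nonneg_left h4 hC.le
    linarith [hup (N, 0)]
  have h4 : F (N, 0) / m ≤ 1 / 2 := by
    rw [div_le_iff₀ hm0]; linarith
  linarith

end IsReflectedWalk

/-! ### The two reflections and the normalization of the increments -/

lemma lindley_eq_traj {Ω : Type*} (ζ : ℕ → Ω → ℤ × ℤ) (z : ℕ × ℕ) (n : ℕ) (ω : Ω) :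
    lindley ζ z n ω = traj (fun z v => clipPart (addStep z v)) z (fun i => ζ i ω) n := by
  induction n with
  | zero => rfl
  | succ n ih => rw [lindley, traj, ih]

lemma mirror_eq_traj {Ω : Type*} (ζ : ℕ → Ω → ℤ × ℤ) (z : ℕ × ℕ) (n : ℕ) (ω : Ω) :
    mirror ζ z n ω = traj (fun z v => absPart (addStep z v)) z (fun i => ζ i ω) n := by
  induction n with
  | zero => rfl
  | succ n ih => rw [mirror, traj, ih]

lemma toNat_eq_add_push (m : ℕ) (v : ℤ) :
    ((((m : ℤ) + v).toNat : ℕ) : ℝ) = m + (v + push 1 m v) := by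
  have h1 : ((((m : ℤ) + v).toNat : ℕ) : ℝ) = max ((m : ℝ) + v) 0 := by
    have := Int.toNat_eq_max ((m : ℤ) + v)
    exact_mod_cast this
  rw [h1, push, one_mul]
  rcases le_total 0 ((m : ℝ) + v) with h | h
  · rw [max_eq_left h, max_eq_right (by linarith)]; ring
  · rw [max_eq_right h, max_eq_left (by linarith)]; ring

lemma natAbs_eq_add_push (m : ℕ) (v : ℤ) :
    ((((m : ℤ) + v).natAbs : ℕ) : ℝ) = m + (v + push 2 m v) := by
  have h1 : ((((m : ℤ) + v).natAbs : ℕ) : ℝ) = |(m : ℝ) + v| := by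
    rw [Nat.cast_natAbs]; push_cast; rfl
  rw [h1, push]
  rcases le_total 0 ((m : ℝ) + v) with h | h
  · rw [abs_of_nonneg h, max_eq_right (by linarith)]; ring
  · rw [abs_of_nonpos h, max_eq_left (by linarith)]; ring

lemma toPlane_zero (z : ℤ × ℤ) : toPlane z 0 = z.1 := by simp [toPlane]

lemma toPlane_one (z : ℤ × ℤ) : toPlane z 1 = z.2 := by simp [toPlane]

lemma norm_toPlane (z : ℤ × ℤ) : ‖toPlane z‖ = √((z.1 : ℝ) ^ 2 + (z.2 : ℝ) ^ 2) := by
  rw [EuclideanSpace.norm_eq]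
  simp [toPlane]

lemma stateNorm_eq (z : ℕ × ℕ) : stateNorm z = √((z.1 : ℝ) ^ 2 + (z.2 : ℝ) ^ 2) := by
  rw [stateNorm, norm_toPlane]; simp

section Increment

variable {Ω : Type*} [MeasurableSpace Ω] {μ : Measure Ω} {ξ : Ω → ℤ × ℤ}

lemma secondMoment_zero_zero (μ : Measure Ω) (ξ : Ω → ℤ × ℤ) :
    secondMoment μ ξ 0 0 = ∫ ω, ((ξ ω).1 : ℝ) ^ 2 ∂μ := by
  simp [secondMoment, toPlane_zero, pow_two]

lemma secondMoment_one_one (μ : Measure Ω) (ξ : Ω → ℤ × ℤ) :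
    secondMoment μ ξ 1 1 = ∫ ω, ((ξ ω).2 : ℝ) ^ 2 ∂μ := by
  simp [secondMoment, toPlane_one, pow_two]

lemma secondMoment_zero_one (μ : Measure Ω) (ξ : Ω → ℤ × ℤ) :
    secondMoment μ ξ 0 1 = ∫ ω, ((ξ ω).1 : ℝ) * (ξ ω).2 ∂μ := by
  simp [secondMoment, toPlane_zero, toPlane_one]

lemma secondMoment_det_pos (h : (secondMoment μ ξ).PosDef) :
    secondMoment μ ξ 0 1 ^ 2 < secondMoment μ ξ 0 0 * secondMoment μ ξ 1 1 := by
  have hdet := h.det_pos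
  rw [Matrix.det_fin_two] at hdet
  have hsymm : secondMoment μ ξ 1 0 = secondMoment μ ξ 0 1 := by
    simp [secondMoment, mul_comm]
  rw [hsymm] at hdet
  nlinarith

lemma abs_correlation_lt_one (h : (secondMoment μ ξ).PosDef) : |correlation μ ξ| < 1 := by
  have hd := secondMoment_det_pos h
  have hpos : 0 < secondMoment μ ξ 0 0 * secondMoment μ ξ 1 1 := lt_of_le_of_lt (sq_nonneg _) hd
  rw [correlation, abs_div, abs_of_pos (Real.sqrt_pos.2 hpos), div_lt_one (Real.sqrt_pos.2 hpos)]
  exact Real.lt_sqrt_of_sq_lt (by rwa [sq_abs])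

lemma measurable_toPlane (hξ : Measurable ξ) : Measurable fun ω => toPlane (ξ ω) :=
  (Measurable.of_discrete (f := toPlane)).comp hξ

variable [IsProbabilityMeasure μ]

/-- The increments are normalized after division by the standard deviations. -/
lemma IncrementHypothesis.exists_normalized (hξ : Measurable ξ) (h : IncrementHypothesis μ ξ) :
    ∃ s₁ s₂ ν R : ℝ, 0 < s₁ ∧ 0 < s₂ ∧ NormalizedIncrement μ (fun ω => ((ξ ω).1 : ℝ) / s₁)
      (fun ω => ((ξ ω).2 : ℝ) / s₂) (correlation μ ξ) ν R := by
  obtain ⟨ν, hν, hm⟩ := h.moment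
  obtain ⟨R, hR⟩ := h.bounded_below
  have h00 : 0 < secondMoment μ ξ 0 0 := h.posDef.diag_pos
  have h11 : 0 < secondMoment μ ξ 1 1 := h.posDef.diag_pos
  have m₁ : Measurable fun ω => ((ξ ω).1 : ℝ) :=
    (Measurable.of_discrete (f := fun v : ℤ × ℤ => (v.1 : ℝ))).comp hξ
  have m₂ : Measurable fun ω => ((ξ ω).2 : ℝ) :=
    (Measurable.of_discrete (f := fun v : ℤ × ℤ => (v.2 : ℝ))).comp hξ
  have mP := measurable_toPlane hξ
  set s₁ := √(secondMoment μ ξ 0 0) with hs₁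
  set s₂ := √(secondMoment μ ξ 1 1) with hs₂
  have p₁ : 0 < s₁ := Real.sqrt_pos.2 h00
  have p₂ : 0 < s₂ := Real.sqrt_pos.2 h11
  have q₁ : s₁ ^ 2 = secondMoment μ ξ 0 0 := Real.sq_sqrt h00.le
  have q₂ : s₂ ^ 2 = secondMoment μ ξ 1 1 := Real.sq_sqrt h11.le
  have iP : Integrable (fun ω => toPlane (ξ ω)) μ := by
    refine ((integrable_const (1 : ℝ)).add hm).mono' mP.aestronglyMeasurable
      (Eventually.of_forall fun ω => ?_)
    simp only [Pi.add_apply]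
    rcases le_total ‖toPlane (ξ ω)‖ 1 with h1 | h1
    · have : 0 ≤ ‖toPlane (ξ ω)‖ ^ ν := by positivity
      linarith
    · have := Real.rpow_le_rpow_of_exponent_le h1 (show (1 : ℝ) ≤ ν by linarith)
      rw [Real.rpow_one] at this
      linarith
  have hmean : ∀ k : Fin 2, ∫ ω, toPlane (ξ ω) k ∂μ = 0 := by
    intro k
    have := (EuclideanSpace.proj (𝕜 := ℝ) k).integral_comp_comm iP
    rw [h.mean_zero] at this
    simpa using this
  have hmean₁ : ∫ ω, ((ξ ω).1 : ℝ) ∂μ = 0 := by simpa [toPlane_zero] using hmean 0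
  have hmean₂ : ∫ ω, ((ξ ω).2 : ℝ) ∂μ = 0 := by simpa [toPlane_one] using hmean 1
  have c₁ : ∀ ω, |((ξ ω).1 : ℝ)| ≤ ‖toPlane (ξ ω)‖ := fun ω => by
    rw [norm_toPlane]; exact Real.abs_le_sqrt (by nlinarith [sq_nonneg ((ξ ω).2 : ℝ)])
  have c₂ : ∀ ω, |((ξ ω).2 : ℝ)| ≤ ‖toPlane (ξ ω)‖ := fun ω => by
    rw [norm_toPlane]; exact Real.abs_le_sqrt (by nlinarith [sq_nonneg ((ξ ω).1 : ℝ)])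
  -- The moment order is capped at 3, the order of the Taylor remainder; the sum is a lower bound
  -- common to both coordinates.
  refine ⟨s₁, s₂, min ν 3, R / s₁ + R / s₂, p₁, p₂, ?_⟩
  refine ⟨m₁.div_const _, m₂.div_const _, lt_min hν (by norm_num), min_le_right _ _, by positivity,
    ?_, ?_, ?_, ?_, ?_, ?_, ?_, ?_⟩
  · filter_upwards [hR 0] with ω hω
    rw [toPlane_zero] at hω
    have : -(R / s₁) ≤ ((ξ ω).1 : ℝ) / s₁ := by rw [← neg_div]; gcongr
    have : 0 ≤ R / s₂ := by positivity
    linarith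
  · filter_upwards [hR 1] with ω hω
    rw [toPlane_one] at hω
    have : -(R / s₂) ≤ ((ξ ω).2 : ℝ) / s₂ := by rw [← neg_div]; gcongr
    have : 0 ≤ R / s₁ := by positivity
    linarith
  · set A := 1 / s₁ + 1 / s₂ with hA
    have hA0 : 0 < A := by positivity
    refine (((integrable_const (1 : ℝ)).add hm).const_mul (A ^ min ν 3)).mono'
      (Measurable.aestronglyMeasurable (by fun_prop))
      (Eventually.of_forall fun ω => ?_)
    have h3 : 0 ≤ min ν 3 := le_min (by linarith) (by norm_num)
    rw [Real.norm_of_nonneg (by positivity)]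
    have h4 : |((ξ ω).1 : ℝ) / s₁| + |((ξ ω).2 : ℝ) / s₂| ≤ A * ‖toPlane (ξ ω)‖ := by
      rw [abs_div, abs_div, abs_of_pos p₁, abs_of_pos p₂, hA, add_mul, one_div_mul_eq_div,
        one_div_mul_eq_div]
      gcongr
      · exact c₁ ω
      · exact c₂ ω
    refine (Real.rpow_le_rpow (by positivity) h4 h3).trans ?_
    rw [Real.mul_rpow hA0.le (norm_nonneg _)]
    gcongr
    simp only [Pi.add_apply]
    rcases le_total ‖toPlane (ξ ω)‖ 1 with h1 | h1
    · have := Real.rpow_le_one (norm_nonneg _) h1 h3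
      have : 0 ≤ ‖toPlane (ξ ω)‖ ^ ν := by positivity
      linarith
    · have := Real.rpow_le_rpow_of_exponent_le h1 (min_le_left ν 3)
      linarith
  · rw [integral_div, hmean₁, zero_div]
  · rw [integral_div, hmean₂, zero_div]
  · simp only [div_pow]
    rw [integral_div, ← secondMoment_zero_zero, q₁, div_self h00.ne']
  · simp only [div_pow]
    rw [integral_div, ← secondMoment_one_one, q₂, div_self h11.ne']
  · simp only [div_mul_div_comm]
    rw [integral_div, ← secondMoment_zero_one, correlation, Real.sqrt_mul h00.le]

end Increment

/-- Both kinds of reflection give a reflected walk in the sense of `IsReflectedWalk`. -/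
lemma exists_isReflectedWalk {Ω : Type*} [MeasurableSpace Ω] {μ : Measure Ω}
    [IsProbabilityMeasure μ] {ζ : ℕ → Ω → ℤ × ℤ} (hiid : IsIID μ ζ)
    (hζ : IncrementHypothesis μ (ζ 0)) {Z : ℕ × ℕ → ℕ → Ω → ℕ × ℕ}
    (hZ : Z = lindley ζ ∨ Z = mirror ζ) :
    ∃ (T : ℕ × ℕ → ℤ × ℤ → ℕ × ℕ) (s₁ s₂ θ ν R : ℝ),
      IsReflectedWalk μ ζ T s₁ s₂ θ (correlation μ (ζ 0)) ν R ∧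
      Z = fun z n ω => traj T z (fun i => ζ i ω) n := by
  obtain ⟨s₁, s₂, ν, R, p₁, p₂, hn⟩ := hζ.exists_normalized (hiid.measurable 0)
  rcases hZ with rfl | rfl
  · exact ⟨fun z v => clipPart (addStep z v), s₁, s₂, 1, ν, R,
      ⟨hiid, p₁, p₂, le_rfl, by norm_num, fun z v => toNat_eq_add_push _ _,
        fun z v => toNat_eq_add_push _ _, hn⟩,
      by funext z n ω; exact lindley_eq_traj ζ z n ω⟩
  · exact ⟨fun z v => absPart (addStep z v), s₁, s₂, 2, ν, R,
      ⟨hiid, p₁, p₂, by norm_num, le_rfl, fun z v => natAbs_eq_add_push _ _,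
        fun z v => natAbs_eq_add_push _ _, hn⟩,
      by funext z n ω; exact mirror_eq_traj ζ z n ω⟩

/-! ### Recurrence, transience and the tail exponent -/

lemma lt_passageTime_iff (path : ℕ → ℕ × ℕ) (r : ℝ) (n : ℕ) :
    (n : ℕ∞) < passageTime path r ↔ ∀ m ≤ n, path m ∉ {z | stateNorm z ≤ r} := by
  rw [← not_le, passageTime]
  constructor
  · intro h m hm hmem
    exact h ((iInf₂_le m hmem).trans (by exact_mod_cast hm))
  · intro h hle
    have h1 : ((n + 1 : ℕ) : ℕ∞) ≤ ⨅ (m : ℕ) (_ : stateNorm (path m) ≤ r), (m : ℕ∞) := by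
      refine le_iInf₂ fun m hm => ?_
      by_contra! hlt
      have : m < n + 1 := by exact_mod_cast hlt
      exact h m (by omega) hm
    have h2 : ((n + 1 : ℕ) : ℕ∞) ≤ n := h1.trans hle
    have : n + 1 ≤ n := by exact_mod_cast h2
    omega

/-- Constants disappear after division by log n. Exponents in a window around α suffice, which
matters because the bounds on survival hold only in such a window. -/
lemma tendsto_log_div_log {u : ℕ → ℝ} {α A₁ A₂ : ℝ} (h₁ : A₁ < α) (h₂ : α < A₂)
    (hup : ∀ a, A₁ < a → a < α → ∃ C : ℝ, 0 < C ∧ ∀ᶠ n : ℕ in atTop, u n ≤ C * (n : ℝ) ^ (-a))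
    (hlow : ∀ a, α < a → a < A₂ → ∃ c : ℝ, 0 < c ∧ ∀ᶠ n : ℕ in atTop, c * (n : ℝ) ^ (-a) ≤ u n) :
    Tendsto (fun n : ℕ => Real.log (u n) / Real.log n) atTop (nhds (-α)) := by
  have hlog : Tendsto (fun n : ℕ => Real.log n) atTop atTop :=
    Real.tendsto_log_atTop.comp tendsto_natCast_atTop_atTop
  have hconst : ∀ C a : ℝ, Tendsto (fun n : ℕ => Real.log C / Real.log n + -a) atTop
      (nhds (-a)) := fun C a => by
    simpa using (hlog.const_div_atTop (Real.log C)).add_const (-a)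
  have hval : ∀ {C a : ℝ}, 0 < C → ∀ n : ℕ, 1 < n →
      Real.log (C * (n : ℝ) ^ (-a)) / Real.log n = Real.log C / Real.log n + -a := by
    intro C a hC n hn
    have hn1 : (1 : ℝ) < n := by exact_mod_cast hn
    have hn0 : (0 : ℝ) < n := by linarith
    have hl : 0 < Real.log n := Real.log_pos hn1
    rw [Real.log_mul hC.ne' (by positivity), Real.log_rpow hn0, add_div, mul_div_assoc,
      div_self hl.ne', mul_one]
  obtain ⟨a₁, ha₁, ha₁'⟩ := exists_between h₂
  obtain ⟨c₁, hc₁, hpos⟩ := hlow a₁ ha₁ ha₁'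
  have hupos : ∀ᶠ n : ℕ in atTop, 0 < u n := by
    filter_upwards [hpos, eventually_gt_atTop 1] with n hn h1
    have : (0 : ℝ) < n := by exact_mod_cast (by omega : 0 < n)
    exact lt_of_lt_of_le (by positivity) hn
  rw [tendsto_order]
  constructor
  · intro x hx
    obtain ⟨a, ha, ha'⟩ := exists_between (lt_min h₂ (show α < -x by linarith))
    rw [lt_min_iff] at ha'
    obtain ⟨c, hc, hcn⟩ := hlow a ha ha'.1
    filter_upwards [hcn, (hconst c a).eventually_const_lt (show x < -a by linarith),
      eventually_gt_atTop 1] with n hn hx' h1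
    have hn1 : (1 : ℝ) < n := by exact_mod_cast h1
    have hl : 0 < Real.log n := Real.log_pos hn1
    have h0 : 0 < c * (n : ℝ) ^ (-a) := by positivity
    refine hx'.trans_le ?_
    rw [← hval hc n h1]
    exact div_le_div_of_nonneg_right (Real.log_le_log h0 hn) hl.le
  · intro x hx
    obtain ⟨a, ha, ha'⟩ := exists_between (max_lt h₁ (show -x < α by linarith))
    rw [max_lt_iff] at ha
    obtain ⟨C, hC, hCn⟩ := hup a ha.1 ha'
    filter_upwards [hCn, (hconst C a).eventually_lt_const (show -a < x by linarith),
      eventually_gt_atTop 1, hupos] with n hn hx' h1 h0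
    have hn1 : (1 : ℝ) < n := by exact_mod_cast h1
    have hl : 0 < Real.log n := Real.log_pos hn1
    refine lt_of_le_of_lt ?_ hx'
    rw [← hval hC n h1]
    exact div_le_div_of_nonneg_right (Real.log_le_log h0 hn) hl.le

lemma return_compl {Ω : Type*} (ζ : ℕ → Ω → ℤ × ℤ) (T : ℕ × ℕ → ℤ × ℤ → ℕ × ℕ) (z : ℕ × ℕ) :
    {ω | ∃ n : ℕ, 1 ≤ n ∧ traj T z (fun i => ζ i ω) n = z}ᶜ =
      ⋂ n, {ω | ∀ m, 1 ≤ m → m ≤ n → traj T z (fun i => ζ i ω) m ∉ ({z} : Set (ℕ × ℕ))} := by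
  ext ω
  simp only [mem_compl_iff, mem_ofPred_eq, not_exists, not_and, mem_iInter, mem_singleton_iff]
  exact ⟨fun h n m hm _ => h m hm, fun h n hn => h n n hn le_rfl⟩

lemma measurableSet_return {Ω : Type*} [MeasurableSpace Ω] {μ : Measure Ω}
    {ζ : ℕ → Ω → ℤ × ℤ} {T : ℕ × ℕ → ℤ × ℤ → ℕ × ℕ} (hiid : IsIID μ ζ) (z : ℕ × ℕ) :
    MeasurableSet {ω | ∃ n : ℕ, 1 ≤ n ∧ traj T z (fun i => ζ i ω) n = z} := by
  rw [← MeasurableSet.compl_iff, return_compl]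
  exact MeasurableSet.iInter fun n => measurableSet_avoid hiid.measurable _ z n

section Main

variable {Ω : Type*} [MeasurableSpace Ω] {μ : Measure Ω} [IsProbabilityMeasure μ]
  {ζ : ℕ → Ω → ℤ × ℤ} {T : ℕ × ℕ → ℤ × ℤ → ℕ × ℕ} {s₁ s₂ θ ρ ν R ξ : ℝ}

lemma exists_survival_lt_one (hiid : IsIID μ ζ)
    (hirr : IsIrreducible μ fun z n ω => traj T z (fun i => ζ i ω) n) {B : Set (ℕ × ℕ)}
    (hB : B.Nonempty) (z : ℕ × ℕ) : ∃ N, survival (transition μ (ζ 0) T) B N z < 1 := by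
  obtain ⟨w, hw⟩ := hB
  by_cases hz : z ∈ B
  · exact ⟨0, by rw [survival_of_mem hz]; exact zero_lt_one⟩
  obtain ⟨N, hN⟩ := hirr z w
  refine ⟨N, ?_⟩
  rw [← measureReal_avoid hiid hz]
  have hm : MeasurableSet {ω | traj T z (fun i => ζ i ω) N = w} :=
    measurable_traj hiid.measurable z N (MeasurableSet.of_discrete (s := {w}))
  have h1 : {ω | ∀ m ≤ N, traj T z (fun i => ζ i ω) m ∉ B} ⊆
      {ω | traj T z (fun i => ζ i ω) N = w}ᶜ := fun ω hω heq =>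
    hω N le_rfl (by rw [show traj T z (fun i => ζ i ω) N = w from heq]; exact hw)
  have h2 := measureReal_mono h1 (μ := μ)
  rw [probReal_compl_eq_one_sub hm] at h2
  have h3 : 0 < μ.real {ω | traj T z (fun i => ζ i ω) N = w} :=
    ENNReal.toReal_pos hN.ne' (measure_ne_top _ _)
  linarith

lemma tendsto_integral_survival (hiid : IsIID μ ζ) (z : ℕ × ℕ) :
    Tendsto (fun n => ∫ w, survival (transition μ (ζ 0) T) {z} n w ∂transition μ (ζ 0) T z) atTop
      (nhds (μ.real {ω | ∃ n : ℕ, 1 ≤ n ∧ traj T z (fun i => ζ i ω) n = z}ᶜ)) := by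
  rw [return_compl]
  have h1 := tendsto_measure_iInter_atTop (μ := μ)
    (s := fun n => {ω | ∀ m, 1 ≤ m → m ≤ n → traj T z (fun i => ζ i ω) m ∉ ({z} : Set (ℕ × ℕ))})
    (fun n => (measurableSet_avoid hiid.measurable _ z n).nullMeasurableSet)
    (fun n n' hn ω hω m h1 h2 => hω m h1 (h2.trans hn)) ⟨0, measure_ne_top _ _⟩
  have h2 := (ENNReal.tendsto_toReal (measure_ne_top _ _)).comp h1
  have h3 := h2.comp (tendsto_add_atTop_nat 1)
  refine h3.congr fun n => ?_
  exact measureReal_avoid_succ hiid {z} z n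

/-- The polynomial bound on avoiding z, integrated over the first step, tends to zero because its
prefactor is integrable. -/
lemma IsReflectedWalk.recurrent (h : IsReflectedWalk μ ζ T s₁ s₂ θ ρ ν R) (h0 : 0 < ξ)
    (hπ : ξ < Real.pi) (hξ2 : Real.pi / 2 < ξ) (hξ : Real.cos ξ = -ρ)
    (hirr : IsIrreducible μ fun z n ω => traj T z (fun i => ζ i ω) n) :
    IsRecurrent μ fun z n ω => traj T z (fun i => ζ i ω) n := by
  have := h.isProbabilityMeasure
  intro z
  have hα : 0 < 2 - Real.pi / ξ := by
    have : Real.pi / ξ < 2 := by rw [div_lt_iff₀ h0]; linarith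
    linarith
  obtain ⟨a, ha, haα⟩ := exists_between hα
  obtain ⟨F, hF0, iF, hF⟩ := h.exists_survival_le h0 hπ hξ ha haα (B := {z})
    (exists_survival_lt_one h.iid hirr (singleton_nonempty z))
  have hlim := tendsto_integral_survival (T := T) h.iid z
  have hzero : Tendsto
      (fun n => ∫ w, survival (transition μ (ζ 0) T) {z} n w ∂transition μ (ζ 0) T z) atTop
      (nhds 0) := by
    have hb : Tendsto (fun n : ℕ => (∫ w, F w ∂transition μ (ζ 0) T z) * (n : ℝ) ^ (-(a / 2)))
        atTop (nhds 0) := by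
      simpa using ((tendsto_rpow_neg_atTop (half_pos ha)).comp
        tendsto_natCast_atTop_atTop).const_mul (∫ w, F w ∂transition μ (ζ 0) T z)
    refine tendsto_of_tendsto_of_tendsto_of_le_of_le' tendsto_const_nhds hb
      (Eventually.of_forall fun n => integral_nonneg fun w => survival_nonneg n w) ?_
    filter_upwards [eventually_gt_atTop 0] with n hn
    rw [← integral_mul_const]
    exact integral_mono (integrable_survival n z) ((iF z).mul_const _) (hF n hn)
  have h1 := tendsto_nhds_unique hlim hzero
  rw [probReal_compl_eq_one_sub (measurableSet_return h.iid z)] at h1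
  have h2 : μ.real {ω | ∃ n : ℕ, 1 ≤ n ∧ traj T z (fun i => ζ i ω) n = z} = 1 := by linarith
  rwa [measureReal_def, ENNReal.toReal_eq_one_iff] at h2

/-- If z were recurrent, then from the position at any fixed time k the walk would again hit z
almost surely. By irreducibility that position is, with positive probability, a state from which z
is avoided with probability at least 1/2. -/
lemma IsReflectedWalk.transient (h : IsReflectedWalk μ ζ T s₁ s₂ θ ρ ν R) (h0 : 0 < ξ)
    (hξ2 : ξ < Real.pi / 2) (hξ : Real.cos ξ = -ρ)
    (hirr : IsIrreducible μ fun z n ω => traj T z (fun i => ζ i ω) n) :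
    IsTransient μ fun z n ω => traj T z (fun i => ζ i ω) n := by
  have := h.isProbabilityMeasure
  intro z
  by_contra hge
  have hone : μ {ω | ∃ n : ℕ, 1 ≤ n ∧ traj T z (fun i => ζ i ω) n = z} = 1 :=
    le_antisymm prob_le_one (not_lt.1 hge)
  have hlim := tendsto_integral_survival (T := T) h.iid z
  rw [probReal_compl_eq_one_sub (measurableSet_return h.iid z), measureReal_def, hone,
    ENNReal.toReal_one, sub_self] at hlim
  set p := transition μ (ζ 0) T with hp
  have hbound : ∀ n w, |survival p {z} n w| ≤ 1 := fun n w => by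
    rw [abs_of_nonneg (survival_nonneg n w)]; exact survival_le_one n w
  have iS : ∀ n k, Integrable (fun ω => survival p {z} n (traj T z (fun i => ζ i ω) k)) μ :=
    fun n k => (integrable_const (1 : ℝ)).mono'
      ((Measurable.of_discrete (f := survival p {z} n)).comp
        (measurable_traj h.iid.measurable z k)).aestronglyMeasurable
      (Eventually.of_forall fun ω => hbound n _)
  -- Equality up to the last term holds for v ≠ z; at v = z the survival function vanishes and the
  -- last term, the probability of no return, takes over.
  have hstep : ∀ n v, ∫ w, survival p {z} n w ∂p v ≤
      survival p {z} (n + 1) v + ∫ w, survival p {z} n w ∂p z := by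
    intro n v
    by_cases hv : v = z
    · rw [hv]; linarith [survival_nonneg (p := p) (B := {z}) (n + 1) z]
    · rw [survival_succ (by simpa using hv)]
      have : 0 ≤ ∫ w, survival p {z} n w ∂p z := integral_nonneg fun w => survival_nonneg n w
      linarith
  have hall : ∀ k, Tendsto (fun n => ∫ ω, survival p {z} n (traj T z (fun i => ζ i ω) k) ∂μ) atTop
      (nhds 0) := by
    intro k
    induction k with
    | zero =>
      have : ∀ n, survival p {z} n z = 0 := fun n => survival_of_mem (mem_singleton z) n
      simp [traj, this]
    | succ k ih =>
      have hb : Tendsto (fun n => ∫ ω, survival p {z} (n + 1) (traj T z (fun i => ζ i ω) k) ∂μ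
          + ∫ w, survival p {z} n w ∂p z) atTop (nhds 0) := by
        simpa using (ih.comp (tendsto_add_atTop_nat 1)).add hlim
      refine tendsto_of_tendsto_of_tendsto_of_le_of_le tendsto_const_nhds hb
        (fun n => integral_nonneg fun ω => survival_nonneg n _) (fun n => ?_)
      simp only
      rw [integral_traj_succ h.iid z k (hbound n)]
      have i1 : Integrable (fun ω => ∫ w, survival p {z} n w ∂p (traj T z (fun i => ζ i ω) k)) μ :=
        (integrable_const (1 : ℝ)).mono'
          ((Measurable.of_discrete (f := fun v => ∫ w, survival p {z} n w ∂p v)).comp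
            (measurable_traj h.iid.measurable z k)).aestronglyMeasurable
          (Eventually.of_forall fun ω => by
            have := norm_integral_le_of_norm_le_const (μ := p (traj T z (fun i => ζ i ω) k))
              (f := survival p {z} n) (C := 1) (Eventually.of_forall (hbound n))
            simpa using this)
      have := integral_mono i1 ((iS (n + 1) k).add (integrable_const _)) (fun ω => hstep n _)
      simp only [Pi.add_apply] at this
      rw [integral_add (iS (n + 1) k) (integrable_const _)] at this
      simpa using this
  obtain ⟨w, hw⟩ := h.exists_survival_ge_half h0 hξ2 hξ z
  obtain ⟨k, hk⟩ := hirr z w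
  have hm : MeasurableSet {ω | traj T z (fun i => ζ i ω) k = w} :=
    measurable_traj h.iid.measurable z k (MeasurableSet.of_discrete (s := {w}))
  have hpos : 0 < μ.real {ω | traj T z (fun i => ζ i ω) k = w} :=
    ENNReal.toReal_pos hk.ne' (measure_ne_top _ _)
  have hge' : ∀ n, 1 / 2 * μ.real {ω | traj T z (fun i => ζ i ω) k = w} ≤
      ∫ ω, survival p {z} n (traj T z (fun i => ζ i ω) k) ∂μ := by
    intro n
    have h1 : ∫ ω, {ω | traj T z (fun i => ζ i ω) k = w}.indicator (fun _ => (1 / 2 : ℝ)) ω ∂μ =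
        1 / 2 * μ.real {ω | traj T z (fun i => ζ i ω) k = w} := by
      rw [integral_indicator_const _ hm, smul_eq_mul, mul_comm]
    rw [← h1]
    refine integral_mono ((integrable_const _).indicator hm) (iS n k) fun ω => ?_
    by_cases hω : traj T z (fun i => ζ i ω) k = w
    · rw [indicator_of_mem (show ω ∈ {ω | traj T z (fun i => ζ i ω) k = w} from hω)]
      simp only [hω]
      exact hw n
    · rw [indicator_of_notMem (show ω ∉ {ω | traj T z (fun i => ζ i ω) k = w} from hω)]
      exact survival_nonneg _ _
  have := ge_of_tendsto' (hall k) hge'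
  linarith

lemma IsReflectedWalk.tail_exponent (h : IsReflectedWalk μ ζ T s₁ s₂ θ ρ ν R) (h0 : 0 < ξ)
    (hπ : ξ < Real.pi) (hξ2 : Real.pi / 2 < ξ) (hξ : Real.cos ξ = -ρ)
    (hirr : IsIrreducible μ fun z n ω => traj T z (fun i => ζ i ω) n) {r : ℝ} (hr : 0 < r) :
    ∃ r₀ : ℝ, r < r₀ ∧ ∀ z : ℕ × ℕ, r₀ < stateNorm z → Tendsto (fun n : ℕ =>
      Real.log (μ.real {ω | (n : ℕ∞) < passageTime (fun m => traj T z (fun i => ζ i ω) m) r})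
        / Real.log n) atTop (nhds (-(1 - Real.pi / (2 * ξ)))) := by
  have := h.isProbabilityMeasure
  have p₁ := h.s₁_pos
  have p₂ := h.s₂_pos
  set B : Set (ℕ × ℕ) := {z | stateNorm z ≤ r} with hB
  have hBne : B.Nonempty := ⟨0, by simp [hB, stateNorm_eq, hr.le]⟩
  have hBb : ∀ z ∈ B, size s₁ s₂ z ≤ r / s₁ + r / s₂ := by
    intro z hz
    have hz' : √((z.1 : ℝ) ^ 2 + (z.2 : ℝ) ^ 2) ≤ r := by rw [← stateNorm_eq]; exact hz
    have h1 : (z.1 : ℝ) ≤ r := (Real.le_sqrt_of_sq_le (by nlinarith)).trans hz'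
    have h2 : (z.2 : ℝ) ≤ r := (Real.le_sqrt_of_sq_le (by nlinarith)).trans hz'
    unfold size
    gcongr
  obtain ⟨r₁, hlow⟩ := h.exists_le_survival h0 hπ hξ hBb
  set S := s₁ + s₂ with hS
  -- The Euclidean norm is at most s₁ + s₂ times the normalized size, so norm above S * r₁ forces
  -- size at least r₁.
  refine ⟨max (r + 1) (S * r₁), lt_of_lt_of_le (by linarith) (le_max_left _ _), fun z hz => ?_⟩
  rw [max_lt_iff] at hz
  have hzB : z ∉ B := fun hzB => by
    have : stateNorm z ≤ r := hzB
    linarith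
  have hzs : r₁ ≤ size s₁ s₂ z := by
    have h1 : stateNorm z ≤ z.1 + z.2 := by
      rw [stateNorm_eq]
      refine Real.sqrt_le_iff.2 ⟨by positivity, ?_⟩
      have : (0 : ℝ) ≤ z.1 * z.2 := by positivity
      nlinarith
    have h2 : (z.1 : ℝ) + z.2 ≤ S * size s₁ s₂ z := by
      have e1 : S * size s₁ s₂ z = z.1 + z.2 + (s₂ * (z.1 / s₁) + s₁ * (z.2 / s₂)) := by
        rw [hS, size]; field_simp; ring
      have : 0 ≤ s₂ * ((z.1 : ℝ) / s₁) + s₁ * (z.2 / s₂) := by positivity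
      linarith
    have h3 : S * r₁ < S * size s₁ s₂ z := by linarith [hz.2]
    exact (lt_of_mul_lt_mul_left h3 (by positivity)).le
  have hev : ∀ n : ℕ,
      μ.real {ω | (n : ℕ∞) < passageTime (fun m => traj T z (fun i => ζ i ω) m) r} =
        survival (transition μ (ζ 0) T) B n z := by
    intro n
    rw [← measureReal_avoid h.iid hzB]
    simp only [lt_passageTime_iff, hB]
  simp only [hev]
  have hα : 0 < 1 - Real.pi / (2 * ξ) := by
    have : Real.pi / (2 * ξ) < 1 := by rw [div_lt_one (by positivity)]; linarith
    linarith
  have hα1 : 1 - Real.pi / (2 * ξ) < 1 / 2 := by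
    have : 1 / 2 < Real.pi / (2 * ξ) := by
      rw [div_lt_div_iff₀ (by norm_num) (by positivity)]; linarith
    linarith
  have e2 : 2 - Real.pi / ξ = 2 * (1 - Real.pi / (2 * ξ)) := by field_simp
  -- Time is the square of size, so an exponent a in n comes from a Lyapunov function of order 2a.
  refine tendsto_log_div_log hα hα1 (fun a ha haα => ?_) (fun a haα ha => ?_)
  · obtain ⟨F, hF0, _, hF⟩ := h.exists_survival_le (a := 2 * a) h0 hπ hξ (by linarith)
      (by rw [e2]; linarith) (exists_survival_lt_one h.iid hirr hBne)
    refine ⟨F z + 1, by linarith [hF0 z], ?_⟩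
    filter_upwards [eventually_gt_atTop 0] with n hn
    refine (hF n hn z).trans ?_
    rw [show 2 * a / 2 = a by ring]
    have : (0 : ℝ) ≤ (n : ℝ) ^ (-a) := by positivity
    nlinarith
  · obtain ⟨c, hc, n₀, hn₀⟩ := hlow z hzs (2 * a) (by linarith) (by linarith)
      (by rw [e2]; linarith)
    refine ⟨c, hc, ?_⟩
    filter_upwards [eventually_ge_atTop n₀] with n hn
    have := hn₀ n hn
    rwa [show 2 * a / 2 = a by ring] at this

end Main

end

end ReflectedWalk

theorem mainTheorem2 {Ω : Type*} [MeasurableSpace Ω] (μ : MeasureTheory.Measure Ω) [MeasureTheory.IsProbabilityMeasure μ]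
    (ζ : ℕ → Ω → ℤ × ℤ) (hiid : ReflectedWalk.IsIID μ ζ) (hζ : ReflectedWalk.IncrementHypothesis μ (ζ 0))
    (Z : ℕ × ℕ → ℕ → Ω → ℕ × ℕ) (hZ : Z = ReflectedWalk.lindley ζ ∨ Z = ReflectedWalk.mirror ζ)
    (hirr : ReflectedWalk.IsIrreducible μ Z) :
    (0 < ReflectedWalk.correlation μ (ζ 0) → ReflectedWalk.IsRecurrent μ Z) ∧
    (ReflectedWalk.correlation μ (ζ 0) < 0 → ReflectedWalk.IsTransient μ Z) ∧
    (0 < ReflectedWalk.correlation μ (ζ 0) → ∀ r : ℝ, 0 < r → ∃ r₀ : ℝ, r < r₀ ∧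
      ∀ z : ℕ × ℕ, r₀ < ReflectedWalk.stateNorm z →
        Filter.Tendsto
          (fun n : ℕ =>
            Real.log (μ.real {ω | (n : ℕ∞) < ReflectedWalk.passageTime (fun m => Z z m ω) r}) / Real.log n)
          Filter.atTop
          (nhds (-(1 - Real.pi / (2 * Real.arccos (-(ReflectedWalk.correlation μ (ζ 0)))))))) := by
  obtain ⟨T, s₁, s₂, θ, ν, R, h, rfl⟩ := ReflectedWalk.exists_isReflectedWalk hiid hζ hZ
  have hρ := abs_lt.1 (ReflectedWalk.abs_correlation_lt_one hζ.posDef)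
  set ρ := ReflectedWalk.correlation μ (ζ 0)
  -- The opening of the wedge, strictly between 0 and π since |ρ| < 1; it is obtuse for ρ > 0 and
  -- acute for ρ < 0.
  have hcos : Real.cos (Real.arccos (-ρ)) = -ρ := Real.cos_arccos (by linarith) (by linarith)
  have h0 : 0 < Real.arccos (-ρ) := Real.arccos_pos.2 (by linarith)
  have hπ : Real.arccos (-ρ) < Real.pi := by
    refine lt_of_le_of_ne (Real.arccos_le_pi _) fun heq => ?_
    rw [heq, Real.cos_pi] at hcos
    linarith
  have hgt : 0 < ρ → Real.pi / 2 < Real.arccos (-ρ) := fun hpos => by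
    by_contra! hle
    have := Real.cos_nonneg_of_neg_pi_div_two_le_of_le (by linarith [Real.pi_pos]) hle
    linarith
  have hlt : ρ < 0 → Real.arccos (-ρ) < Real.pi / 2 := fun hneg =>
    Real.arccos_lt_pi_div_two.2 (by linarith)
  exact ⟨fun hpos => h.recurrent h0 hπ (hgt hpos) hcos hirr,
    fun hneg => h.transient h0 (hlt hneg) hcos hirr,
    fun hpos r hr => h.tail_exponent h0 hπ (hgt hpos) hcos hirr hr⟩
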